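/- **Setting.** For each $n$ let $\{P^{(n)}_{\xi}:\xi\in\Xi\}$ be probability measures on a measurable space, with $\Xi\subset\mathbb R^m$ open, and assume that this sequence of experiments is uniformly locally asymptotically normal (ULAN) with central sequence $\Delta^{(n)}_\xi$ and information matrix $\Gamma_\xi$ of full rank $m$ for every $\xi\in\Xi$. Here a family indexed by a set $S$ is ULAN if, for every $\xi\in S$, all $\xi^{(n)}\in S$ with $\xi^{(n)}-\xi=O(n^{-1/2})$ and all bounded $\tau^{(n)}$ with $\xi^{(n)}+n^{-1/2}\tau^{(n)}\in S$, under $P^{(n)}_{\xi^{(n)}}$, $$\log\frac{dP^{(n)}_{\xi^{(n)}+n^{-1/2}\tau^{(n)}}}{dP^{(n)}_{\xi^{(n)}}}=\tau^{(n)\prime}\Delta^{(n)}_{\xi^{(n)}}-\tfrac12\tau^{(n)\prime}\Gamma_\xi\tau^{(n)}+o_P(1),\qquad \Delta^{(n)}_{\xi^{(n)}}\xrightarrow{\ \mathcal L\ }\mathcal N(0,\Gamma_\xi).$$ Let $h:\Xi\to\mathbb R^p$ be continuously differentiable, with Jacobian matrix $Dh(\xi)$ of full rank $m$ for all $\xi\in\Xi$,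 and a homeomorphism of $\Xi$ onto $\Theta:=h(\Xi)$ (so that $\Theta$ is an $m$-dimensional manifold in $\mathbb R^p$). For $\vartheta=h(\xi)$ put $P^{(n)}_\vartheta:=P^{(n)}_\xi$ and, with $D^-h(\xi):=(Dh(\xi)'Dh(\xi))^{-1}Dh(\xi)'$, $$\Delta^{(n)}_\vartheta:=(D^-h(\xi))'\Delta^{(n)}_\xi,\qquad \Gamma_\vartheta:=(D^-h(\xi))'\,\Gamma_\xi\, D^-h(\xi).$$ Let $C$ be an $r$-dimensional $C^1$ submanifold of $\mathbb R^p$, $r<p$, and consider the null hypothesis $\mathcal H_0:\vartheta\in C\cap\Theta$, equivalently $\xi\in\Xi_0:=h^{-1}(C\cap\Theta)$, where $\Xi_0$ is assumed to be an $\ell$-dimensional $C^1$ submanifold. Fix $\xi_0\in\Xi_0$ and $\vartheta_0:=h(\xi_0)$. Let $\bar l:B\subset\mathbb R^\ell\to\Xi$ be a local chart of $\Xi_0$ with $\bar l(\alpha_0)=\xi_0$, and let $\tilde b:A\subset\mathbb R^\ell\to\mathbb R^p$ be a local chart of the (affine) tangent space at $\vartheta_0$ to $C\cap\Theta$, with $\tilde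 b(\eta_0)=\vartheta_0$; local charts are regular $C^1$ parametrizations of relatively open subsets. With $A^-$ the Moore–Penrose inverse of a matrix $A$, let $$Q_{\xi_0}:=\Delta_{\xi_0}'\Bigl(\Gamma_{\xi_0}^{-1}-D\bar l(\alpha_0)\bigl(D\bar l(\alpha_0)'\Gamma_{\xi_0}D\bar l(\alpha_0)\bigr)^{-1}D\bar l(\alpha_0)'\Bigr)\Delta_{\xi_0},$$ $$Q_{\vartheta_0}:=\Delta_{\vartheta_0}'\Bigl(\Gamma_{\vartheta_0}^{-}-D\tilde b(\eta_0)\bigl(D\tilde b(\eta_0)'\Gamma_{\vartheta_0}D\tilde b(\eta_0)\bigr)^{-}D\tilde b(\eta_0)'\Bigr)\Delta_{\vartheta_0}.$$ **Stringency.** For $\alpha\in(0,1)$ let $\mathcal C_\alpha$ be the class of sequences of (possibly randomized) tests $\phi^{(n)}$ with $\limsup_n E_{\vartheta^{(n)}}\phi^{(n)}\le\alpha$ along every sequence $\vartheta^{(n)}\in C\cap\Theta$ with $\vartheta^{(n)}-\vartheta_0=O(n^{-1/2})$. The sequence $\phi^{(n)}$ is locally asymptotically most stringent at $\vartheta_0$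 (at asymptotic level $\alpha$) if it belongs to $\mathcal C_\alpha$ and minimizes over $\mathcal C_\alpha$ the maximal asymptotic regret $$\sup_{(\vartheta^{(n)})}\ \sup_{\psi\in\mathcal C_\alpha}\ \limsup_n\bigl(E_{\vartheta^{(n)}}\psi^{(n)}-E_{\vartheta^{(n)}}\phi^{(n)}\bigr),$$ the first supremum being over the sequences $\vartheta^{(n)}\in\Theta\setminus C$ with $\vartheta^{(n)}-\vartheta_0=O(n^{-1/2})$; similarly at $\xi_0$ in the $\xi$-parametrization, with $\Xi_0$ and $\Xi\setminus\Xi_0$. A statistic is called locally asymptotically most stringent if, for every $\alpha\in(0,1)$, the test rejecting when it exceeds the $\alpha$-upper quantile of the $\chi^2_{m-\ell}$ distribution is. **Proposition.** The experiments $\{P^{(n)}_\vartheta:\vartheta\in\Theta\}$ are ULAN with central sequence $\Delta^{(n)}_\vartheta$ and information matrix $\Gamma_\vartheta$; the two statistics coincide, $Q_{\xi_0}=Q_{\vartheta_0}$; this statistic is locally asymptotically most stringent for $\mathcal H_0$, at $\xi_0$ in the $\xi$-parametrization and at $\vartheta_0$ in the $\vartheta$-parametrization; and $\ell\le m$ and,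 under $P^{(n)}_{\xi_0}=P^{(n)}_{\vartheta_0}$, it is asymptotically chi-square with $m-\ell$ degrees of freedom. -/

import Mathlib

open MeasureTheory ProbabilityTheory Filter Topology Matrix
open scoped ENNReal

namespace CurvedULAN

/-- `d`-dimensional Euclidean space. -/
abbrev Euc (d : ℕ) : Type := EuclideanSpace ℝ (Fin d)

/-! ### Jacobian matrices and Moore–Penrose inverses -/

/-- The Jacobian matrix of `f` at `x`; its `(i, j)` entry is the partial derivative `∂ⱼ fᵢ (x)`. -/
noncomputable def jacobian {a b : ℕ} (f : Euc a → Euc b) (x : Euc a) :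
    Matrix (Fin b) (Fin a) ℝ :=
  Matrix.of fun i j => fderiv ℝ f x (EuclideanSpace.single j 1) i

/-- The four Penrose conditions. -/
structure IsMoorePenrose {a b : ℕ} (A : Matrix (Fin a) (Fin b) ℝ)
    (X : Matrix (Fin b) (Fin a) ℝ) : Prop where
  mul_mul_left : A * X * A = A
  mul_mul_right : X * A * X = X
  symm_left : (A * X)ᵀ = A * X
  symm_right : (X * A)ᵀ = X * A

theorem exists_isMoorePenrose_of_symm {b : ℕ} (S : Matrix (Fin b) (Fin b) ℝ) (hS : Sᵀ = S) :
    ∃ T : Matrix (Fin b) (Fin b) ℝ, Tᵀ = T ∧ IsMoorePenrose S T := by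
  have hH : S.IsHermitian := by
    rw [Matrix.IsHermitian, Matrix.conjTranspose_eq_transpose_of_trivial]; exact hS
  obtain ⟨U, d, hU, hd⟩ : ∃ (U : Matrix (Fin b) (Fin b) ℝ) (d : Fin b → ℝ),
      Uᵀ * U = 1 ∧ S = U * diagonal d * Uᵀ := by
    refine ⟨hH.eigenvectorUnitary, hH.eigenvalues, ?_, ?_⟩
    · have h := Unitary.coe_star_mul_self hH.eigenvectorUnitary
      rwa [Matrix.star_eq_conjTranspose, Matrix.conjTranspose_eq_transpose_of_trivial] at h
    · have h := hH.spectral_theorem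
      rw [Unitary.conjStarAlgAut_apply, Matrix.star_eq_conjTranspose,
        Matrix.conjTranspose_eq_transpose_of_trivial] at h
      exact h
  have key : ∀ e f : Fin b → ℝ, (U * diagonal e * Uᵀ) * (U * diagonal f * Uᵀ)
      = U * diagonal (fun i => e i * f i) * Uᵀ := by
    intro e f
    calc (U * diagonal e * Uᵀ) * (U * diagonal f * Uᵀ)
        = U * diagonal e * (Uᵀ * U) * diagonal f * Uᵀ := by simp only [Matrix.mul_assoc]
      _ = _ := by rw [hU, Matrix.mul_one, Matrix.mul_assoc U, diagonal_mul_diagonal]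
  have tr : ∀ e : Fin b → ℝ, (U * diagonal e * Uᵀ)ᵀ = U * diagonal e * Uᵀ := by
    intro e; simp [Matrix.transpose_mul, Matrix.mul_assoc]
  have c1 : (fun i => d i * (d i)⁻¹ * d i) = d := by
    funext i; exact mul_inv_mul_cancel (d i)
  have c2 : (fun i => (d i)⁻¹ * d i * (d i)⁻¹) = fun i => (d i)⁻¹ := by
    funext i; simpa using mul_inv_mul_cancel (d i)⁻¹
  refine ⟨U * diagonal (fun i => (d i)⁻¹) * Uᵀ, tr _, ?_, ?_, ?_, ?_⟩
  · rw [hd, key, key, c1]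
  · rw [hd, key, key, c2]
  · rw [hd, key, tr]
  · rw [hd, key, tr]

theorem exists_isMoorePenrose {a b : ℕ} (A : Matrix (Fin a) (Fin b) ℝ) :
    ∃ X, IsMoorePenrose A X := by
  obtain ⟨T, hT, h⟩ := exists_isMoorePenrose_of_symm (Aᵀ * A) (by simp [Matrix.transpose_mul])
  have hz : (A * (T * (Aᵀ * A)) - A)ᵀ * (A * (T * (Aᵀ * A)) - A) = 0 := by
    have h1 : (A * (T * (Aᵀ * A)) - A)ᵀ * A = 0 := by
      have h2 := h.mul_mul_left
      simp only [Matrix.transpose_sub, Matrix.transpose_mul, Matrix.transpose_transpose, hT,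
        Matrix.sub_mul, Matrix.mul_assoc] at h2 ⊢
      rw [h2, sub_self]
    rw [Matrix.mul_sub, ← Matrix.mul_assoc, h1, Matrix.zero_mul, sub_zero]
  have hA : A * (T * (Aᵀ * A)) = A := by
    rw [← Matrix.conjTranspose_eq_transpose_of_trivial] at hz
    exact sub_eq_zero.1 (Matrix.conjTranspose_mul_self_eq_zero.1 hz)
  refine ⟨T * Aᵀ, ?_, ?_, ?_, ?_⟩
  · simpa only [Matrix.mul_assoc] using hA
  · calc T * Aᵀ * A * (T * Aᵀ) = T * (Aᵀ * A) * T * Aᵀ := by simp only [Matrix.mul_assoc]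
      _ = T * Aᵀ := by rw [h.mul_mul_right]
  · simp [Matrix.transpose_mul, hT, Matrix.mul_assoc]
  · have h2 := h.symm_right
    simpa only [Matrix.mul_assoc] using h2

/-- The Moore–Penrose inverse of a real matrix. -/
noncomputable def pinv {a b : ℕ} (A : Matrix (Fin a) (Fin b) ℝ) : Matrix (Fin b) (Fin a) ℝ :=
  Classical.choose (exists_isMoorePenrose A)

theorem pinv_spec {a b : ℕ} (A : Matrix (Fin a) (Fin b) ℝ) : IsMoorePenrose A (pinv A) :=
  Classical.choose_spec (exists_isMoorePenrose A)

/-! ### Submanifolds of Euclidean space -/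

/-- `b : A ⊆ ℝ^ℓ → ℝ^d` is a (`C¹`) local chart, that is, a regular local parametrization, of `S`:
a `C¹` immersion which is a homeomorphism of the open set `A` onto a relatively open
subset of `S`. -/
structure IsLocalChart {l d : ℕ} (b : Euc l → Euc d) (A : Set (Euc l)) (S : Set (Euc d)) :
    Prop where
  isOpen_source : IsOpen A
  contDiffOn : ContDiffOn ℝ 1 b A
  rank_jacobian : ∀ a ∈ A, (jacobian b a).rank = l
  isEmbedding : IsEmbedding (A.domRestrict b)
  isOpen_image : ∃ U : Set (Euc d), IsOpen U ∧ b '' A = S ∩ U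

/-- `S` is an `l`-dimensional (`C¹`, embedded) submanifold of `ℝ^d`. -/
def IsSubmanifold {d : ℕ} (l : ℕ) (S : Set (Euc d)) : Prop :=
  ∀ x ∈ S, ∃ (b : Euc l → Euc d) (A : Set (Euc l)), IsLocalChart b A S ∧ x ∈ b '' A

/-- Tangent vectors to `S` at `x`: velocities at `x` of curves in `S`. -/
def tangentVectors {d : ℕ} (S : Set (Euc d)) (x : Euc d) : Set (Euc d) :=
  {v | ∃ γ : ℝ → Euc d, γ 0 = x ∧ (∀ᶠ t in 𝓝 (0 : ℝ), γ t ∈ S) ∧ HasDerivAt γ v 0}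

/-- The tangent to `S` at `x`, as an affine set through `x`. -/
def affineTangent {d : ℕ} (S : Set (Euc d)) (x : Euc d) : Set (Euc d) :=
  (fun v => x + v) '' tangentVectors S x

/-! ### Uniform local asymptotic normality -/

section Experiments

variable {𝓧 : ℕ → Type*} [∀ n, MeasurableSpace (𝓧 n)]

/-- A sequence in `S` at distance `O(n^{-1/2})` from `θ`. -/
def IsLocalSeq {d : ℕ} (S : Set (Euc d)) (θ : Euc d) (t : ℕ → Euc d) : Prop :=
  (∀ n, t n ∈ S) ∧ ∃ M : ℝ, ∀ n : ℕ, √(n : ℝ) * ‖t n - θ‖ ≤ M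

/-- The sequence of experiments `{P n θ : θ ∈ S}` is ULAN, at rate root-`n`, with central sequence
`Δ` and information matrix `Γ`. The log-likelihood ratio is the extended real logarithm of the
density of the absolutely continuous part, so it is `-∞` where this density vanishes. -/
structure IsULAN {d : ℕ} (P : ∀ n, Euc d → ProbabilityMeasure (𝓧 n)) (S : Set (Euc d))
    (Δ : ∀ n, Euc d → 𝓧 n → Euc d) (Γ : Euc d → Matrix (Fin d) (Fin d) ℝ) : Prop where
  measurable_central : ∀ n, ∀ θ ∈ S, Measurable (Δ n θ)
  posSemidef_info : ∀ θ ∈ S, (Γ θ).PosSemidef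
  quadratic_expansion : ∀ θ ∈ S, ∀ t : ℕ → Euc d, IsLocalSeq S θ t →
    ∀ τ : ℕ → Euc d, (∃ M : ℝ, ∀ n : ℕ, ‖τ n‖ ≤ M) →
    (∀ n, t n + (√(n : ℝ))⁻¹ • τ n ∈ S) → ∀ ε : ℝ, 0 < ε →
    Tendsto (fun n => (P n (t n) : Measure (𝓧 n))
      {x | ENNReal.ofReal ε ≤
        (ENNReal.log ((P n (t n + (√(n : ℝ))⁻¹ • τ n) : Measure (𝓧 n)).rnDeriv
            (P n (t n) : Measure (𝓧 n)) x)
          - (((τ n).ofLp ⬝ᵥ (Δ n (t n) x).ofLp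
              - 1 / 2 * ((τ n).ofLp ⬝ᵥ (Γ θ *ᵥ (τ n).ofLp)) : ℝ) : EReal)).abs})
      atTop (𝓝 0)
  asymptotic_normality : ∀ θ ∈ S, ∀ t : ℕ → Euc d, IsLocalSeq S θ t →
    TendstoInDistribution (fun n => Δ n (t n)) atTop id
      (fun n => (P n (t n) : Measure (𝓧 n))) (multivariateGaussian 0 (Γ θ))

/-! ### The curved parametrization `θ = h(ξ)`, `ξ ∈ Ξ` -/

/-- `P_θ := P_ξ` for `θ = h(ξ)`, `ξ ∈ Ξ`. -/
noncomputable def curvedModel {m p : ℕ} (h : Euc m → Euc p) (Ξ : Set (Euc m))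
    (P : ∀ n, Euc m → ProbabilityMeasure (𝓧 n)) (n : ℕ) (θ : Euc p) :
    ProbabilityMeasure (𝓧 n) :=
  P n (Function.invFunOn h Ξ θ)

/-- `D⁻h(ξ) = (Dh(ξ)' Dh(ξ))⁻¹ Dh(ξ)'`. -/
noncomputable def leftInvJacobian {m p : ℕ} (h : Euc m → Euc p) (ξ : Euc m) :
    Matrix (Fin m) (Fin p) ℝ :=
  ((jacobian h ξ)ᵀ * jacobian h ξ)⁻¹ * (jacobian h ξ)ᵀ

/-- Central sequence of the curved experiment: `Δ_θ = (D⁻h(ξ))' Δ_ξ` at `θ = h(ξ)`. -/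
noncomputable def curvedCentral {m p : ℕ} (h : Euc m → Euc p) (Ξ : Set (Euc m))
    (Δ : ∀ n, Euc m → 𝓧 n → Euc m) (n : ℕ) (θ : Euc p) (x : 𝓧 n) : Euc p :=
  WithLp.toLp 2 ((leftInvJacobian h (Function.invFunOn h Ξ θ))ᵀ *ᵥ
    (Δ n (Function.invFunOn h Ξ θ) x).ofLp)

/-- Information matrix of the curved experiment:
`Γ_θ = (D⁻h(ξ))' Γ_ξ D⁻h(ξ)` at `θ = h(ξ)`. -/
noncomputable def curvedInfo {m p : ℕ} (h : Euc m → Euc p) (Ξ : Set (Euc m))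
    (Γ : Euc m → Matrix (Fin m) (Fin m) ℝ) (θ : Euc p) : Matrix (Fin p) (Fin p) ℝ :=
  (leftInvJacobian h (Function.invFunOn h Ξ θ))ᵀ * Γ (Function.invFunOn h Ξ θ) *
    leftInvJacobian h (Function.invFunOn h Ξ θ)

/-! ### The two quadratic statistics -/

/-- `δ' (G⁻¹ - L (L' G L)⁻¹ L') δ`. -/
noncomputable def flatStatistic {m l : ℕ} (δ : Euc m) (G : Matrix (Fin m) (Fin m) ℝ)
    (L : Matrix (Fin m) (Fin l) ℝ) : ℝ :=
  δ.ofLp ⬝ᵥ ((G⁻¹ - L * (Lᵀ * G * L)⁻¹ * Lᵀ) *ᵥ δ.ofLp)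

/-- `δ' (G⁻ - B (B' G B)⁻ B') δ`, with Moore–Penrose inverses. -/
noncomputable def curvedStatistic {p l : ℕ} (δ : Euc p) (G : Matrix (Fin p) (Fin p) ℝ)
    (B : Matrix (Fin p) (Fin l) ℝ) : ℝ :=
  δ.ofLp ⬝ᵥ ((pinv G - B * pinv (Bᵀ * G * B) * Bᵀ) *ᵥ δ.ofLp)

/-! ### Local asymptotic stringency -/

/-- A sequence of (possibly randomized) tests. -/
def IsTest (φ : ∀ n, 𝓧 n → ℝ) : Prop :=
  ∀ n, Measurable (φ n) ∧ ∀ x, φ n x ∈ Set.Icc (0 : ℝ) 1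

/-- The power `E_{P n θ}[φ n]`. -/
noncomputable def power {d : ℕ} (P : ∀ n, Euc d → ProbabilityMeasure (𝓧 n))
    (φ : ∀ n, 𝓧 n → ℝ) (n : ℕ) (θ : Euc d) : ℝ :=
  ∫ x, φ n x ∂(P n θ : Measure (𝓧 n))

/-- The class of sequences of tests for `H₀ : θ ∈ N` that have asymptotic level `α` locally
at `θ₀`: asymptotic size at most `α` along each root-`n` sequence in `N`. -/
def levelClass {d : ℕ} (P : ∀ n, Euc d → ProbabilityMeasure (𝓧 n)) (N : Set (Euc d))
    (θ₀ : Euc d) (α : ℝ) : Set (∀ n, 𝓧 n → ℝ) :=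
  {φ | IsTest φ ∧ ∀ t : ℕ → Euc d, IsLocalSeq N θ₀ t →
    limsup (fun n => ((power P φ n (t n) : ℝ) : EReal)) atTop ≤ (α : EReal)}

/-- The asymptotic regret of `φ` along the sequence `t`: the largest asymptotic shortfall in power
relative to the competing sequences of tests in the class of level `α`. -/
noncomputable def regret {d : ℕ} (P : ∀ n, Euc d → ProbabilityMeasure (𝓧 n))
    (N : Set (Euc d)) (θ₀ : Euc d) (α : ℝ) (φ : ∀ n, 𝓧 n → ℝ) (t : ℕ → Euc d) : EReal :=
  ⨆ ψ ∈ levelClass P N θ₀ α,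
    limsup (fun n => ((power P ψ n (t n) - power P φ n (t n) : ℝ) : EReal)) atTop

/-- The maximal asymptotic regret of `φ` over the local alternatives, that is, the root-`n`
sequences in `S \ N`. -/
noncomputable def maxRegret {d : ℕ} (P : ∀ n, Euc d → ProbabilityMeasure (𝓧 n))
    (S N : Set (Euc d)) (θ₀ : Euc d) (α : ℝ) (φ : ∀ n, 𝓧 n → ℝ) : EReal :=
  ⨆ t ∈ {t : ℕ → Euc d | IsLocalSeq (S \ N) θ₀ t}, regret P N θ₀ α φ t

/-- `φ` is locally asymptotically most stringent at `θ₀`, at asymptotic level `α`, for testing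
`H₀ : θ ∈ N` in the experiments `{P n θ : θ ∈ S}`: it has asymptotic level `α` and minimizes the
maximal asymptotic regret over all sequences of tests of asymptotic level `α`. -/
def IsLocallyAsymptoticallyMostStringent {d : ℕ} (P : ∀ n, Euc d → ProbabilityMeasure (𝓧 n))
    (S N : Set (Euc d)) (θ₀ : Euc d) (α : ℝ) (φ : ∀ n, 𝓧 n → ℝ) : Prop :=
  φ ∈ levelClass P N θ₀ α ∧
    ∀ ψ ∈ levelClass P N θ₀ α, maxRegret P S N θ₀ α φ ≤ maxRegret P S N θ₀ α ψ

/-- The chi-square distribution with `k` degrees of freedom (the Dirac mass at `0` for `k = 0`). -/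
noncomputable def chiSquare (k : ℕ) : Measure ℝ :=
  (stdGaussian (Euc k)).map (fun z => ‖z‖ ^ 2)

instance (k : ℕ) : IsProbabilityMeasure (chiSquare k) :=
  Measure.isProbabilityMeasure_map (by fun_prop)

/-- The `α`-upper quantile of the chi-square distribution with `k` degrees of freedom. -/
noncomputable def chiSquareUpperQuantile (k : ℕ) (α : ℝ) : ℝ :=
  sInf {c : ℝ | chiSquare k (Set.Ioi c) ≤ ENNReal.ofReal α}

/-- The test rejecting when `Q` exceeds the `α`-upper quantile of `χ²(k)`. -/
noncomputable def chiSquareTest (k : ℕ) (α : ℝ) (Q : ∀ n, 𝓧 n → ℝ) (n : ℕ) : 𝓧 n → ℝ :=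
  Set.indicator {x | chiSquareUpperQuantile k α < Q n x} 1

/-- The statistic `Q` (with asymptotic `χ²(k)` critical values) is locally asymptotically most
stringent at `θ₀` for `H₀ : θ ∈ N`: so is its test at each level `α ∈ (0, 1)`. -/
def IsMostStringentStatistic {d : ℕ} (P : ∀ n, Euc d → ProbabilityMeasure (𝓧 n))
    (S N : Set (Euc d)) (θ₀ : Euc d) (k : ℕ) (Q : ∀ n, 𝓧 n → ℝ) : Prop :=
  ∀ α : ℝ, 0 < α → α < 1 →
    IsLocallyAsymptoticallyMostStringent P S N θ₀ α (chiSquareTest k α Q)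

end Experiments

end CurvedULAN

/-! Whitening reduces the problem to a Gaussian shift. Let `L` be the Jacobian of the chart of the
null set and `k = m - l`. There is a `k × m` matrix `A` with `A Γ A' = 1`, `A Γ L = 0` and `A' A =
Γ⁻¹ - L (L' Γ L)⁻¹ L'` (`exists_whitening`), so the statistic is `‖A Δ‖²`. By ULAN and Le Cam's
third lemma, along a root-`n` sequence with direction `τ` the vector `A Δ` converges to a standard
Gaussian vector shifted by `v = A Γ τ`. Null sequences have directions in the range of `L`, hence `v
= 0`; this gives the chi-square limit and the asymptotic level.

For stringency, two bounds are matched. Against direction `τ`, testing against the null sequence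
whose direction is the `Γ`-projection of `τ` on the tangent space bounds the power of every test of
the class by `P(N(0,1) > z - ‖v‖)` (`IsULAN.eventually_power_le`). The chi-square test has limiting
power `normSqPower c v`, a function of `‖v‖` only, so its regret is at most the gap between the two.
Conversely (`IsULAN.le_maxRegret`), for every `v ≠ 0` every test of the class suffers at least this
gap. Mix the shifts uniformly over the sphere of radius `‖v‖`: the likelihood ratio of the mixture
is a convex radial function, hence nondecreasing in the norm (`sphereLR_mono`), so the
Neyman–Pearson region against the mixture is the chi-square region. No test of the class can beat it
on average over the sphere, so at some shift its power is at most `normSqPower c v`, up to an error,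
whereas a linear test against that shift reaches the envelope.

The passage to the limit rests on the dual Neyman–Pearson inequality `E[ψ g] ≤ K E[ψ] + E[(g -
K)⁺]`, which survives weak convergence once likelihood ratios are truncated and mixtures are made
finite (`exists_finite_mixture`). Ultrafilters play the role of convergent subsequences.

The curved half is differential geometry and matrix algebra. Since `h` is a strictly differentiable
immersion and a homeomorphism onto its image, root-`n` sequences in both parametrizations
correspond, and rescaled increments are related by `D⁻h` up to `o(1)`. This carries over ULAN and,
powers being unchanged, stringency. With `J = Dh`, the Moore–Penrose inverse of the curved
information is `J Γ⁻¹ J'`, and a chart of the tangent has Jacobian `J L M` with `M` invertible; `M`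
cancels and the statistics agree (`curvedStatistic_eq_flatStatistic`). -/

namespace CurvedULAN

/-! ### Shifts of the standard Gaussian measure and its null sets -/

section Gaussian

open scoped RealInnerProductSpace

variable {E : Type*} [NormedAddCommGroup E] [InnerProductSpace ℝ E]

/-- The density of the standard Gaussian measure shifted by `v` with respect to the unshifted
one. -/
noncomputable def gaussianLR (v x : E) : ℝ := Real.exp (⟪v, x⟫ - ‖v‖ ^ 2 / 2)

theorem gaussianLR_pos (v x : E) : 0 < gaussianLR v x := Real.exp_pos _

@[fun_prop]
theorem continuous_gaussianLR (v : E) : Continuous (gaussianLR v) := by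
  unfold gaussianLR; fun_prop

variable [FiniteDimensional ℝ E] [MeasurableSpace E] [BorelSpace E]

theorem stdGaussian_map_inner (v : E) :
    (stdGaussian E).map (fun x => ⟪v, x⟫) = gaussianReal 0 (‖v‖ ^ 2).toNNReal := by
  have h := IsGaussian.map_eq_gaussianReal (μ := stdGaussian E) (innerSL ℝ v)
  rw [integral_strongDual_stdGaussian, variance_dual_stdGaussian, innerSL_apply_norm] at h
  exact h

theorem mgf_inner_stdGaussian (v : E) (t : ℝ) :
    mgf (fun x => ⟪v, x⟫) (stdGaussian E) t = Real.exp (‖v‖ ^ 2 * t ^ 2 / 2) := by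
  rw [mgf_gaussianReal (stdGaussian_map_inner v)]
  simp

theorem integrable_exp_inner_stdGaussian (v : E) :
    Integrable (fun x => Real.exp ⟪v, x⟫) (stdGaussian E) := by
  have h : 0 < mgf (fun x => ⟪v, x⟫) (stdGaussian E) 1 := by
    rw [mgf_inner_stdGaussian]; positivity
  simpa using (mgf_pos_iff.1 h)

theorem integral_exp_inner_stdGaussian (v : E) :
    ∫ x, Real.exp ⟪v, x⟫ ∂(stdGaussian E) = Real.exp (‖v‖ ^ 2 / 2) := by
  simpa [mgf] using mgf_inner_stdGaussian v 1

theorem integrable_gaussianLR (v : E) : Integrable (gaussianLR v) (stdGaussian E) := by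
  unfold gaussianLR
  simp only [Real.exp_sub]
  exact (integrable_exp_inner_stdGaussian v).div_const _

theorem integral_gaussianLR (v : E) : ∫ x, gaussianLR v x ∂(stdGaussian E) = 1 := by
  simp only [gaussianLR, Real.exp_sub]
  rw [integral_div, integral_exp_inner_stdGaussian, div_self (Real.exp_pos _).ne']

theorem isProbabilityMeasure_withDensity_gaussianLR (v : E) :
    IsProbabilityMeasure
      ((stdGaussian E).withDensity fun x => ENNReal.ofReal (gaussianLR v x)) := by
  constructor
  rw [withDensity_apply _ MeasurableSet.univ, Measure.restrict_univ,
    ← ofReal_integral_eq_lintegral_ofReal (integrable_gaussianLR v)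
      (ae_of_all _ fun x => (gaussianLR_pos v x).le), integral_gaussianLR, ENNReal.ofReal_one]

/-- The Cameron–Martin formula for the standard Gaussian measure. -/
theorem stdGaussian_withDensity_gaussianLR (v : E) :
    (stdGaussian E).withDensity (fun x => ENNReal.ofReal (gaussianLR v x)) =
      (stdGaussian E).map (fun x => x + v) := by
  have := isProbabilityMeasure_withDensity_gaussianLR v
  have hp : IsProbabilityMeasure ((stdGaussian E).map (fun x => x + v)) :=
    Measure.isProbabilityMeasure_map (by fun_prop)
  have hmeas : Measurable fun x => ENNReal.ofReal (gaussianLR v x) := by fun_prop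
  set ν := (stdGaussian E).withDensity (fun x => ENNReal.ofReal (gaussianLR v x)) with hν
  have hmgf1 : ∀ s : E, ∀ u : ℝ, mgf (fun x => ⟪s, x⟫) ν u
      = Real.exp (u * ⟪s, v⟫ + ‖s‖ ^ 2 * u ^ 2 / 2) := by
    intro s u
    rw [mgf, hν, integral_withDensity_eq_integral_toReal_smul hmeas (by simp)]
    have : ∀ x, (ENNReal.ofReal (gaussianLR v x)).toReal • Real.exp (u * ⟪s, x⟫)
        = Real.exp ⟪u • s + v, x⟫ * Real.exp (-(‖v‖ ^ 2 / 2)) := by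
      intro x
      rw [ENNReal.toReal_ofReal (gaussianLR_pos v x).le, smul_eq_mul, gaussianLR, ← Real.exp_add,
        ← Real.exp_add, inner_add_left, real_inner_smul_left]
      congr 1; ring
    simp_rw [this]
    rw [integral_mul_const, integral_exp_inner_stdGaussian, ← Real.exp_add]
    congr 1
    rw [norm_add_sq_real, norm_smul, real_inner_smul_left, mul_pow, Real.norm_eq_abs, sq_abs]
    ring
  have hmgf2 : ∀ s : E, ∀ u : ℝ, mgf (fun x => ⟪s, x⟫) ((stdGaussian E).map (fun x => x + v)) u
      = Real.exp (u * ⟪s, v⟫ + ‖s‖ ^ 2 * u ^ 2 / 2) := by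
    intro s u
    rw [mgf, integral_map (by fun_prop) (by fun_prop)]
    have : ∀ x, Real.exp (u * ⟪s, x + v⟫) = Real.exp (u * ⟪s, v⟫) * Real.exp (u * ⟪s, x⟫) := by
      intro x
      rw [← Real.exp_add, inner_add_right]; congr 1; ring
    simp_rw [this]
    rw [integral_const_mul, Real.exp_add]
    congr 1
    exact mgf_inner_stdGaussian s u
  refine Measure.ext_of_charFun ?_
  funext s
  have hset : integrableExpSet (fun x => ⟪s, x⟫) ν = Set.univ := by
    refine Set.eq_univ_of_forall fun u => ?_
    have h : 0 < mgf (fun x => ⟪s, x⟫) ν u := by rw [hmgf1]; positivity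
    exact mgf_pos_iff.1 h
  -- Both moment generating functions are finite on the whole line and equal, so their analytic
  -- extensions agree; at `I` these are the characteristic functions.
  have h := eqOn_complexMGF_of_mgf (X := fun x => ⟪s, x⟫) (Y := fun x => ⟪s, x⟫) (μ := ν)
    (μ' := (stdGaussian E).map (fun x => x + v)) (by funext u; rw [hmgf1, hmgf2])
  have h2 := h (x := Complex.I) (by rw [hset]; simp)
  simp only [complexMGF] at h2
  rw [charFun_apply, charFun_apply]
  convert h2 using 4 with x x
  · rw [mul_comm, real_inner_comm]
  · rw [mul_comm, real_inner_comm]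

theorem lintegral_gaussianLR_mul (v : E) {f : E → ℝ≥0∞} (hf : Measurable f) :
    ∫⁻ x, ENNReal.ofReal (gaussianLR v x) * f x ∂(stdGaussian E)
      = ∫⁻ x, f (x + v) ∂(stdGaussian E) := by
  rw [← lintegral_map hf (by fun_prop), ← stdGaussian_withDensity_gaussianLR,
    lintegral_withDensity_eq_lintegral_mul _ (by fun_prop) hf]
  rfl

theorem integral_indicator_gaussianLR (v : E) {s : Set E} (hs : MeasurableSet s) :
    ∫ x, s.indicator (gaussianLR v) x ∂(stdGaussian E)
      = (stdGaussian E).real {x | x + v ∈ s} := by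
  rw [integral_eq_lintegral_of_nonneg_ae
    (ae_of_all _ fun x => Set.indicator_nonneg (fun y _ => (gaussianLR_pos v y).le) x)
    ((continuous_gaussianLR v).measurable.indicator hs).aestronglyMeasurable, measureReal_def]
  congr 1
  have h := lintegral_gaussianLR_mul v (f := s.indicator 1) (measurable_one.indicator hs)
  have h1 : ∀ x, ENNReal.ofReal (s.indicator (gaussianLR v) x)
      = ENNReal.ofReal (gaussianLR v x) * s.indicator 1 x := by
    intro x; by_cases hx : x ∈ s <;> simp [hx]
  simp_rw [h1]
  rw [h]
  have h2 : (fun x => s.indicator (1 : E → ℝ≥0∞) (x + v))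
      = ((fun x => x + v) ⁻¹' s).indicator 1 := by
    rfl
  rw [h2, lintegral_indicator_one (by measurability)]
  rfl

/-- The standard Gaussian measure is absolutely continuous. -/
theorem stdGaussian_absolutelyContinuous : stdGaussian E ≪ (volume : Measure E) := by
  refine Measure.AbsolutelyContinuous.mk fun s hs h0 => ?_
  -- Fubini against Lebesgue measure, for which all translates of `s` are null. Hence some translate
  -- is Gaussian null, and the positive Cameron–Martin density brings this back to `s`.
  have h1 : ∫⁻ v : E, (stdGaussian E) {x | x + v ∈ s} = 0 := by
    have hm : MeasurableSet {q : E × E | q.2 + q.1 ∈ s} :=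
      (measurable_snd.add measurable_fst) hs
    have h2 := Measure.prod_apply (μ := (volume : Measure E)) (ν := stdGaussian E) hm
    have h3 := Measure.prod_apply_symm (μ := (volume : Measure E)) (ν := stdGaussian E) hm
    have h4 : ∀ y : E, (volume : Measure E) ((fun x : E => (x, y)) ⁻¹' {q : E × E | q.2 + q.1 ∈ s})
        = 0 := by
      intro y
      rw [← h0, ← measure_preimage_add volume y s]; rfl
    rw [h3] at h2
    rw [lintegral_congr h4, lintegral_zero] at h2
    exact h2.symm
  have hmv : Measurable fun v : E => (stdGaussian E) {x | x + v ∈ s} := by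
    have hm : MeasurableSet {q : E × E | q.2 + q.1 ∈ s} :=
      (measurable_snd.add measurable_fst) hs
    exact measurable_measure_prodMk_left hm
  rw [lintegral_eq_zero_iff hmv] at h1
  obtain ⟨v, hv⟩ := h1.exists
  have h5 : (stdGaussian E).withDensity (fun x => ENNReal.ofReal (gaussianLR v x)) s = 0 := by
    rw [stdGaussian_withDensity_gaussianLR, Measure.map_apply (by fun_prop) hs]; exact hv
  exact withDensity_absolutelyContinuous' (by fun_prop)
    (ae_of_all _ fun x => by simpa using (gaussianLR_pos v x)) h5

/-- Spheres are Lebesgue null. In dimension zero the sphere of radius zero is the whole space,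
whence `Nontrivial`. -/
theorem stdGaussian_norm_sq_eq [Nontrivial E] (v : E) (c : ℝ) :
    stdGaussian E {x | ‖x + v‖ ^ 2 = c} = 0 := by
  refine stdGaussian_absolutelyContinuous ?_
  refine measure_mono_null ?_ (Measure.addHaar_sphere (volume : Measure E) (-v) (√c))
  intro x hx
  simp only [Set.mem_ofPred_eq] at hx
  simp [← hx]

theorem stdGaussian_inner_eq {u : E} (hu : u ≠ 0) (v : E) (c : ℝ) :
    stdGaussian E {x | ⟪u, x + v⟫ = c} = 0 := by
  have h : {x | ⟪u, x + v⟫ = c} = (fun x => ⟪u, x⟫) ⁻¹' {c - ⟪u, v⟫} := by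
    ext x; simp [inner_add_right, eq_sub_iff_add_eq]
  rw [h, ← Measure.map_apply (by fun_prop) (measurableSet_singleton _), stdGaussian_map_inner]
  have : NullSingletonClass (gaussianReal 0 (‖u‖ ^ 2).toNNReal) := by
    apply nullSingletonClass_gaussianReal
    simpa using hu
  exact measure_singleton _

theorem stdGaussian_lt_inner {u : E} (hu : ‖u‖ = 1) (v : E) (z : ℝ) :
    stdGaussian E {x | z < ⟪u, x + v⟫} = gaussianReal 0 1 (Set.Ioi (z - ⟪u, v⟫)) := by
  have h : {x | z < ⟪u, x + v⟫} = (fun x => ⟪u, x⟫) ⁻¹' Set.Ioi (z - ⟪u, v⟫) := by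
    ext x; simp [inner_add_right, sub_lt_iff_lt_add]
  rw [h, ← Measure.map_apply (by fun_prop) measurableSet_Ioi, stdGaussian_map_inner, hu]
  simp

end Gaussian

/-! ### Quantiles -/

theorem continuous_cdf_of_null_singleton (μ : Measure ℝ) [IsProbabilityMeasure μ]
    (hμ : ∀ x, μ {x} = 0) : Continuous (cdf μ) := by
  refine continuous_iff_continuousAt.2 fun x => ?_
  rw [(monotone_cdf μ).continuousAt_iff_leftLim_eq_rightLim, (cdf μ).rightLim_eq]
  have h := (cdf μ).measure_singleton x
  rw [measure_cdf, hμ, eq_comm, ENNReal.ofReal_eq_zero] at h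
  exact le_antisymm ((monotone_cdf μ).leftLim_le le_rfl) (by linarith)

theorem measureReal_Ioi_eq_one_sub_cdf (μ : Measure ℝ) [IsProbabilityMeasure μ] (c : ℝ) :
    μ.real (Set.Ioi c) = 1 - cdf μ c := by
  rw [cdf_eq_real, ← Set.compl_Iic, probReal_compl_eq_one_sub measurableSet_Iic]

/-- Without atoms the distribution function is continuous, so the level is attained at some `c₀` and
the set defining the quantile is closed. Its infimum belongs to it, so the tail is at most `α`, and
lies below `c₀`, so the tail is at least `α`. -/
theorem measureReal_Ioi_sInf_eq (μ : Measure ℝ) [IsProbabilityMeasure μ] (hμ : ∀ x, μ {x} = 0)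
    {α : ℝ} (h0 : 0 < α) (h1 : α < 1) :
    μ.real (Set.Ioi (sInf {c : ℝ | μ (Set.Ioi c) ≤ ENNReal.ofReal α})) = α := by
  have hS : {c : ℝ | μ (Set.Ioi c) ≤ ENNReal.ofReal α} = {c : ℝ | 1 - α ≤ cdf μ c} := by
    ext c
    rw [Set.mem_ofPred_eq, Set.mem_ofPred_eq, ← ENNReal.toReal_le_toReal (measure_ne_top _ _)
      ENNReal.ofReal_ne_top, ENNReal.toReal_ofReal h0.le, ← measureReal_def,
      measureReal_Ioi_eq_one_sub_cdf]
    constructor <;> intro h <;> linarith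
  have hcont := continuous_cdf_of_null_singleton μ hμ
  obtain ⟨c₀, hc₀⟩ : ∃ c, cdf μ c = 1 - α := by
    refine mem_range_of_exists_le_of_exists_ge hcont ?_ ?_
    · exact (((tendsto_cdf_atBot μ).eventually_lt_const (by linarith : (0 : ℝ) < 1 - α)).exists).imp
        fun _ h => h.le
    · exact (((tendsto_cdf_atTop μ).eventually_const_lt (by linarith : 1 - α < (1 : ℝ))).exists).imp
        fun _ h => h.le
  have hbdd : BddBelow {c : ℝ | 1 - α ≤ cdf μ c} := by
    obtain ⟨b, hb⟩ := ((tendsto_cdf_atBot μ).eventually_lt_const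
      (by linarith : (0 : ℝ) < 1 - α)).exists
    refine ⟨b, fun c hc => ?_⟩
    by_contra hlt
    have := monotone_cdf μ (not_le.1 hlt).le
    have hc' : 1 - α ≤ cdf μ c := hc
    linarith
  have hclosed : IsClosed {c : ℝ | 1 - α ≤ cdf μ c} := isClosed_le continuous_const hcont
  have hmem : 1 - α ≤ cdf μ (sInf {c : ℝ | 1 - α ≤ cdf μ c}) :=
    hclosed.csInf_mem ⟨c₀, hc₀.ge⟩ hbdd
  have hle := monotone_cdf μ (csInf_le hbdd (show c₀ ∈ {c : ℝ | 1 - α ≤ cdf μ c} from hc₀.ge))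
  rw [hS, measureReal_Ioi_eq_one_sub_cdf]
  linarith

/-! ### Neyman–Pearson duality and rotation invariance -/

section NeymanPearson

open scoped RealInnerProductSpace

theorem measurableSet_lt_norm_sq {E : Type*} [NormedAddCommGroup E] [MeasurableSpace E]
    [OpensMeasurableSpace E] (c : ℝ) : MeasurableSet {x : E | c < ‖x‖ ^ 2} :=
  measurableSet_lt measurable_const (by fun_prop)

variable {E : Type*} [NormedAddCommGroup E] [InnerProductSpace ℝ E]

/-- A bound uniform over the shifts in a ball, integrable by `integrable_exp_mul_norm_stdGaussian`;
it serves as the dominating function throughout. -/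
theorem gaussianLR_le {v : E} {δ : ℝ} (hv : ‖v‖ ≤ δ) (x : E) :
    gaussianLR v x ≤ Real.exp (δ * ‖x‖) := by
  refine Real.exp_le_exp.2 ?_
  have h1 := real_inner_le_norm v x
  have h2 := mul_le_mul_of_nonneg_right hv (norm_nonneg x)
  nlinarith [sq_nonneg ‖v‖]

@[fun_prop]
theorem continuous_uncurry_gaussianLR : Continuous fun q : E × E => gaussianLR q.1 q.2 := by
  unfold gaussianLR; fun_prop

/-- Radial projection onto the sphere of radius `δ`. -/
noncomputable def radial (δ : ℝ) (z : E) : E := (δ / ‖z‖) • z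

theorem norm_radial {δ : ℝ} (hδ : 0 ≤ δ) {z : E} (hz : z ≠ 0) : ‖radial δ z‖ = δ := by
  have : ‖z‖ ≠ 0 := norm_ne_zero_iff.2 hz
  rw [radial, norm_smul, Real.norm_eq_abs, abs_of_nonneg (by positivity)]
  field_simp

theorem norm_radial_le {δ : ℝ} (hδ : 0 ≤ δ) (z : E) : ‖radial δ z‖ ≤ δ := by
  rcases eq_or_ne z 0 with rfl | hz
  · simpa [radial] using hδ
  · exact (norm_radial hδ hz).le

/-- Equivariance makes the image of the standard Gaussian under `radial δ` rotation invariant, so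
this image replaces the surface measure of the sphere. -/
theorem radial_isometry (δ : ℝ) (R : E ≃ₗᵢ[ℝ] E) (z : E) : radial δ (R z) = R (radial δ z) := by
  simp [radial]

theorem gaussianLR_isometry (R : E ≃ₗᵢ[ℝ] E) (v x : E) :
    gaussianLR (R v) (R x) = gaussianLR v x := by
  simp [gaussianLR]

/-- The reflection in the hyperplane orthogonal to `x - y` exchanges the two points. -/
theorem exists_isometry_of_norm_eq {x y : E} (h : ‖x‖ = ‖y‖) : ∃ R : E ≃ₗᵢ[ℝ] E, R x = y :=
  ⟨(ℝ ∙ (x - y))ᗮ.reflection, Submodule.reflection_sub h⟩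

variable [FiniteDimensional ℝ E] [MeasurableSpace E] [BorelSpace E]

theorem integrable_exp_mul_norm_stdGaussian (δ : ℝ) :
    Integrable (fun x => Real.exp (δ * ‖x‖)) (stdGaussian E) := by
  obtain ⟨C, hC, hint⟩ := IsGaussian.exists_integrable_exp_sq (stdGaussian E)
  refine (hint.mul_const (Real.exp (δ ^ 2 / (4 * C)))).mono' (by fun_prop)
    (ae_of_all _ fun x => ?_)
  rw [Real.norm_eq_abs, Real.abs_exp, ← Real.exp_add]
  refine Real.exp_le_exp.2 ?_
  -- Completing the square reduces to Fernique's integrability of `exp (C ‖x‖²)`.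
  have h : C * ‖x‖ ^ 2 + δ ^ 2 / (4 * C) - δ * ‖x‖ = C * (‖x‖ - δ / (2 * C)) ^ 2 := by
    field_simp; ring
  nlinarith [mul_nonneg hC.le (sq_nonneg (‖x‖ - δ / (2 * C)))]

theorem measurable_radial (δ : ℝ) : Measurable (radial δ : E → E) := by
  unfold radial; fun_prop

theorem ae_ne_zero_stdGaussian [Nontrivial E] : ∀ᵐ z ∂(stdGaussian E), z ≠ 0 := by
  have h := stdGaussian_norm_sq_eq (0 : E) 0
  rw [ae_iff]
  simpa using h

/-- The power, against the shift `v`, of the test rejecting for `c < ‖x‖²`. -/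
noncomputable def normSqPower (c : ℝ) (v : E) : ℝ := (stdGaussian E).real {x | c < ‖x + v‖ ^ 2}

theorem normSqPower_eq_of_norm_eq (c : ℝ) {v w : E} (h : ‖v‖ = ‖w‖) :
    normSqPower c v = normSqPower c w := by
  obtain ⟨R, hR⟩ := exists_isometry_of_norm_eq h
  have hm : MeasurableSet {x : E | c < ‖x + w‖ ^ 2} :=
    measurableSet_lt measurable_const (by fun_prop)
  unfold normSqPower
  conv_rhs => rw [← stdGaussian_map R, map_measureReal_apply R.continuous.measurable hm]
  congr 1
  ext x
  simp [← hR, ← map_add]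

theorem normSqPower_eq_integral (c : ℝ) (v : E) :
    normSqPower c v = ∫ x, {x : E | c < ‖x‖ ^ 2}.indicator (gaussianLR v) x ∂(stdGaussian E) :=
  (integral_indicator_gaussianLR v (measurableSet_lt_norm_sq c)).symm

/-- If the rejection region `s` is, up to ties, where the likelihood ratio `g` exceeds `K`, then
the dual Neyman–Pearson bound is attained. -/
theorem integral_indicator_eq_of_neymanPearson {Ω : Type*} [MeasurableSpace Ω] {μ : Measure Ω}
    [IsProbabilityMeasure μ] {g : Ω → ℝ} (hg : Integrable g μ) {s : Set Ω} (hs : MeasurableSet s)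
    {K : ℝ} (h1 : ∀ x ∈ s, K ≤ g x) (h2 : ∀ x ∉ s, g x ≤ K) :
    K * μ.real s + ∫ x, max (g x - K) 0 ∂μ = ∫ x, s.indicator g x ∂μ := by
  have h3 : ∀ x, max (g x - K) 0 = s.indicator g x - s.indicator (fun _ => K) x := by
    intro x
    by_cases hx : x ∈ s
    · simp [hx, h1 x hx]
    · simp [hx, h2 x hx]
  simp_rw [h3]
  rw [integral_sub (hg.indicator hs) ((integrable_const K).indicator hs),
    integral_indicator_const _ hs, smul_eq_mul]
  ring

/-- Weak duality, from `1_s (g - K) ≤ (g - K)⁺` pointwise. It holds for every region and every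
multiplier. -/
theorem integral_indicator_le_of_neymanPearson {Ω : Type*} [MeasurableSpace Ω] {μ : Measure Ω}
    [IsProbabilityMeasure μ] {g : Ω → ℝ} (hg : Integrable g μ) {s : Set Ω} (hs : MeasurableSet s)
    (K : ℝ) :
    ∫ x, s.indicator g x ∂μ ≤ K * μ.real s + ∫ x, max (g x - K) 0 ∂μ := by
  have h : ∫ x, s.indicator g x - s.indicator (fun _ => K) x ∂μ ≤ ∫ x, max (g x - K) 0 ∂μ := by
    refine integral_mono ((hg.indicator hs).sub ((integrable_const K).indicator hs))
      ((hg.sub (integrable_const K)).sup (integrable_zero _ _ _)) fun x => ?_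
    by_cases hx : x ∈ s <;> simp [hx]
  rw [integral_sub (hg.indicator hs) ((integrable_const K).indicator hs),
    integral_indicator_const _ hs, smul_eq_mul] at h
  linarith

/-- Equality in the duality for the half-space `z < ⟪u, x⟫`, where `u = v / ‖v‖`: the likelihood
ratio increases with `⟪u, x⟫` and equals the multiplier exactly where `⟪u, x⟫ = z`. -/
theorem neymanPearson_gaussian (v : E) (z : ℝ) :
    Real.exp (‖v‖ * z - ‖v‖ ^ 2 / 2) * (gaussianReal 0 1).real (Set.Ioi z)
      + ∫ x, max (gaussianLR v x - Real.exp (‖v‖ * z - ‖v‖ ^ 2 / 2)) 0 ∂(stdGaussian E)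
      = (gaussianReal 0 1).real (Set.Ioi (z - ‖v‖)) := by
  rcases eq_or_ne v 0 with rfl | hv
  · simp [gaussianLR]
  have hv' : 0 < ‖v‖ := norm_pos_iff.2 hv
  set u : E := ‖v‖⁻¹ • v with hu
  have hu1 : ‖u‖ = 1 := by rw [hu, norm_smul, norm_inv, norm_norm, inv_mul_cancel₀ hv'.ne']
  have hvu : v = ‖v‖ • u := by rw [hu, smul_inv_smul₀ hv'.ne']
  have huv : ⟪u, v⟫ = ‖v‖ := by
    rw [hu, real_inner_smul_left, real_inner_self_eq_norm_sq]; field_simp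
  have hs : MeasurableSet {x : E | z < ⟪u, x⟫} := measurableSet_lt measurable_const (by fun_prop)
  have hlr : ∀ x, gaussianLR v x = Real.exp (‖v‖ * ⟪u, x⟫ - ‖v‖ ^ 2 / 2) := by
    intro x
    rw [gaussianLR]
    conv_lhs => rw [show ⟪v, x⟫ = ‖v‖ * ⟪u, x⟫ by
      rw [hu, real_inner_smul_left, mul_inv_cancel_left₀ hv'.ne']]
  have h := integral_indicator_eq_of_neymanPearson (integrable_gaussianLR v) hs
    (K := Real.exp (‖v‖ * z - ‖v‖ ^ 2 / 2)) ?_ ?_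
  · have e1 : (stdGaussian E).real {x : E | z < ⟪u, x⟫} = (gaussianReal 0 1).real (Set.Ioi z) := by
      have := stdGaussian_lt_inner hu1 (0 : E) z
      simp only [add_zero, inner_zero_right, sub_zero] at this
      rw [measureReal_def, measureReal_def, this]
    have e2 := stdGaussian_lt_inner hu1 v z
    rw [e1, integral_indicator_gaussianLR v hs] at h
    rw [h, measureReal_def, measureReal_def, ← huv, ← e2]
    rfl
  · intro x hx
    have hx' : z < ⟪u, x⟫ := hx
    rw [hlr]
    exact Real.exp_le_exp.2 (by nlinarith)
  · intro x hx
    have hx' : ⟪u, x⟫ ≤ z := not_lt.1 hx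
    rw [hlr]
    exact Real.exp_le_exp.2 (by nlinarith)

/-- Weak duality for the chi-square region, with the multiplier that is exact for the half-space of
the same level. -/
theorem normSqPower_le_of_level_eq {c z : ℝ}
    (hcz : normSqPower c (0 : E) = (gaussianReal 0 1).real (Set.Ioi z)) (v : E) :
    normSqPower c v ≤ (gaussianReal 0 1).real (Set.Ioi (z - ‖v‖)) := by
  rw [← neymanPearson_gaussian v z, normSqPower_eq_integral, ← hcz]
  have := integral_indicator_le_of_neymanPearson (integrable_gaussianLR v)
    (measurableSet_lt_norm_sq c) (Real.exp (‖v‖ * z - ‖v‖ ^ 2 / 2))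
  simpa [normSqPower] using this

/-! ### The least favorable mixture on a sphere -/

/-- The likelihood ratio of the mixture of the shifts that are uniform on the sphere of
radius `δ`. -/
noncomputable def sphereLR (δ : ℝ) (x : E) : ℝ := ∫ z, gaussianLR (radial δ z) x ∂(stdGaussian E)

theorem measurable_gaussianLR_radial (δ : ℝ) :
    Measurable fun q : E × E => gaussianLR (radial δ q.1) q.2 :=
  continuous_uncurry_gaussianLR.measurable.comp
    (((measurable_radial δ).comp measurable_fst).prodMk measurable_snd)

theorem integrable_gaussianLR_radial {δ : ℝ} (hδ : 0 ≤ δ) (x : E) :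
    Integrable (fun z => gaussianLR (radial δ z) x) (stdGaussian E) := by
  refine (integrable_const (Real.exp (δ * ‖x‖))).mono'
    ((measurable_gaussianLR_radial δ).comp measurable_prodMk_right).aestronglyMeasurable
    (ae_of_all _ fun z => ?_)
  rw [Real.norm_of_nonneg (gaussianLR_pos _ _).le]
  exact gaussianLR_le (norm_radial_le hδ z) x

theorem sphereLR_isometry (δ : ℝ) (R : E ≃ₗᵢ[ℝ] E) (x : E) :
    sphereLR δ (R x) = sphereLR δ x := by
  unfold sphereLR
  conv_lhs => rw [← stdGaussian_map R]
  have hm : Measurable fun z => gaussianLR (radial δ z) (R x) :=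
    (measurable_gaussianLR_radial δ).comp measurable_prodMk_right
  rw [integral_map R.continuous.measurable.aemeasurable hm.aestronglyMeasurable]
  simp_rw [radial_isometry, gaussianLR_isometry]

/-- The function is rotation invariant, even and convex. Rotate `x` to `s • y` with `0 ≤ s ≤ 1`;
this is the combination of `y` and `-y` with weights `(1 + s) / 2` and `(1 - s) / 2`, and the
function has the same value at `y` and `-y`. -/
theorem sphereLR_mono {δ : ℝ} (hδ : 0 ≤ δ) {x y : E} (h : ‖x‖ ≤ ‖y‖) :
    sphereLR δ x ≤ sphereLR δ y := by
  rcases eq_or_ne y 0 with rfl | hy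
  · have : x = 0 := by simpa using h
    rw [this]
  have hy' : 0 < ‖y‖ := norm_pos_iff.2 hy
  set s : ℝ := ‖x‖ / ‖y‖ with hs
  have hs0 : 0 ≤ s := by positivity
  have hs1 : s ≤ 1 := (div_le_one hy').2 h
  have hn : ‖x‖ = ‖s • y‖ := by
    rw [norm_smul, Real.norm_of_nonneg hs0, hs, div_mul_cancel₀ _ hy'.ne']
  obtain ⟨R, hR⟩ := exists_isometry_of_norm_eq hn
  have h1 : sphereLR δ x = sphereLR δ (s • y) := by rw [← hR, sphereLR_isometry]
  have h2 : sphereLR δ (-y) = sphereLR δ y := by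
    have := sphereLR_isometry δ (LinearIsometryEquiv.neg ℝ) y
    simpa using this
  have h3 : sphereLR δ (s • y) ≤ (1 + s) / 2 * sphereLR δ y + (1 - s) / 2 * sphereLR δ (-y) := by
    unfold sphereLR
    rw [← integral_const_mul, ← integral_const_mul, ← integral_add
      ((integrable_gaussianLR_radial hδ _).const_mul _)
      ((integrable_gaussianLR_radial hδ _).const_mul _)]
    refine integral_mono (integrable_gaussianLR_radial hδ _)
      (((integrable_gaussianLR_radial hδ _).const_mul _).add
        ((integrable_gaussianLR_radial hδ _).const_mul _)) fun z => ?_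
    have hc := convexOn_exp.2 (Set.mem_univ (⟪radial δ z, y⟫ - ‖radial δ z‖ ^ 2 / 2))
      (Set.mem_univ (⟪radial δ z, -y⟫ - ‖radial δ z‖ ^ 2 / 2))
      (by linarith : 0 ≤ (1 + s) / 2) (by linarith : 0 ≤ (1 - s) / 2) (by ring)
    simp only [smul_eq_mul] at hc
    refine le_trans (le_of_eq ?_) hc
    rw [gaussianLR, inner_neg_right, real_inner_smul_right]
    congr 1; ring
  rw [h1]
  rw [h2] at h3
  linarith

theorem integrable_sphereLR_prod {δ : ℝ} (hδ : 0 ≤ δ) :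
    Integrable (fun q : E × E => gaussianLR (radial δ q.1) q.2)
      ((stdGaussian E).prod (stdGaussian E)) := by
  refine ((integrable_exp_mul_norm_stdGaussian (E := E) δ).comp_snd (stdGaussian E)).mono'
    (measurable_gaussianLR_radial δ).aestronglyMeasurable (ae_of_all _ fun q => ?_)
  rw [Real.norm_of_nonneg (gaussianLR_pos _ _).le]
  exact gaussianLR_le (norm_radial_le hδ _) _

theorem integrable_sphereLR {δ : ℝ} (hδ : 0 ≤ δ) :
    Integrable (sphereLR δ) (stdGaussian E) :=
  (integrable_sphereLR_prod hδ).integral_prod_right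

/-- By Fubini this is the average over the sphere of the power of the chi-square region, and that
power is constant on the sphere. -/
theorem integral_indicator_sphereLR [Nontrivial E] (c : ℝ) (v : E) :
    ∫ x, {x : E | c < ‖x‖ ^ 2}.indicator (sphereLR ‖v‖) x ∂(stdGaussian E) = normSqPower c v := by
  set s := {x : E | c < ‖x‖ ^ 2} with hsdef
  have hs : MeasurableSet s := measurableSet_lt_norm_sq c
  have h1 : ∀ x, s.indicator (sphereLR ‖v‖) x
      = ∫ z, s.indicator (gaussianLR (radial ‖v‖ z)) x ∂(stdGaussian E) := by
    intro x
    by_cases hx : x ∈ s <;> simp [hx, sphereLR]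
  simp_rw [h1]
  rw [integral_integral_swap]
  · have h2 : ∀ᵐ z ∂(stdGaussian E),
        ∫ x, s.indicator (gaussianLR (radial ‖v‖ z)) x ∂(stdGaussian E) = normSqPower c v := by
      filter_upwards [ae_ne_zero_stdGaussian (E := E)] with z hz
      rw [hsdef, ← normSqPower_eq_integral]
      exact normSqPower_eq_of_norm_eq c (norm_radial (norm_nonneg v) hz)
    rw [integral_congr_ae h2]
    simp
  · have h3 := (integrable_sphereLR_prod (E := E) (norm_nonneg v)).swap.indicator
      (measurable_fst hs)
    refine h3.congr (ae_of_all _ fun q => ?_)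
    by_cases hq : q.1 ∈ s <;> simp [Function.uncurry, hq]

/-- Reads the average over a simple random direction as a finite mixture, with the masses of the
fibers as weights. -/
theorem integral_comp_simpleFunc {Ω β : Type*} [MeasurableSpace Ω] (μ : Measure Ω)
    [IsFiniteMeasure μ] (F : SimpleFunc Ω β) (f : β → ℝ) :
    ∫ z, f (F z) ∂μ = ∑ j ∈ F.range, μ.real (F ⁻¹' {j}) * f j := by
  have h : ∀ z, f (F z) = ∑ j ∈ F.range, (F ⁻¹' {j}).indicator (fun _ => f j) z := by
    intro z
    rw [Finset.sum_eq_single (F z)]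
    · simp
    · intro j _ hj
      simp [hj.symm]
    · intro hz
      exact absurd (F.mem_range_self z) hz
  simp_rw [h]
  rw [integral_finsetSum _ fun j _ =>
    (integrable_const (f j)).indicator (F.measurableSet_fiber j)]
  refine Finset.sum_congr rfl fun j _ => ?_
  rw [integral_indicator_const _ (F.measurableSet_fiber j), smul_eq_mul]

/-- The mixture over the sphere of radius `‖v‖` can be replaced, within `ε`, by a finite one. -/
theorem exists_finite_mixture [Nontrivial E] {c α : ℝ} (hα : α < 1)
    (hc : normSqPower c (0 : E) = α) (v : E) {ε : ℝ} (hε : 0 < ε) :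
    ∃ (J : Finset E) (w : E → ℝ) (K : ℝ), (∀ j ∈ J, ‖j‖ = ‖v‖) ∧ (∀ j, 0 ≤ w j) ∧
      ∑ j ∈ J, w j = 1 ∧ 0 ≤ K ∧
      K * α + ∫ x, max (∑ j ∈ J, w j * gaussianLR j x - K) 0 ∂(stdGaussian E)
        ≤ normSqPower c v + ε := by
  -- With a negative critical value the region is the whole space and its level is `1`.
  have hc0 : 0 ≤ c := by
    by_contra hlt
    have : {x : E | c < ‖x + 0‖ ^ 2} = Set.univ :=
      Set.eq_univ_of_forall fun x => (not_le.1 hlt).trans_le (sq_nonneg _)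
    rw [normSqPower, this] at hc
    simp at hc
    linarith
  -- A point on the boundary of the chi-square region. Taking `K` to be the mixed likelihood ratio
  -- there makes the region, by monotonicity, the Neyman–Pearson region up to ties, so the duality
  -- is exact.
  obtain ⟨x₀, hx₀⟩ := exists_norm_eq E (Real.sqrt_nonneg c)
  set K := sphereLR ‖v‖ x₀ with hK
  have hK0 : 0 ≤ K := integral_nonneg fun z => (gaussianLR_pos _ _).le
  have hid : K * α + ∫ x, max (sphereLR ‖v‖ x - K) 0 ∂(stdGaussian E) = normSqPower c v := by
    have h := integral_indicator_eq_of_neymanPearson (integrable_sphereLR (norm_nonneg v))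
      (measurableSet_lt_norm_sq (E := E) c) (K := K) ?_ ?_
    · rw [integral_indicator_sphereLR] at h
      rw [← h, ← hc]; simp [normSqPower]
    · intro x hx
      refine sphereLR_mono (norm_nonneg v) ?_
      rw [hx₀]
      exact Real.sqrt_le_iff.2 ⟨norm_nonneg _, (show c < ‖x‖ ^ 2 from hx).le⟩
    · intro x hx
      refine sphereLR_mono (norm_nonneg v) ?_
      rw [hx₀]
      exact Real.le_sqrt_of_sq_le (not_lt.1 hx)
  -- The approximations take values in the sphere itself, so each atom of the finite mixture keeps
  -- the norm `‖v‖`; the default value `v` is on the sphere.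
  set F : ℕ → SimpleFunc E E := SimpleFunc.approxOn (radial ‖v‖) (measurable_radial ‖v‖)
    (Metric.sphere 0 ‖v‖) v (by simp) with hF
  have hFn : ∀ n z, ‖F n z‖ = ‖v‖ := by
    intro n z
    have := SimpleFunc.approxOn_mem (measurable_radial ‖v‖)
      (s := Metric.sphere (0 : E) ‖v‖) (y₀ := v) (by simp) n z
    simpa using this
  have hFlim : ∀ᵐ z ∂(stdGaussian E), Tendsto (fun n => F n z) atTop (𝓝 (radial ‖v‖ z)) := by
    filter_upwards [ae_ne_zero_stdGaussian (E := E)] with z hz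
    exact SimpleFunc.tendsto_approxOn _ _ (subset_closure (by
      simpa using norm_radial (norm_nonneg v) hz))
  have hpt : ∀ x, Tendsto (fun n => ∫ z, gaussianLR (F n z) x ∂(stdGaussian E)) atTop
      (𝓝 (sphereLR ‖v‖ x)) := by
    intro x
    refine tendsto_integral_of_dominated_convergence (fun _ => Real.exp (‖v‖ * ‖x‖)) ?_
      (integrable_const _) ?_ ?_
    · intro n
      exact (continuous_uncurry_gaussianLR.measurable.comp
        ((F n).measurable.prodMk measurable_const)).aestronglyMeasurable
    · intro n
      refine ae_of_all _ fun z => ?_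
      rw [Real.norm_of_nonneg (gaussianLR_pos _ _).le]
      exact gaussianLR_le (hFn n z).le x
    · filter_upwards [hFlim] with z hz
      have : Continuous fun w : E => gaussianLR w x := by unfold gaussianLR; fun_prop
      exact (this.tendsto _).comp hz
  have hsum : ∀ n x, ∫ z, gaussianLR (F n z) x ∂(stdGaussian E)
      = ∑ j ∈ (F n).range, (stdGaussian E).real (F n ⁻¹' {j}) * gaussianLR j x := by
    intro n x
    exact integral_comp_simpleFunc _ (F n) fun j => gaussianLR j x
  have hlim : Tendsto (fun n => ∫ x, max (∑ j ∈ (F n).range,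
      (stdGaussian E).real (F n ⁻¹' {j}) * gaussianLR j x - K) 0 ∂(stdGaussian E)) atTop
      (𝓝 (∫ x, max (sphereLR ‖v‖ x - K) 0 ∂(stdGaussian E))) := by
    refine tendsto_integral_of_dominated_convergence (fun x => Real.exp (‖v‖ * ‖x‖)) ?_
      (integrable_exp_mul_norm_stdGaussian _) ?_ ?_
    · intro n
      refine Continuous.aestronglyMeasurable ?_
      fun_prop
    · intro n
      refine ae_of_all _ fun x => ?_
      rw [Real.norm_of_nonneg (le_max_right _ _), ← hsum]
      refine max_le ?_ (Real.exp_pos _).le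
      have : ∫ z, gaussianLR (F n z) x ∂(stdGaussian E)
          ≤ ∫ z, Real.exp (‖v‖ * ‖x‖) ∂(stdGaussian E) := by
        refine integral_mono_of_nonneg (ae_of_all _ fun z => (gaussianLR_pos _ _).le)
          (integrable_const _) (ae_of_all _ fun z => gaussianLR_le (hFn n z).le x)
      simp only [integral_const, probReal_univ, one_smul] at this
      linarith
    · refine ae_of_all _ fun x => ?_
      simp_rw [← hsum]
      exact ((hpt x).sub_const K).max tendsto_const_nhds
  obtain ⟨n, hn⟩ := (hlim.eventually_le_const (lt_add_of_pos_right _ hε)).exists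
  refine ⟨(F n).range, fun j => (stdGaussian E).real (F n ⁻¹' {j}), K, ?_,
    fun j => measureReal_nonneg,
    ?_, hK0, by simp only; linarith⟩
  · intro j hj
    obtain ⟨z, rfl⟩ := SimpleFunc.mem_range.1 hj
    exact hFn n z
  · have h := integral_comp_simpleFunc (stdGaussian E) (F n) fun _ => 1
    simpa using h.symm

end NeymanPearson

/-! ### Convergence in distribution -/

section Distribution

variable {ι : Type*} {F : Filter ι} {Ω : ι → Type*} [∀ i, MeasurableSpace (Ω i)]
  {P : ∀ i, Measure (Ω i)} [∀ i, IsProbabilityMeasure (P i)]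
  {E : Type*} [TopologicalSpace E] [MeasurableSpace E] [BorelSpace E]
  {X : ∀ i, Ω i → E} {μ : Measure E} [IsProbabilityMeasure μ]

theorem _root_.MeasureTheory.TendstoInDistribution.mono_filter {G : Filter ι}
    (hX : TendstoInDistribution X F id P μ)
    (h : G ≤ F) : TendstoInDistribution X G id P μ :=
  ⟨hX.forall_aemeasurable, hX.aemeasurable_limit, hX.tendsto.mono_left h⟩

theorem tendstoInDistribution_id_iff (hX : ∀ i, AEMeasurable (X i) (P i)) :
    TendstoInDistribution X F id P μ ↔ ∀ f : BoundedContinuousFunction E ℝ,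
      Tendsto (fun i => ∫ ω, f (X i ω) ∂(P i)) F (𝓝 (∫ x, f x ∂μ)) := by
  have h1 : ∀ (f : BoundedContinuousFunction E ℝ) i,
      ∫ x, f x ∂((P i).map (X i)) = ∫ ω, f (X i ω) ∂(P i) := fun f i =>
    integral_map (hX i) f.continuous.measurable.aestronglyMeasurable
  constructor
  · intro h f
    have h2 := (ProbabilityMeasure.tendsto_iff_forall_integral_tendsto.1 h.tendsto) f
    simp only [ProbabilityMeasure.coe_mk, Measure.map_id, h1] at h2
    exact h2
  · intro h
    refine ⟨hX, aemeasurable_id, ProbabilityMeasure.tendsto_iff_forall_integral_tendsto.2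
      fun f => ?_⟩
    simp only [ProbabilityMeasure.coe_mk, Measure.map_id, h1]
    exact h f

theorem _root_.MeasureTheory.TendstoInDistribution.tendsto_integral
    (hX : TendstoInDistribution X F id P μ) {f : E → ℝ}
    (hf : Continuous f) {C : ℝ} (hC : ∀ x, |f x| ≤ C) :
    Tendsto (fun i => ∫ ω, f (X i ω) ∂(P i)) F (𝓝 (∫ x, f x ∂μ)) :=
  (tendstoInDistribution_id_iff hX.forall_aemeasurable).1 hX
    (BoundedContinuousFunction.ofNormedAddCommGroup f hf C hC)

theorem _root_.MeasureTheory.TendstoInDistribution.tendsto_measureReal [HasOuterApproxClosed E]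
    (hX : TendstoInDistribution X F id P μ) {s : Set E} (hs : MeasurableSet s)
    (h0 : μ (frontier s) = 0) :
    Tendsto (fun i => (P i).real {ω | X i ω ∈ s}) F (𝓝 (μ.real s)) := by
  have h := ProbabilityMeasure.tendsto_measure_of_null_frontier_of_tendsto' hX.tendsto (E := s)
    (by simpa using h0)
  simp only [ProbabilityMeasure.coe_mk, Measure.map_id] at h
  have h2 := (ENNReal.tendsto_toReal (measure_ne_top μ s)).comp h
  refine h2.congr fun i => ?_
  simp only [Function.comp_apply, measureReal_def]
  rw [Measure.map_apply_of_aemeasurable (hX.forall_aemeasurable i) hs]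
  rfl

theorem _root_.MeasureTheory.TendstoInDistribution.map_continuous {E' : Type*} [TopologicalSpace E']
    [MeasurableSpace E'] [BorelSpace E'] (hX : TendstoInDistribution X F id P μ) {g : E → E'}
    (hg : Continuous g) {ν : Measure E'} [IsProbabilityMeasure ν] (hν : μ.map g = ν) :
    TendstoInDistribution (fun i ω => g (X i ω)) F id P ν := by
  refine (tendstoInDistribution_id_iff fun i =>
    hg.measurable.comp_aemeasurable (hX.forall_aemeasurable i)).2 fun f => ?_
  have h := (tendstoInDistribution_id_iff hX.forall_aemeasurable).1 hX
    (f.compContinuous ⟨g, hg⟩)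
  rw [← hν, integral_map hg.measurable.aemeasurable
    f.continuous.measurable.aestronglyMeasurable]
  exact h

/-- Slutsky's lemma with a deterministic perturbation. -/
theorem _root_.MeasureTheory.TendstoInDistribution.map_continuous_prod [SecondCountableTopology E]
    [TopologicalSpace.PseudoMetrizableSpace E]
    {A : Type*} [TopologicalSpace A] [SecondCountableTopology A]
    [TopologicalSpace.PseudoMetrizableSpace A]
    {E' : Type*} [TopologicalSpace E'] [MeasurableSpace E'] [BorelSpace E']
    (hX : TendstoInDistribution X F id P μ) {g : E × A → E'} (hg : Continuous g)
    {a : ι → A} {a₀ : A} (ha : Tendsto a F (𝓝 a₀)) {ν : Measure E'} [IsProbabilityMeasure ν]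
    (hν : μ.map (fun x => g (x, a₀)) = ν) :
    TendstoInDistribution (fun i ω => g (X i ω, a i)) F id P ν := by
  borelize A
  have hg1 : ∀ b, Measurable fun x => g (x, b) := fun b =>
    (hg.comp (Continuous.prodMk_left b)).measurable
  refine (tendstoInDistribution_id_iff fun i =>
    (hg1 (a i)).comp_aemeasurable (hX.forall_aemeasurable i)).2 fun f => ?_
  -- The deterministic parameter is treated as a Dirac law; weak convergence of the two marginals
  -- gives that of the product laws.
  have h1 := ((continuous_diracProba.tendsto a₀).comp ha)
  have h2 := (ProbabilityMeasure.continuous_prod.tendsto _).comp (hX.tendsto.prodMk_nhds h1)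
  have h3 : Tendsto (fun i => ∫ q, f (g q) ∂(((P i).map (X i)).prod (Measure.dirac (a i)))) F
      (𝓝 (∫ q, f (g q) ∂((μ.map id).prod (Measure.dirac a₀)))) :=
    ProbabilityMeasure.tendsto_iff_forall_integral_tendsto.1 h2 (f.compContinuous ⟨g, hg⟩)
  have hm : ∀ b : Measure (E × A), AEStronglyMeasurable (fun q => f (g q)) b := fun b =>
    (f.continuous.comp hg).measurable.aestronglyMeasurable
  have key : ∀ (m : Measure E) [SFinite m] (b : A),
      ∫ q, f (g q) ∂(m.prod (Measure.dirac b)) = ∫ x, f (g (x, b)) ∂m := by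
    intro m _ b
    rw [Measure.prod_dirac, integral_map measurable_prodMk_right.aemeasurable (hm _)]
  rw [key, Measure.map_id] at h3
  rw [← hν, integral_map (hg1 a₀).aemeasurable f.continuous.measurable.aestronglyMeasurable]
  refine h3.congr fun i => ?_
  rw [key]
  exact integral_map (hX.forall_aemeasurable i)
    (f.continuous.measurable.comp (hg1 (a i))).aestronglyMeasurable

/-- A continuous function of `X i` and of a deterministic parameter tends to zero in probability
if it vanishes at the limiting parameter. -/
theorem _root_.MeasureTheory.TendstoInDistribution.tendsto_measure_abs_ge
    [SecondCountableTopology E]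
    [TopologicalSpace.PseudoMetrizableSpace E]
    {A : Type*} [TopologicalSpace A] [SecondCountableTopology A]
    [TopologicalSpace.PseudoMetrizableSpace A]
    (hX : TendstoInDistribution X F id P μ) {g : E × A → ℝ} (hg : Continuous g)
    {a : ι → A} {a₀ : A} (ha : Tendsto a F (𝓝 a₀)) (h0 : ∀ x, g (x, a₀) = 0) {ε : ℝ}
    (hε : 0 < ε) : Tendsto (fun i => P i {ω | ε ≤ |g (X i ω, a i)|}) F (𝓝 0) := by
  have h1 : μ.map (fun x => g (x, a₀)) = Measure.dirac 0 := by
    simp [h0, Measure.map_const]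
  have h2 := hX.map_continuous_prod hg ha h1
  have hs : MeasurableSet {y : ℝ | ε ≤ |y|} := measurableSet_le measurable_const (by fun_prop)
  -- The limit law is the Dirac mass at `0`, which does not charge the closed set `ε ≤ |y|`; the
  -- portmanteau theorem concludes.
  have h3 := ProbabilityMeasure.limsup_measure_closed_le_of_tendsto h2.tendsto
    (F := {y : ℝ | ε ≤ |y|}) (isClosed_le continuous_const continuous_abs)
  simp only [ProbabilityMeasure.coe_mk, Measure.map_id] at h3
  rw [Measure.dirac_apply' _ hs, Set.indicator_of_notMem (by simpa using hε)] at h3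
  refine tendsto_of_le_liminf_of_limsup_le zero_le (le_trans (le_of_eq ?_) h3)
  congr 1
  funext i
  rw [Measure.map_apply_of_aemeasurable (h2.forall_aemeasurable i) hs]
  rfl

end Distribution

/-! ### Asymptotic likelihood ratios -/

section LeCam

/-- Closeness of logarithms controls ratios only; truncation at `K` turns this into an absolute
bound. -/
theorem abs_min_sub_min_le {a b K η : ℝ} (ha : 0 < a) (hb : 0 < b) (hK : 0 ≤ K)
    (h : |Real.log a - Real.log b| ≤ η) :
    |min a K - min b K| ≤ K * (Real.exp η - 1) := by
  have key : ∀ a b : ℝ, 0 < a → 0 < b → Real.log a - Real.log b ≤ η → 0 ≤ η →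
      min a K - min b K ≤ K * (Real.exp η - 1) := by
    intro a b ha hb hab hη
    have h1 : a ≤ Real.exp η * b := by
      rw [← Real.exp_log ha, ← Real.exp_log hb, ← Real.exp_add]
      exact Real.exp_le_exp.2 (by linarith)
    have h2 : 1 ≤ Real.exp η := Real.one_le_exp hη
    have h3 : min a K ≤ Real.exp η * min b K := by
      rw [mul_min_of_nonneg _ _ (by positivity)]
      exact min_le_min h1 (by nlinarith)
    have h4 : min b K ≤ K := min_le_right _ _
    nlinarith
  have hη : 0 ≤ η := (abs_nonneg _).trans h
  obtain ⟨h1, h2⟩ := abs_le.1 h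
  refine abs_le.2 ⟨?_, key a b ha hb h2 hη⟩
  have := key b a hb ha (by linarith) hη
  linarith

/-- An extended real logarithm at finite distance from a real number. -/
theorem toReal_pos_and_abs_log_lt {d : ℝ≥0∞} {s η : ℝ}
    (h : (ENNReal.log d - (s : EReal)).abs < ENNReal.ofReal η) :
    0 < d.toReal ∧ |Real.log d.toReal - s| < η := by
  have h0 : d ≠ 0 := by rintro rfl; simp at h
  have h1 : d ≠ ⊤ := by rintro rfl; simp at h
  refine ⟨ENNReal.toReal_pos h0 h1, ?_⟩
  rw [ENNReal.log_pos_real h0 h1, ← EReal.coe_sub, EReal.abs_def] at h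
  exact (ENNReal.ofReal_lt_ofReal_iff_of_nonneg (abs_nonneg _)).1 h

theorem abs_log_sub_le {d : ℝ≥0∞} {s s' η η' : ℝ}
    (h : ENNReal.ofReal (η + η') ≤ (ENNReal.log d - (s : EReal)).abs) (h' : |s' - s| < η') :
    ENNReal.ofReal η ≤ (ENNReal.log d - (s' : EReal)).abs := by
  by_contra hlt
  obtain ⟨h1, h2⟩ := toReal_pos_and_abs_log_lt (not_le.1 hlt)
  refine (not_lt.2 h) ?_
  have hd0 : d ≠ 0 := by rintro rfl; simp at h1
  have hd1 : d ≠ ⊤ := by rintro rfl; simp at h1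
  rw [ENNReal.log_pos_real hd0 hd1, ← EReal.coe_sub, EReal.abs_def]
  refine (ENNReal.ofReal_lt_ofReal_iff_of_nonneg (abs_nonneg _)).2 ?_
  have : Real.log d.toReal - s = (Real.log d.toReal - s') + (s' - s) := by ring
  rw [this]
  exact (abs_add_le _ _).trans_lt (by linarith)

theorem integrable_of_mem_Icc {Ω : Type*} [MeasurableSpace Ω] {μ : Measure Ω} [IsFiniteMeasure μ]
    {f : Ω → ℝ} (hf : Measurable f) {a b : ℝ} (h : ∀ x, f x ∈ Set.Icc a b) : Integrable f μ :=
  Integrable.of_mem_Icc a b hf.aemeasurable (ae_of_all _ h)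

/-- Truncating the density and dropping the singular part of `Q` can only lose mass. No absolute
continuity is needed, at the price of an inequality. -/
theorem integral_mul_min_rnDeriv_le {Ω : Type*} [MeasurableSpace Ω] (P Q : Measure Ω)
    [IsProbabilityMeasure P] [IsProbabilityMeasure Q] {f : Ω → ℝ} (hf : Measurable f)
    (h01 : ∀ x, f x ∈ Set.Icc (0 : ℝ) 1) {K : ℝ} (hK : 0 ≤ K) :
    ∫ x, f x * min (Q.rnDeriv P x).toReal K ∂P ≤ ∫ x, f x ∂Q := by
  have hint : Integrable (fun x => f x * (Q.rnDeriv P x).toReal) P := by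
    refine Integrable.bdd_mul (c := 1) Measure.integrable_toReal_rnDeriv
      hf.aestronglyMeasurable (ae_of_all _ fun x => ?_)
    rw [Real.norm_of_nonneg (h01 x).1]; exact (h01 x).2
  have h1 : ∫ x, f x * min (Q.rnDeriv P x).toReal K ∂P ≤ ∫ x, f x * (Q.rnDeriv P x).toReal ∂P := by
    refine integral_mono_of_nonneg (ae_of_all _ fun x =>
      mul_nonneg (h01 x).1 (le_min ENNReal.toReal_nonneg hK)) hint (ae_of_all _ fun x => ?_)
    exact mul_le_mul_of_nonneg_left (min_le_left _ _) (h01 x).1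
  refine h1.trans ?_
  have h2 : ∫ x, f x * (Q.rnDeriv P x).toReal ∂P
      = ∫ x, f x ∂(P.withDensity (Q.rnDeriv P)) := by
    rw [integral_withDensity_eq_integral_toReal_smul (Measure.measurable_rnDeriv _ _)
      (Measure.rnDeriv_lt_top Q P)]
    simp only [smul_eq_mul, mul_comm]
  rw [h2]
  exact integral_mono_measure (Measure.withDensity_rnDeriv_le Q P)
    (ae_of_all _ fun x => (h01 x).1) (integrable_of_mem_Icc hf h01)

variable {ι : Type*} {F : Filter ι} {Ω : ι → Type*} [∀ i, MeasurableSpace (Ω i)]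

/-- The log-likelihood ratios of `Q` with respect to `P` are `S + o_P(1)` along the filter `F`. -/
def LogLRApprox (F : Filter ι) (P Q : ∀ i, Measure (Ω i)) (S : ∀ i, Ω i → ℝ) : Prop :=
  ∀ ε : ℝ, 0 < ε → Tendsto (fun i => P i {x | ENNReal.ofReal ε ≤
    (ENNReal.log ((Q i).rnDeriv (P i) x) - (S i x : EReal)).abs}) F (𝓝 0)

variable {P Q : ∀ i, Measure (Ω i)}

theorem LogLRApprox.mono_filter {S : ∀ i, Ω i → ℝ} {G : Filter ι} (h : LogLRApprox F P Q S)
    (hG : G ≤ F) : LogLRApprox G P Q S := fun ε hε => (h ε hε).mono_left hG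

theorem LogLRApprox.congr_approx {S S' : ∀ i, Ω i → ℝ} (h : LogLRApprox F P Q S)
    (hS : ∀ ε : ℝ, 0 < ε → Tendsto (fun i => P i {x | ε ≤ |S i x - S' i x|}) F (𝓝 0)) :
    LogLRApprox F P Q S' := by
  intro ε hε
  have h1 := (h (ε / 2) (by positivity)).add (hS (ε / 2) (by positivity))
  rw [add_zero] at h1
  refine tendsto_of_tendsto_of_tendsto_of_le_of_le tendsto_const_nhds h1 (fun i => zero_le)
    fun i => ?_
  refine (measure_mono ?_).trans (measure_union_le _ _)
  intro x hx
  by_cases hd : |S i x - S' i x| < ε / 2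
  · left
    refine abs_log_sub_le (s := S' i x) (η' := ε / 2) ?_ hd
    rw [add_halves]; exact hx
  · right
    exact not_lt.1 hd

variable [∀ i, IsProbabilityMeasure (P i)]

/-- Where the logarithms are within `η`, the truncated ratios differ by at most `K (exp η - 1)`; the
remaining event contributes at most `K` times its vanishing probability. -/
theorem LogLRApprox.tendsto_integral_abs_min_sub {S : ∀ i, Ω i → ℝ} (h : LogLRApprox F P Q S)
    {K : ℝ} (hK : 0 ≤ K) {ε : ℝ} (hε : 0 < ε) :
    ∀ᶠ i in F, ∫ x, |min ((Q i).rnDeriv (P i) x).toReal K - min (Real.exp (S i x)) K| ∂(P i)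
      ≤ ε := by
  obtain ⟨η, hη, hη2⟩ : ∃ η : ℝ, 0 < η ∧ K * (Real.exp η - 1) ≤ ε / 2 := by
    have hc : Tendsto (fun η : ℝ => K * (Real.exp η - 1)) (𝓝[>] 0) (𝓝 0) := by
      have : Continuous fun η : ℝ => K * (Real.exp η - 1) := by fun_prop
      have h2 := this.tendsto 0
      simp only [Real.exp_zero, sub_self, mul_zero] at h2
      exact h2.mono_left nhdsWithin_le_nhds
    obtain ⟨η, h1, h2⟩ := ((hc.eventually_le_const (half_pos hε)).and self_mem_nhdsWithin).exists
    exact ⟨η, h2, h1⟩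
  have h1 := (ENNReal.tendsto_toReal ENNReal.zero_ne_top).comp (h η hη)
  have h2 : Tendsto (fun i => K * (P i).real {x | ENNReal.ofReal η ≤
      (ENNReal.log ((Q i).rnDeriv (P i) x) - (S i x : EReal)).abs}) F (𝓝 0) := by
    have h3 := h1.const_mul K
    rw [ENNReal.toReal_zero, mul_zero] at h3
    exact h3
  filter_upwards [h2.eventually_le_const (half_pos hε)] with i hi
  set bad := {x | ENNReal.ofReal η ≤
    (ENNReal.log ((Q i).rnDeriv (P i) x) - (S i x : EReal)).abs} with hbad
  -- `S` is not assumed measurable, so the exceptional set is replaced by a measurable hull of the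
  -- same measure.
  set B := toMeasurable (P i) bad with hB
  have hBm : MeasurableSet B := measurableSet_toMeasurable _ _
  have hBr : (P i).real B = (P i).real bad := by
    rw [measureReal_def, measureReal_def, hB, measure_toMeasurable]
  have hpt : ∀ x, |min ((Q i).rnDeriv (P i) x).toReal K - min (Real.exp (S i x)) K|
      ≤ ε / 2 + B.indicator (fun _ => K) x := by
    intro x
    by_cases hx : x ∈ B
    · rw [Set.indicator_of_mem hx]
      have h3 : 0 ≤ min ((Q i).rnDeriv (P i) x).toReal K := le_min ENNReal.toReal_nonneg hK
      have h4 : 0 ≤ min (Real.exp (S i x)) K := le_min (Real.exp_pos _).le hK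
      have h5 := min_le_right ((Q i).rnDeriv (P i) x).toReal K
      have h6 := min_le_right (Real.exp (S i x)) K
      exact abs_le.2 ⟨by linarith, by linarith⟩
    · rw [Set.indicator_of_notMem hx, add_zero]
      have hx' : x ∉ bad := fun hb => hx (subset_toMeasurable _ _ hb)
      obtain ⟨h3, h4⟩ := toReal_pos_and_abs_log_lt (not_le.1 hx')
      refine (abs_min_sub_min_le h3 (Real.exp_pos _) hK ?_).trans hη2
      rw [Real.log_exp]; exact h4.le
  have hint : Integrable (fun x => ε / 2 + B.indicator (fun _ => K) x) (P i) :=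
    (integrable_const _).add ((integrable_const _).indicator hBm)
  refine (integral_mono_of_nonneg (ae_of_all _ fun x => abs_nonneg _) hint
    (ae_of_all _ hpt)).trans ?_
  rw [integral_add (integrable_const _) ((integrable_const _).indicator hBm),
    integral_indicator_const _ hBm, hBr]
  simp only [integral_const, probReal_univ, smul_eq_mul]
  linarith

variable {E : Type*} [TopologicalSpace E] [MeasurableSpace E] [BorelSpace E]
  {X : ∀ i, Ω i → E} {μ : Measure E}

theorem tendsto_integral_min_atTop {g : E → ℝ} (hg : Continuous g) (h0 : ∀ x, 0 ≤ g x)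
    (hint : Integrable g μ) :
    Tendsto (fun K : ℝ => ∫ x, min (g x) K ∂μ) atTop (𝓝 (∫ x, g x ∂μ)) := by
  refine tendsto_integral_filter_of_dominated_convergence g ?_ ?_ hint ?_
  · exact Eventually.of_forall fun K =>
      (hg.min continuous_const).measurable.aestronglyMeasurable
  · filter_upwards [eventually_ge_atTop 0] with K hK
    refine ae_of_all _ fun x => ?_
    rw [Real.norm_of_nonneg (le_min (h0 x) hK)]
    exact min_le_left _ _
  · refine ae_of_all _ fun x => ?_
    refine tendsto_const_nhds.congr' ?_
    filter_upwards [eventually_ge_atTop (g x)] with K hK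
    rw [min_eq_left hK]

variable [∀ i, IsProbabilityMeasure (Q i)] [IsProbabilityMeasure μ]

/-- Expectations of tests under `Q i` are, uniformly over the tests and up to `ε`, expectations
under `P i` weighted by the truncated limiting likelihood ratio. -/
theorem LogLRApprox.eventually_abs_integral_sub_le {S : E → ℝ} (hS : Continuous S)
    (hX : TendstoInDistribution X F id P μ) (hXm : ∀ i, Measurable (X i))
    (hint : Integrable (fun x => Real.exp (S x)) μ) (hone : ∫ x, Real.exp (S x) ∂μ = 1)
    (h : LogLRApprox F P Q fun i x => S (X i x)) {ε : ℝ} (hε : 0 < ε) :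
    ∃ K₀ : ℝ, ∀ K, K₀ ≤ K → ∀ᶠ i in F, ∀ f : Ω i → ℝ, Measurable f →
      (∀ x, f x ∈ Set.Icc (0 : ℝ) 1) →
      |∫ x, f x ∂(Q i) - ∫ x, f x * min (Real.exp (S (X i x))) K ∂(P i)| ≤ ε := by
  have hlim := tendsto_integral_min_atTop (hS.rexp) (fun x => (Real.exp_pos _).le) hint
  rw [hone] at hlim
  obtain ⟨K₀, hK₀⟩ := eventually_atTop.1
    (hlim.eventually_const_le (show 1 - ε / 4 < (1 : ℝ) by linarith))
  refine ⟨max K₀ 0, fun K hK => ?_⟩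
  have hK0 : 0 ≤ K := (le_max_right _ _).trans hK
  have hK1 := hK₀ K ((le_max_left _ _).trans hK)
  have hm : Tendsto (fun i => ∫ x, min (Real.exp (S (X i x))) K ∂(P i)) F
      (𝓝 (∫ x, min (Real.exp (S x)) K ∂μ)) := by
    refine hX.tendsto_integral (f := fun x => min (Real.exp (S x)) K) (C := K)
      (hS.rexp.min continuous_const) fun x => ?_
    rw [abs_of_nonneg (le_min (Real.exp_pos _).le hK0)]
    exact min_le_right _ _
  filter_upwards [hm.eventually_const_le (show 1 - ε / 2 < _ by linarith),
    h.tendsto_integral_abs_min_sub hK0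
      (show 0 < ε / 4 by positivity)] with i hi1 hi2 f hf h01
  set D : Ω i → ℝ := fun x => min ((Q i).rnDeriv (P i) x).toReal K with hD
  set T : Ω i → ℝ := fun x => min (Real.exp (S (X i x))) K with hT
  have hDm : Measurable D := (Measure.measurable_rnDeriv _ _).ennreal_toReal.min measurable_const
  have hTm : Measurable T := (hS.measurable.comp (hXm i)).exp.min measurable_const
  have hDb : ∀ x, D x ∈ Set.Icc 0 K := fun x =>
    ⟨le_min ENNReal.toReal_nonneg hK0, min_le_right _ _⟩
  have hTb : ∀ x, T x ∈ Set.Icc 0 K := fun x =>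
    ⟨le_min (Real.exp_pos _).le hK0, min_le_right _ _⟩
  have hDi : Integrable D (P i) := integrable_of_mem_Icc hDm hDb
  have hTi : Integrable T (P i) := integrable_of_mem_Icc hTm hTb
  have hfD : Integrable (fun x => f x * D x) (P i) :=
    integrable_of_mem_Icc (hf.mul hDm) (a := 0) (b := 1 * K) fun x =>
      ⟨mul_nonneg (h01 x).1 (hDb x).1,
        mul_le_mul (h01 x).2 (hDb x).2 (hDb x).1 zero_le_one⟩
  have hfT : Integrable (fun x => f x * T x) (P i) :=
    integrable_of_mem_Icc (hf.mul hTm) (a := 0) (b := 1 * K) fun x =>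
      ⟨mul_nonneg (h01 x).1 (hTb x).1,
        mul_le_mul (h01 x).2 (hTb x).2 (hTb x).1 zero_le_one⟩
  -- The one-sided bound is applied to `f` and to `1 - f`. Together they leave an error of at most
  -- `1 - ∫ D`, which is small because the limiting likelihood ratio has integral `1`: no mass is
  -- lost asymptotically, which is contiguity.
  have e1 : ∫ x, f x * D x ∂(P i) ≤ ∫ x, f x ∂(Q i) :=
    integral_mul_min_rnDeriv_le (P i) (Q i) hf h01 hK0
  have e2 : ∫ x, (1 - f x) * D x ∂(P i) ≤ ∫ x, (1 - f x) ∂(Q i) :=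
    integral_mul_min_rnDeriv_le (P i) (Q i) (f := fun x => 1 - f x) (measurable_const.sub hf)
      (fun x => ⟨by linarith [(h01 x).2], by linarith [(h01 x).1]⟩) hK0
  have e3 : ∫ x, (1 - f x) * D x ∂(P i) = ∫ x, D x ∂(P i) - ∫ x, f x * D x ∂(P i) := by
    rw [← integral_sub hDi hfD]; congr 1; funext x; ring
  have e4 : ∫ x, (1 - f x) ∂(Q i) = 1 - ∫ x, f x ∂(Q i) := by
    rw [integral_sub (integrable_const _) (integrable_of_mem_Icc hf h01)]; simp
  have hdi : Integrable (fun x => |D x - T x|) (P i) := (hDi.sub hTi).abs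
  have e5 : |∫ x, f x * D x ∂(P i) - ∫ x, f x * T x ∂(P i)| ≤ ∫ x, |D x - T x| ∂(P i) := by
    rw [← integral_sub hfD hfT]
    refine (abs_integral_le_integral_abs).trans (integral_mono (hfD.sub hfT).abs hdi fun x => ?_)
    simp only
    rw [← mul_sub, abs_mul, abs_of_nonneg (h01 x).1]
    exact mul_le_of_le_one_left (abs_nonneg _) (h01 x).2
  have e6 : |∫ x, D x ∂(P i) - ∫ x, T x ∂(P i)| ≤ ∫ x, |D x - T x| ∂(P i) := by
    rw [← integral_sub hDi hTi]
    exact abs_integral_le_integral_abs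
  have e5' := abs_le.1 e5
  have e6' := abs_le.1 e6
  exact abs_le.2 ⟨by linarith, by linarith⟩

theorem integral_eq_of_rescale {Ω' : Type*} [MeasurableSpace Ω'] (m : Measure Ω')
    [IsProbabilityMeasure m] {f : Ω' → ℝ} (hf : Measurable f) {a : ℝ} (ha : 0 < a)
    (hfa : ∀ x, |f x| ≤ a) : 2 * a * ∫ x, (f x + a) / (2 * a) ∂m - a = ∫ x, f x ∂m := by
  rw [integral_div, integral_add
    (integrable_of_mem_Icc hf fun x => abs_le.1 (hfa x)) (integrable_const _)]
  simp only [integral_const, probReal_univ, one_smul]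
  field_simp
  ring

/-- Le Cam's third lemma. -/
theorem LogLRApprox.tendstoInDistribution {S : E → ℝ} (hS : Continuous S)
    (hX : TendstoInDistribution X F id P μ) (hXm : ∀ i, Measurable (X i))
    (hint : Integrable (fun x => Real.exp (S x)) μ) (hone : ∫ x, Real.exp (S x) ∂μ = 1)
    (h : LogLRApprox F P Q fun i x => S (X i x)) {ν : Measure E} [IsProbabilityMeasure ν]
    (hν : μ.withDensity (fun x => ENNReal.ofReal (Real.exp (S x))) = ν) :
    TendstoInDistribution X F id Q ν := by
  refine (tendstoInDistribution_id_iff fun i => (hXm i).aemeasurable).2 fun f => ?_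
  have hexpm : Measurable fun x => ENNReal.ofReal (Real.exp (S x)) :=
    (hS.rexp.measurable).ennreal_ofReal
  have key : ∀ g : E → ℝ, Continuous g → (∀ x, g x ∈ Set.Icc (0 : ℝ) 1) →
      Tendsto (fun i => ∫ ω, g (X i ω) ∂(Q i)) F (𝓝 (∫ x, g x ∂ν)) := by
    intro g hg h01
    have hν2 : ∫ x, g x ∂ν = ∫ x, g x * Real.exp (S x) ∂μ := by
      rw [← hν, integral_withDensity_eq_integral_toReal_smul hexpm (by simp)]
      congr 1; funext x
      rw [ENNReal.toReal_ofReal (Real.exp_pos _).le, smul_eq_mul, mul_comm]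
    have hgi : Integrable (fun x => g x * Real.exp (S x)) μ := by
      refine Integrable.bdd_mul (c := 1) hint hg.measurable.aestronglyMeasurable
        (ae_of_all _ fun x => ?_)
      rw [Real.norm_of_nonneg (h01 x).1]; exact (h01 x).2
    rw [hν2, Metric.tendsto_nhds]
    intro ε hε
    obtain ⟨K₀, hK₀⟩ := h.eventually_abs_integral_sub_le hS hX hXm hint hone
      (show 0 < ε / 4 by positivity)
    have hlim := tendsto_integral_min_atTop hS.rexp (fun x => (Real.exp_pos _).le) hint
    rw [hone] at hlim
    obtain ⟨K, hK1, hK2, hK3⟩ := ((hlim.eventually_const_le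
      (show 1 - ε / 4 < (1 : ℝ) by linarith)).and ((eventually_ge_atTop K₀).and
        (eventually_ge_atTop 0))).exists
    have hminb : ∀ x, min (Real.exp (S x)) K ∈ Set.Icc 0 K := fun x =>
      ⟨le_min (Real.exp_pos _).le hK3, min_le_right _ _⟩
    have hgb : ∀ x, g x * min (Real.exp (S x)) K ∈ Set.Icc 0 (1 * K) := fun x =>
      ⟨mul_nonneg (h01 x).1 (hminb x).1, mul_le_mul (h01 x).2 (hminb x).2 (hminb x).1 zero_le_one⟩
    have hgc : Continuous fun x => g x * min (Real.exp (S x)) K :=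
      hg.mul (hS.rexp.min continuous_const)
    have hm : Tendsto (fun i => ∫ x, g (X i x) * min (Real.exp (S (X i x))) K ∂(P i)) F
        (𝓝 (∫ x, g x * min (Real.exp (S x)) K ∂μ)) := by
      refine hX.tendsto_integral (f := fun x => g x * min (Real.exp (S x)) K) (C := 1 * K) hgc
        fun x => ?_
      rw [abs_of_nonneg (hgb x).1]
      exact (hgb x).2
    have hmi : Integrable (fun x => min (Real.exp (S x)) K) μ :=
      integrable_of_mem_Icc (hS.rexp.min continuous_const).measurable hminb
    have e1 : |∫ x, g x * Real.exp (S x) ∂μ - ∫ x, g x * min (Real.exp (S x)) K ∂μ| ≤ ε / 4 := by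
      have hgmi : Integrable (fun x => g x * min (Real.exp (S x)) K) μ :=
        integrable_of_mem_Icc hgc.measurable hgb
      rw [← integral_sub hgi hgmi]
      refine abs_integral_le_integral_abs.trans ?_
      have e2 : ∫ x, |g x * Real.exp (S x) - g x * min (Real.exp (S x)) K| ∂μ
          ≤ ∫ x, (Real.exp (S x) - min (Real.exp (S x)) K) ∂μ := by
        refine integral_mono (hgi.sub hgmi).abs (hint.sub hmi) fun x => ?_
        have : 0 ≤ Real.exp (S x) - min (Real.exp (S x)) K := sub_nonneg.2 (min_le_left _ _)
        simp only
        rw [← mul_sub, abs_mul, abs_of_nonneg (h01 x).1, abs_of_nonneg this]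
        exact mul_le_of_le_one_left this (h01 x).2
      rw [integral_sub hint hmi, hone] at e2
      linarith
    filter_upwards [hK₀ K hK2, Metric.tendsto_nhds.1 hm (ε / 4) (by positivity)] with i hi1 hi2
    have hi3 := hi1 (fun x => g (X i x)) (hg.measurable.comp (hXm i)) fun x => h01 _
    rw [Real.dist_eq] at hi2 ⊢
    have a1 := abs_le.1 e1
    have a2 := abs_lt.1 hi2
    have a3 := abs_le.1 hi3
    exact abs_lt.2 ⟨by linarith, by linarith⟩
  -- A bounded continuous function is an affine image of a continuous test with values in `[0, 1]`.
  set a : ℝ := ‖f‖ + 1 with ha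
  have ha0 : 0 < a := by positivity
  have hfb : ∀ x, |f x| ≤ a := fun x => (f.norm_coe_le_norm x).trans (by linarith)
  have hlim := key (fun x => (f x + a) / (2 * a)) (by fun_prop) fun x => by
    have := abs_le.1 (hfb x)
    refine ⟨div_nonneg (by linarith) (by linarith), (div_le_one (by linarith)).2 (by linarith)⟩
  have h3 := (hlim.const_mul (2 * a)).sub_const a
  rw [integral_eq_of_rescale ν f.continuous.measurable ha0 hfb] at h3
  exact h3.congr fun i => integral_eq_of_rescale (Q i)
    (f.continuous.measurable.comp (hXm i)) ha0 fun x => hfb _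

/-- The asymptotic Neyman–Pearson bound for finite mixtures of alternatives. -/
theorem eventually_sum_integral_le_of_neymanPearson {κ : Type*} {J : Finset κ}
    {R : κ → ∀ i, Measure (Ω i)} [∀ j i, IsProbabilityMeasure (R j i)]
    {S : κ → E → ℝ} (hS : ∀ j, Continuous (S j))
    (hX : TendstoInDistribution X F id P μ) (hXm : ∀ i, Measurable (X i))
    (hint : ∀ j ∈ J, Integrable (fun x => Real.exp (S j x)) μ)
    (hone : ∀ j ∈ J, ∫ x, Real.exp (S j x) ∂μ = 1)
    (h : ∀ j ∈ J, LogLRApprox F P (R j) fun i x => S j (X i x))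
    {w : κ → ℝ} (hw : ∀ j, 0 ≤ w j) (hw1 : ∑ j ∈ J, w j = 1) {K : ℝ} (hK : 0 ≤ K) {α : ℝ}
    {ψ : ∀ i, Ω i → ℝ} (hψm : ∀ i, Measurable (ψ i)) (hψ : ∀ i x, ψ i x ∈ Set.Icc (0 : ℝ) 1)
    (hα : ∀ ε : ℝ, 0 < ε → ∀ᶠ i in F, ∫ x, ψ i x ∂(P i) ≤ α + ε) {ε : ℝ} (hε : 0 < ε) :
    ∀ᶠ i in F, ∑ j ∈ J, w j * ∫ x, ψ i x ∂(R j i)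
      ≤ K * α + ∫ x, max (∑ j ∈ J, w j * Real.exp (S j x) - K) 0 ∂μ + ε := by
  have hC : ∀ j, ∃ C : ℝ, 0 ≤ C ∧ (j ∈ J → ∀ᶠ i in F,
      ∫ x, ψ i x ∂(R j i) ≤ ∫ x, ψ i x * min (Real.exp (S j (X i x))) C ∂(P i) + ε / 3) := by
    intro j
    by_cases hj : j ∈ J
    · obtain ⟨K₀, hK₀⟩ := (h j hj).eventually_abs_integral_sub_le (hS j) hX hXm (hint j hj)
        (hone j hj) (show 0 < ε / 3 by positivity)
      refine ⟨max K₀ 0, le_max_right _ _, fun _ => ?_⟩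
      filter_upwards [hK₀ (max K₀ 0) (le_max_left _ _)] with i hi
      have := (abs_le.1 (hi (ψ i) (hψm i) (hψ i))).2
      linarith
    · exact ⟨0, le_rfl, fun h => absurd h hj⟩
  choose C hC0 hC using hC
  set G : E → ℝ := fun x => ∑ j ∈ J, w j * min (Real.exp (S j x)) (C j) with hG
  have hGc : Continuous G := continuous_finsetSum _ fun j _ =>
    continuous_const.mul ((hS j).rexp.min continuous_const)
  have hG0 : ∀ x, 0 ≤ G x := fun x => Finset.sum_nonneg fun j _ =>
    mul_nonneg (hw j) (le_min (Real.exp_pos _).le (hC0 j))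
  have hGb : ∀ x, G x ≤ ∑ j ∈ J, w j * C j := fun x => Finset.sum_le_sum fun j _ =>
    mul_le_mul_of_nonneg_left (min_le_right _ _) (hw j)
  have hGe : ∀ x, G x ≤ ∑ j ∈ J, w j * Real.exp (S j x) := fun x => Finset.sum_le_sum fun j _ =>
    mul_le_mul_of_nonneg_left (min_le_left _ _) (hw j)
  set M := ∑ j ∈ J, w j * C j with hM
  have hmaxb : ∀ x, max (G x - K) 0 ∈ Set.Icc 0 M := fun x =>
    ⟨le_max_right _ _, max_le (by linarith [hGb x]) ((hG0 x).trans (hGb x))⟩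
  have hlim : Tendsto (fun i => ∫ x, max (G (X i x) - K) 0 ∂(P i)) F
      (𝓝 (∫ x, max (G x - K) 0 ∂μ)) := by
    refine hX.tendsto_integral (f := fun x => max (G x - K) 0) (C := M)
      ((hGc.sub continuous_const).max continuous_const) fun x => ?_
    rw [abs_of_nonneg (hmaxb x).1]
    exact (hmaxb x).2
  have hle : ∫ x, max (G x - K) 0 ∂μ
      ≤ ∫ x, max (∑ j ∈ J, w j * Real.exp (S j x) - K) 0 ∂μ := by
    refine integral_mono (integrable_of_mem_Icc
      ((hGc.sub continuous_const).max continuous_const).measurable hmaxb) ?_ fun x =>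
      max_le_max (sub_le_sub_right (hGe x) K) le_rfl
    exact ((integrable_finsetSum _ fun j hj => (hint j hj).const_mul _).sub
      (integrable_const K)).sup (integrable_zero _ _ _)
  have hev : ∀ᶠ i in F, ∀ j ∈ J, ∫ x, ψ i x ∂(R j i)
      ≤ ∫ x, ψ i x * min (Real.exp (S j (X i x))) (C j) ∂(P i) + ε / 3 :=
    (Finset.eventually_all J).2 fun j hj => hC j hj
  -- The slack in the level is multiplied by `K` below, hence the division by `K + 1`; each of the
  -- three errors is then at most `ε / 3`.
  filter_upwards [hev, hα (ε / (3 * (K + 1))) (by positivity),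
    hlim.eventually_le_const (show _ < _ + ε / 3 from lt_add_of_pos_right _ (by positivity))]
    with i hi1 hi2 hi3
  have hTm : ∀ j, Measurable fun x => min (Real.exp (S j (X i x))) (C j) := fun j =>
    ((hS j).rexp.min continuous_const).measurable.comp (hXm i)
  have hTb : ∀ j x, min (Real.exp (S j (X i x))) (C j) ∈ Set.Icc 0 (C j) := fun j x =>
    ⟨le_min (Real.exp_pos _).le (hC0 j), min_le_right _ _⟩
  have hψT : ∀ j, Integrable (fun x => ψ i x * min (Real.exp (S j (X i x))) (C j)) (P i) :=
    fun j => integrable_of_mem_Icc ((hψm i).mul (hTm j)) (a := 0) (b := 1 * C j) fun x =>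
      ⟨mul_nonneg (hψ i x).1 (hTb j x).1,
        mul_le_mul (hψ i x).2 (hTb j x).2 (hTb j x).1 zero_le_one⟩
  have hψi : Integrable (ψ i) (P i) := integrable_of_mem_Icc (hψm i) (hψ i)
  have s1 : ∑ j ∈ J, w j * ∫ x, ψ i x ∂(R j i)
      ≤ ∑ j ∈ J, w j * (∫ x, ψ i x * min (Real.exp (S j (X i x))) (C j) ∂(P i) + ε / 3) :=
    Finset.sum_le_sum fun j hj => mul_le_mul_of_nonneg_left (hi1 j hj) (hw j)
  have s2 : ∑ j ∈ J, w j * (∫ x, ψ i x * min (Real.exp (S j (X i x))) (C j) ∂(P i) + ε / 3)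
      = ∫ x, ψ i x * G (X i x) ∂(P i) + ε / 3 := by
    simp_rw [mul_add]
    rw [Finset.sum_add_distrib, ← Finset.sum_mul, hw1, one_mul]
    congr 1
    simp_rw [← integral_const_mul]
    rw [← integral_finsetSum _ fun j _ => (hψT j).const_mul _]
    congr 1; funext x
    simp only [hG, Finset.mul_sum]
    refine Finset.sum_congr rfl fun j _ => by ring
  have hGX : Measurable fun x => G (X i x) := hGc.measurable.comp (hXm i)
  have hmaxi : Integrable (fun x => max (G (X i x) - K) 0) (P i) :=
    integrable_of_mem_Icc ((hGX.sub measurable_const).max measurable_const) fun x => hmaxb _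
  -- The dual bound holds pointwise: `ψ G ≤ K ψ + (G - K)⁺` for `0 ≤ ψ ≤ 1`.
  have s3 : ∫ x, ψ i x * G (X i x) ∂(P i)
      ≤ ∫ x, (K * ψ i x + max (G (X i x) - K) 0) ∂(P i) := by
    refine integral_mono (integrable_of_mem_Icc ((hψm i).mul hGX) (a := 0) (b := 1 * M) fun x =>
      ⟨mul_nonneg (hψ i x).1 (hG0 _), mul_le_mul (hψ i x).2 (hGb _) (hG0 _) zero_le_one⟩)
      ((hψi.const_mul K).add hmaxi) fun x => ?_
    have h1 := le_max_left (G (X i x) - K) 0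
    have h2 := le_max_right (G (X i x) - K) 0
    have h3 := (hψ i x).1
    have h4 := (hψ i x).2
    simp only
    nlinarith
  rw [integral_add (hψi.const_mul K) hmaxi, integral_const_mul] at s3
  have s4 : K * ∫ x, ψ i x ∂(P i) ≤ K * α + ε / 3 := by
    have h1 := mul_le_mul_of_nonneg_left hi2 hK
    have h2 : K * (ε / (3 * (K + 1))) ≤ ε / 3 := by
      rw [mul_div_assoc', div_le_div_iff₀ (by positivity) (by positivity)]
      nlinarith
    linarith
  linarith

end LeCam

/-! ### Matrices acting on Euclidean spaces -/

section MulVec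

open scoped RealInnerProductSpace

variable {a b c : ℕ}

/-- The action of a matrix on Euclidean vectors. -/
noncomputable def mulEuc (M : Matrix (Fin b) (Fin a) ℝ) (x : Euc a) : Euc b :=
  WithLp.toLp 2 (M *ᵥ x.ofLp)

theorem inner_eq_dotProduct (x y : Euc a) : ⟪x, y⟫ = x.ofLp ⬝ᵥ y.ofLp := by
  rw [EuclideanSpace.inner_eq_star_dotProduct, dotProduct_comm]; simp

@[simp] theorem ofLp_mulEuc (M : Matrix (Fin b) (Fin a) ℝ) (x : Euc a) :
    (mulEuc M x).ofLp = M *ᵥ x.ofLp := rfl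

theorem mulEuc_mulEuc (M : Matrix (Fin c) (Fin b) ℝ) (N : Matrix (Fin b) (Fin a) ℝ) (x : Euc a) :
    mulEuc M (mulEuc N x) = mulEuc (M * N) x := by
  simp [mulEuc, Matrix.mulVec_mulVec]

@[simp] theorem mulEuc_one (x : Euc a) : mulEuc 1 x = x := by simp [mulEuc]

@[simp] theorem mulEuc_zero_left (x : Euc a) : mulEuc (0 : Matrix (Fin b) (Fin a) ℝ) x = 0 := by
  simp [mulEuc]

theorem mulEuc_add (M : Matrix (Fin b) (Fin a) ℝ) (x y : Euc a) :
    mulEuc M (x + y) = mulEuc M x + mulEuc M y := by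
  simp [mulEuc, Matrix.mulVec_add]

theorem mulEuc_sub (M : Matrix (Fin b) (Fin a) ℝ) (x y : Euc a) :
    mulEuc M (x - y) = mulEuc M x - mulEuc M y := by
  simp [mulEuc, Matrix.mulVec_sub]

theorem mulEuc_smul (M : Matrix (Fin b) (Fin a) ℝ) (r : ℝ) (x : Euc a) :
    mulEuc M (r • x) = r • mulEuc M x := by
  simp [mulEuc, Matrix.mulVec_smul]

theorem sub_mulEuc (M N : Matrix (Fin b) (Fin a) ℝ) (x : Euc a) :
    mulEuc (M - N) x = mulEuc M x - mulEuc N x := by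
  simp [mulEuc, Matrix.sub_mulVec]

theorem inner_mulEuc (M : Matrix (Fin b) (Fin a) ℝ) (x : Euc a) (y : Euc b) :
    ⟪mulEuc M x, y⟫ = ⟪x, mulEuc Mᵀ y⟫ := by
  rw [inner_eq_dotProduct, inner_eq_dotProduct, ofLp_mulEuc, ofLp_mulEuc,
    dotProduct_comm, dotProduct_mulVec, Matrix.mulVec_transpose, dotProduct_comm]

theorem continuous_mulEuc_uncurry :
    Continuous fun q : Matrix (Fin b) (Fin a) ℝ × Euc a => mulEuc q.1 q.2 := by
  refine (PiLp.continuous_toLp 2 _).comp ?_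
  exact Continuous.matrix_mulVec continuous_fst ((PiLp.continuous_ofLp 2 _).comp continuous_snd)

@[fun_prop]
theorem continuous_mulEuc (M : Matrix (Fin b) (Fin a) ℝ) : Continuous (mulEuc M) :=
  continuous_mulEuc_uncurry.comp (Continuous.prodMk_right M)

@[fun_prop]
theorem measurable_mulEuc (M : Matrix (Fin b) (Fin a) ℝ) : Measurable (mulEuc M) :=
  (continuous_mulEuc M).measurable

theorem ext_mulEuc {M N : Matrix (Fin b) (Fin a) ℝ} (h : ∀ x, mulEuc M x = mulEuc N x) :
    M = N := by
  refine Matrix.ext_of_mulVec_single fun i => ?_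
  have := congrArg WithLp.ofLp (h (WithLp.toLp 2 (Pi.single i 1)))
  simpa using this

theorem mulEuc_eq_toEuclideanCLM (M : Matrix (Fin a) (Fin a) ℝ) (x : Euc a) :
    Matrix.toEuclideanCLM (𝕜 := ℝ) M x = mulEuc M x := rfl

end MulVec

/-! ### Matrix algebra -/

section MatrixAlgebra

open scoped RealInnerProductSpace MatrixOrder

variable {a b l m p : ℕ}

theorem IsMoorePenrose.unique {A : Matrix (Fin a) (Fin b) ℝ} {X Y : Matrix (Fin b) (Fin a) ℝ}
    (hX : IsMoorePenrose A X) (hY : IsMoorePenrose A Y) : X = Y := by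
  have h1 : A * X = A * Y := by
    calc A * X = (A * X)ᵀ := hX.symm_left.symm
      _ = (A * Y * (A * X))ᵀ := by
        conv_lhs => rw [← hY.mul_mul_left]
        simp only [Matrix.mul_assoc]
      _ = (A * X)ᵀ * (A * Y)ᵀ := Matrix.transpose_mul _ _
      _ = A * X * (A * Y) := by rw [hX.symm_left, hY.symm_left]
      _ = A * X * A * Y := by simp only [Matrix.mul_assoc]
      _ = A * Y := by rw [hX.mul_mul_left]
  have h2 : X * A = Y * A := by
    calc X * A = (X * A)ᵀ := hX.symm_right.symm
      _ = (X * A * (Y * A))ᵀ := by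
        conv_lhs => rw [← hY.mul_mul_left]
        simp only [Matrix.mul_assoc]
      _ = (Y * A)ᵀ * (X * A)ᵀ := Matrix.transpose_mul _ _
      _ = Y * A * (X * A) := by rw [hX.symm_right, hY.symm_right]
      _ = Y * (A * X * A) := by simp only [Matrix.mul_assoc]
      _ = Y * A := by rw [hX.mul_mul_left]
  calc X = X * A * X := hX.mul_mul_right.symm
    _ = Y * A * X := by rw [h2]
    _ = Y * (A * X) := Matrix.mul_assoc _ _ _
    _ = Y * A * Y := by rw [h1, Matrix.mul_assoc]
    _ = Y := hY.mul_mul_right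

theorem pinv_eq_of_isMoorePenrose {A : Matrix (Fin a) (Fin b) ℝ} {X : Matrix (Fin b) (Fin a) ℝ}
    (hX : IsMoorePenrose A X) : pinv A = X :=
  (pinv_spec A).unique hX

theorem pinv_eq_inv {A : Matrix (Fin a) (Fin a) ℝ} (hA : IsUnit A.det) : pinv A = A⁻¹ := by
  refine pinv_eq_of_isMoorePenrose ⟨?_, ?_, ?_, ?_⟩ <;>
    simp [Matrix.mul_nonsing_inv _ hA, Matrix.nonsing_inv_mul _ hA]

theorem isUnit_det_of_rank_eq {A : Matrix (Fin a) (Fin a) ℝ} (h : A.rank = a) :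
    IsUnit A.det := by
  rw [← Matrix.isUnit_iff_isUnit_det, ← Matrix.mulVec_surjective_iff_isUnit,
    ← Matrix.coe_mulVecLin, ← LinearMap.range_eq_top]
  refine Submodule.eq_top_of_finrank_eq ?_
  rw [← Matrix.rank, h]; simp

theorem isUnit_det_gram {A : Matrix (Fin a) (Fin b) ℝ} (h : A.rank = b) :
    IsUnit (Aᵀ * A).det :=
  isUnit_det_of_rank_eq (by rw [Matrix.rank_transpose_mul_self, h])

theorem mulVec_injective_of_rank {A : Matrix (Fin a) (Fin b) ℝ} (h : A.rank = b) :
    Function.Injective A.mulVec := by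
  intro x y hxy
  have := congrArg (fun z => (Aᵀ * A)⁻¹ *ᵥ (Aᵀ *ᵥ z)) hxy
  simpa [Matrix.mulVec_mulVec, ← Matrix.mul_assoc, Matrix.nonsing_inv_mul _ (isUnit_det_gram h)]
    using this

theorem rank_mul_eq_of_rank_left {A : Matrix (Fin a) (Fin b) ℝ} (h : A.rank = b)
    (B : Matrix (Fin b) (Fin l) ℝ) : (A * B).rank = B.rank := by
  refine le_antisymm (Matrix.rank_mul_le_right _ _) ?_
  have hB : B = (Aᵀ * A)⁻¹ * Aᵀ * (A * B) := by
    rw [← Matrix.mul_assoc, Matrix.mul_assoc _ Aᵀ A,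
      Matrix.nonsing_inv_mul _ (isUnit_det_gram h), Matrix.one_mul]
  conv_lhs => rw [hB]
  exact Matrix.rank_mul_le_right _ _

theorem sqrt_mul_sqrt_of_posSemidef {G : Matrix (Fin m) (Fin m) ℝ} (hG : G.PosSemidef) :
    CFC.sqrt G * CFC.sqrt G = G :=
  CFC.sqrt_mul_sqrt_self G hG.nonneg

theorem transpose_sqrt (G : Matrix (Fin m) (Fin m) ℝ) : (CFC.sqrt G)ᵀ = CFC.sqrt G := by
  have h : IsSelfAdjoint (CFC.sqrt G) := IsSelfAdjoint.of_nonneg (CFC.sqrt_nonneg G)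
  rw [IsSelfAdjoint, Matrix.star_eq_conjTranspose,
    Matrix.conjTranspose_eq_transpose_of_trivial] at h
  exact h

theorem exists_factor_of_posSemidef {G : Matrix (Fin m) (Fin m) ℝ} (hG : G.PosSemidef)
    (hr : G.rank = m) : ∃ R : Matrix (Fin m) (Fin m) ℝ, IsUnit R.det ∧ G = Rᵀ * R := by
  have hR : G = (CFC.sqrt G)ᵀ * CFC.sqrt G := by
    rw [transpose_sqrt, sqrt_mul_sqrt_of_posSemidef hG]
  refine ⟨CFC.sqrt G, isUnit_det_of_rank_eq ?_, hR⟩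
  rw [← Matrix.rank_transpose_mul_self, ← hR, hr]

/-- With `G = R' R` this is the Gram matrix of `R L`, whose columns are independent. -/
theorem isUnit_det_restrict {G : Matrix (Fin m) (Fin m) ℝ} (hG : G.PosSemidef)
    (hr : G.rank = m) {L : Matrix (Fin m) (Fin l) ℝ} (hL : L.rank = l) :
    IsUnit (Lᵀ * G * L).det := by
  obtain ⟨R, hR, rfl⟩ := exists_factor_of_posSemidef hG hr
  have h1 : R.rank = m := by
    rw [← Matrix.rank_transpose_mul_self, hr]
  have h2 := isUnit_det_gram (A := R * L) (by rw [rank_mul_eq_of_rank_left h1, hL])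
  simpa [Matrix.transpose_mul, Matrix.mul_assoc] using h2

/-- A matrix with orthonormal rows that span the orthogonal complement of the range of `W`. -/
theorem exists_orthonormal_complement {W : Matrix (Fin m) (Fin l) ℝ} (hW : W.rank = l) :
    ∃ N : Matrix (Fin (m - l)) (Fin m) ℝ, N * Nᵀ = 1 ∧ N * W = 0 ∧
      Nᵀ * N = 1 - W * (Wᵀ * W)⁻¹ * Wᵀ := by
  classical
  set T : Euc l →ₗ[ℝ] Euc m := Matrix.toLpLin 2 2 W with hT
  have hTW : ∀ x, T x = mulEuc W x := fun x => rfl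
  have hTinj : Function.Injective T := by
    intro x y hxy
    have h := mulVec_injective_of_rank hW (congrArg WithLp.ofLp hxy)
    exact WithLp.ofLp_injective 2 h
  set U : Submodule ℝ (Euc m) := LinearMap.range T with hU
  have hUl : Module.finrank ℝ U = l := by
    rw [hU, LinearMap.finrank_range_of_inj hTinj]; simp
  have hUo : Module.finrank ℝ Uᗮ = m - l := by
    have := U.finrank_add_finrank_orthogonal
    rw [hUl, finrank_euclideanSpace_fin] at this
    omega
  set e : OrthonormalBasis (Fin (m - l)) ℝ Uᗮ :=
    (stdOrthonormalBasis ℝ Uᗮ).reindex (finCongr hUo) with he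
  set N : Matrix (Fin (m - l)) (Fin m) ℝ := Matrix.of fun i j => (e i : Euc m) j with hN
  have hNrow : ∀ (x : Euc m) i, (N *ᵥ x.ofLp) i = ⟪(e i : Euc m), x⟫ := by
    intro x i
    rw [inner_eq_dotProduct]; rfl
  have h1 : N * Nᵀ = 1 := by
    ext i j
    have h := orthonormal_iff_ite.1 e.orthonormal i j
    rw [Submodule.coe_inner, inner_eq_dotProduct] at h
    rw [Matrix.one_apply, ← h]; rfl
  have h2 : N * W = 0 := by
    refine ext_mulEuc fun x => ?_
    rw [← mulEuc_mulEuc, mulEuc_zero_left]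
    ext i
    have hx : mulEuc W x ∈ U := ⟨x, hTW x⟩
    have h := (Submodule.mem_orthogonal' U _).1 (e i).2 _ hx
    rw [ofLp_mulEuc, hNrow, h]; rfl
  refine ⟨N, h1, h2, ?_⟩
  have hgram := isUnit_det_gram hW
  have h2T : Wᵀ * Nᵀ = 0 := by rw [← Matrix.transpose_mul, h2, Matrix.transpose_zero]
  rw [eq_sub_iff_add_eq, ← sub_eq_zero, ← neg_eq_zero, neg_sub]
  -- The defect in the decomposition of the identity. Its columns are orthogonal to the range of `W`
  -- and also to a basis of the orthogonal complement, so they vanish.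
  set Z := 1 - (Nᵀ * N + W * (Wᵀ * W)⁻¹ * Wᵀ) with hZ
  have hNZ : N * Z = 0 := by
    rw [hZ, Matrix.mul_sub, Matrix.mul_add, Matrix.mul_one, ← Matrix.mul_assoc, h1,
      ← Matrix.mul_assoc, ← Matrix.mul_assoc, h2]
    simp
  have hWZ : Wᵀ * Z = 0 := by
    rw [hZ, Matrix.mul_sub, Matrix.mul_add, Matrix.mul_one, ← Matrix.mul_assoc, h2T,
      ← Matrix.mul_assoc, ← Matrix.mul_assoc, Matrix.mul_nonsing_inv _ hgram]
    simp
  refine ext_mulEuc fun x => ?_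
  rw [mulEuc_zero_left]
  set y := mulEuc Z x with hy
  have hyU : y ∈ Uᗮ := by
    rw [Submodule.mem_orthogonal]
    rintro _ ⟨u, rfl⟩
    rw [hTW, inner_mulEuc, hy, mulEuc_mulEuc, hWZ, mulEuc_zero_left, inner_zero_right]
  have hyN : mulEuc N y = 0 := by rw [hy, mulEuc_mulEuc, hNZ, mulEuc_zero_left]
  have hy0 : (⟨y, hyU⟩ : Uᗮ) = 0 := by
    rw [← e.sum_repr' ⟨y, hyU⟩]
    refine Finset.sum_eq_zero fun i _ => ?_
    have h3 := congrFun (congrArg WithLp.ofLp hyN) i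
    rw [ofLp_mulEuc, hNrow] at h3
    rw [Submodule.coe_inner, h3]
    exact zero_smul ℝ _
  exact congrArg Subtype.val hy0

/-- The whitening matrix of the information orthogonal to the range of `L`. -/
theorem exists_whitening {G : Matrix (Fin m) (Fin m) ℝ} (hG : G.PosSemidef) (hr : G.rank = m)
    {L : Matrix (Fin m) (Fin l) ℝ} (hL : L.rank = l) :
    ∃ A : Matrix (Fin (m - l)) (Fin m) ℝ, A * G * Aᵀ = 1 ∧ A * G * L = 0 ∧
      Aᵀ * A = G⁻¹ - L * (Lᵀ * G * L)⁻¹ * Lᵀ := by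
  obtain ⟨R, hR, rfl⟩ := exists_factor_of_posSemidef hG hr
  have h1 : R.rank = m := by rw [← Matrix.rank_transpose_mul_self, hr]
  obtain ⟨N, hN1, hN2, hN3⟩ := exists_orthonormal_complement (W := R * L)
    (by rw [rank_mul_eq_of_rank_left h1, hL])
  have hRT : IsUnit Rᵀ.det := by rwa [Matrix.det_transpose]
  -- If `δ` has covariance `G = R' R`, then `(R')⁻¹ δ` has identity covariance; `N` keeps its
  -- coordinates orthogonal to the range of `R L`.
  refine ⟨N * Rᵀ⁻¹, ?_, ?_, ?_⟩
  · calc N * Rᵀ⁻¹ * (Rᵀ * R) * (N * Rᵀ⁻¹)ᵀ = N * (Rᵀ⁻¹ * Rᵀ) * (R * R⁻¹) * Nᵀ := by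
          simp only [Matrix.transpose_mul, Matrix.transpose_nonsing_inv, Matrix.transpose_transpose,
            Matrix.mul_assoc]
      _ = 1 := by
          rw [Matrix.nonsing_inv_mul _ hRT, Matrix.mul_nonsing_inv _ hR, Matrix.mul_one,
            Matrix.mul_one, hN1]
  · calc N * Rᵀ⁻¹ * (Rᵀ * R) * L = N * (Rᵀ⁻¹ * Rᵀ) * (R * L) := by simp only [Matrix.mul_assoc]
      _ = 0 := by rw [Matrix.nonsing_inv_mul _ hRT, Matrix.mul_one, hN2]
  · calc (N * Rᵀ⁻¹)ᵀ * (N * Rᵀ⁻¹) = R⁻¹ * (Nᵀ * N) * Rᵀ⁻¹ := by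
          simp only [Matrix.transpose_mul, Matrix.transpose_nonsing_inv, Matrix.transpose_transpose,
            Matrix.mul_assoc]
      _ = R⁻¹ * Rᵀ⁻¹ - (R⁻¹ * R) * L * (Lᵀ * (Rᵀ * R) * L)⁻¹ * Lᵀ * (Rᵀ * Rᵀ⁻¹) := by
          rw [hN3, Matrix.mul_sub, Matrix.sub_mul, Matrix.mul_one]
          simp only [Matrix.transpose_mul, Matrix.mul_assoc]
      _ = _ := by
          rw [Matrix.nonsing_inv_mul _ hR, Matrix.mul_nonsing_inv _ hRT, Matrix.one_mul,
            Matrix.mul_one, Matrix.mul_inv_rev]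

/-- The two quadratic statistics coincide when the range of `B` is that of `J * L`. -/
theorem curvedStatistic_eq_flatStatistic {G : Matrix (Fin m) (Fin m) ℝ} (hG : G.PosSemidef)
    (hr : G.rank = m) {L : Matrix (Fin m) (Fin l) ℝ} (hL : L.rank = l)
    {J : Matrix (Fin p) (Fin m) ℝ} (hJ : J.rank = m) {M : Matrix (Fin l) (Fin l) ℝ}
    (hM : IsUnit M.det) {D : Matrix (Fin m) (Fin p) ℝ} (hD : D = (Jᵀ * J)⁻¹ * Jᵀ) (δ : Euc m) :
    curvedStatistic (mulEuc Dᵀ δ) (Dᵀ * G * D) (J * L * M) = flatStatistic δ G L := by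
  have hGu := isUnit_det_of_rank_eq hr
  have hGT : Gᵀ = G := by
    have := hG.1; rwa [Matrix.IsHermitian, Matrix.conjTranspose_eq_transpose_of_trivial] at this
  have hDJ : D * J = 1 := by
    rw [hD, Matrix.mul_assoc, Matrix.nonsing_inv_mul _ (isUnit_det_gram hJ)]
  have hJD : (J * D)ᵀ = J * D := by
    rw [hD]
    simp [Matrix.transpose_mul, Matrix.transpose_nonsing_inv, Matrix.mul_assoc]
  have hJDT : Jᵀ * Dᵀ = 1 := by rw [← Matrix.transpose_mul, hDJ, Matrix.transpose_one]
  have e1 : Dᵀ * G * D * (J * G⁻¹ * Jᵀ) = J * D := by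
    calc Dᵀ * G * D * (J * G⁻¹ * Jᵀ) = Dᵀ * (G * (D * J) * G⁻¹) * Jᵀ := by
          simp only [Matrix.mul_assoc]
      _ = J * D := by
          rw [hDJ, Matrix.mul_one, Matrix.mul_nonsing_inv _ hGu, Matrix.mul_one,
            ← Matrix.transpose_mul, hJD]
  have e2 : J * G⁻¹ * Jᵀ * (Dᵀ * G * D) = J * D := by
    calc J * G⁻¹ * Jᵀ * (Dᵀ * G * D) = J * (G⁻¹ * (Jᵀ * Dᵀ) * G) * D := by
          simp only [Matrix.mul_assoc]
      _ = J * D := by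
          rw [hJDT, Matrix.mul_one, Matrix.nonsing_inv_mul _ hGu, Matrix.mul_one]
  -- Both products of the candidate inverse with `Dᵀ * G * D` equal `J * D`, the orthogonal
  -- projection on the range of `J`; the symmetry conditions follow.
  have hp1 : pinv (Dᵀ * G * D) = J * G⁻¹ * Jᵀ := by
    refine pinv_eq_of_isMoorePenrose ⟨?_, ?_, ?_, ?_⟩
    · rw [e1]
      calc J * D * (Dᵀ * G * D) = (J * D)ᵀ * (Dᵀ * G * D) := by rw [hJD]
        _ = Dᵀ * (Jᵀ * Dᵀ) * G * D := by
            rw [Matrix.transpose_mul]; simp only [Matrix.mul_assoc]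
        _ = _ := by rw [hJDT, Matrix.mul_one]
    · rw [e2]
      calc J * D * (J * G⁻¹ * Jᵀ) = J * (D * J) * G⁻¹ * Jᵀ := by simp only [Matrix.mul_assoc]
        _ = _ := by rw [hDJ, Matrix.mul_one]
    · rw [e1, hJD]
    · rw [e2, hJD]
  have hLGL := isUnit_det_restrict hG hr hL
  have hMT : IsUnit Mᵀ.det := by rwa [Matrix.det_transpose]
  have e3 : (J * L * M)ᵀ * (Dᵀ * G * D) * (J * L * M) = Mᵀ * (Lᵀ * G * L) * M := by
    calc (J * L * M)ᵀ * (Dᵀ * G * D) * (J * L * M)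
        = Mᵀ * (Lᵀ * (Jᵀ * Dᵀ) * G * (D * J) * L) * M := by
          simp only [Matrix.transpose_mul, Matrix.mul_assoc]
      _ = _ := by rw [hJDT, hDJ, Matrix.mul_one, Matrix.mul_one]
  have hp2 : pinv ((J * L * M)ᵀ * (Dᵀ * G * D) * (J * L * M))
      = M⁻¹ * (Lᵀ * G * L)⁻¹ * Mᵀ⁻¹ := by
    rw [e3, pinv_eq_inv (by rw [Matrix.det_mul, Matrix.det_mul]; exact (hMT.mul hLGL).mul hM),
      Matrix.mul_inv_rev, Matrix.mul_inv_rev]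
    simp only [Matrix.mul_assoc]
  -- The invertible factor `M` cancels: the projection depends on the tangent space alone, not on
  -- its chart.
  have e4 : J * L * M * (M⁻¹ * (Lᵀ * G * L)⁻¹ * Mᵀ⁻¹) * (J * L * M)ᵀ
      = J * (L * (Lᵀ * G * L)⁻¹ * Lᵀ) * Jᵀ := by
    calc J * L * M * (M⁻¹ * (Lᵀ * G * L)⁻¹ * Mᵀ⁻¹) * (J * L * M)ᵀ
        = J * (L * (M * M⁻¹) * (Lᵀ * G * L)⁻¹ * (Mᵀ⁻¹ * Mᵀ) * Lᵀ) * Jᵀ := by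
          simp only [Matrix.transpose_mul, Matrix.mul_assoc]
      _ = _ := by
          rw [Matrix.mul_nonsing_inv _ hM, Matrix.nonsing_inv_mul _ hMT, Matrix.mul_one,
            Matrix.mul_one]
  have e5 : D * (J * G⁻¹ * Jᵀ - J * (L * (Lᵀ * G * L)⁻¹ * Lᵀ) * Jᵀ) * Dᵀ
      = G⁻¹ - L * (Lᵀ * G * L)⁻¹ * Lᵀ := by
    have : J * G⁻¹ * Jᵀ - J * (L * (Lᵀ * G * L)⁻¹ * Lᵀ) * Jᵀ
        = J * (G⁻¹ - L * (Lᵀ * G * L)⁻¹ * Lᵀ) * Jᵀ := by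
      rw [Matrix.mul_sub, Matrix.sub_mul]
    rw [this]
    calc D * (J * (G⁻¹ - L * (Lᵀ * G * L)⁻¹ * Lᵀ) * Jᵀ) * Dᵀ
        = D * J * (G⁻¹ - L * (Lᵀ * G * L)⁻¹ * Lᵀ) * (Jᵀ * Dᵀ) := by simp only [Matrix.mul_assoc]
      _ = _ := by rw [hDJ, hJDT, Matrix.one_mul, Matrix.mul_one]
  rw [curvedStatistic, hp1, hp2, e4, flatStatistic, ← e5, ofLp_mulEuc, ← Matrix.mulVec_mulVec,
    ← Matrix.mulVec_mulVec, Matrix.mulVec_transpose, Matrix.dotProduct_mulVec δ.ofLp D]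

theorem flatStatistic_eq_norm_sq {k : ℕ} {G : Matrix (Fin m) (Fin m) ℝ}
    {L : Matrix (Fin m) (Fin l) ℝ} {A : Matrix (Fin k) (Fin m) ℝ}
    (hA : Aᵀ * A = G⁻¹ - L * (Lᵀ * G * L)⁻¹ * Lᵀ) (δ : Euc m) :
    flatStatistic δ G L = ‖mulEuc A δ‖ ^ 2 := by
  rw [← real_inner_self_eq_norm_sq, inner_mulEuc, mulEuc_mulEuc, inner_eq_dotProduct, hA]
  rfl

end MatrixAlgebra

/-! ### Multivariate Gaussian shifts -/

section MultivariateGaussian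

open scoped RealInnerProductSpace MatrixOrder

variable {a b m : ℕ}

theorem multivariateGaussian_map_mulEuc {G : Matrix (Fin a) (Fin a) ℝ} (hG : G.PosSemidef)
    (M : Matrix (Fin b) (Fin a) ℝ) :
    (multivariateGaussian 0 G).map (mulEuc M) = multivariateGaussian 0 (M * G * Mᵀ) := by
  have hp : IsProbabilityMeasure ((multivariateGaussian 0 G).map (mulEuc M)) :=
    Measure.isProbabilityMeasure_map (by fun_prop)
  have hMGM : (M * G * Mᵀ).PosSemidef := by
    have := hG.mul_mul_conjTranspose_same M
    rwa [Matrix.conjTranspose_eq_transpose_of_trivial] at this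
  refine Measure.ext_of_charFun ?_
  funext t
  rw [charFun_multivariateGaussian hMGM, charFun_apply, integral_map (by fun_prop) (by fun_prop)]
  simp_rw [inner_mulEuc]
  rw [← charFun_apply, charFun_multivariateGaussian hG]
  congr 2
  · simp
  · congr 2
    rw [ofLp_mulEuc, Matrix.mulVec_transpose, ← Matrix.dotProduct_mulVec, Matrix.mulVec_mulVec,
      ← Matrix.mulVec_transpose, Matrix.mulVec_mulVec]

theorem multivariateGaussian_eq_map_sqrt (G : Matrix (Fin m) (Fin m) ℝ) :
    multivariateGaussian 0 G = (stdGaussian (Euc m)).map (mulEuc (CFC.sqrt G)) := by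
  rw [multivariateGaussian]
  congr 1
  funext x
  rw [zero_add, mulEuc_eq_toEuclideanCLM]

/-- The log-likelihood ratio of the Gaussian shift by `τ` with information `G`. -/
noncomputable def gaussianLogLR (G : Matrix (Fin m) (Fin m) ℝ) (τ x : Euc m) : ℝ :=
  ⟪τ, x⟫ - ⟪τ, mulEuc G τ⟫ / 2

theorem continuous_gaussianLogLR (G : Matrix (Fin m) (Fin m) ℝ) (τ : Euc m) :
    Continuous (gaussianLogLR G τ) := by
  unfold gaussianLogLR; fun_prop

/-- Writing `x = G^{1/2} z` turns the LAN expansion into a likelihood ratio for the standard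
Gaussian shift by `G^{1/2} τ`. Unlike inversion of `G`, this works for singular information. -/
theorem exp_gaussianLogLR_sqrt {G : Matrix (Fin m) (Fin m) ℝ} (hG : G.PosSemidef) (τ z : Euc m) :
    Real.exp (gaussianLogLR G τ (mulEuc (CFC.sqrt G) z))
      = gaussianLR (mulEuc (CFC.sqrt G) τ) z := by
  rw [gaussianLR, gaussianLogLR]
  congr 2
  · rw [inner_mulEuc, transpose_sqrt]
  · rw [← real_inner_self_eq_norm_sq, inner_mulEuc, transpose_sqrt, mulEuc_mulEuc,
      sqrt_mul_sqrt_of_posSemidef hG]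

theorem integrable_exp_gaussianLogLR {G : Matrix (Fin m) (Fin m) ℝ} (hG : G.PosSemidef)
    (τ : Euc m) :
    Integrable (fun x => Real.exp (gaussianLogLR G τ x)) (multivariateGaussian 0 G) := by
  rw [multivariateGaussian_eq_map_sqrt, integrable_map_measure
    (continuous_gaussianLogLR G τ).rexp.measurable.aestronglyMeasurable (by fun_prop)]
  refine (integrable_gaussianLR (mulEuc (CFC.sqrt G) τ)).congr (ae_of_all _ fun z => ?_)
  exact (exp_gaussianLogLR_sqrt hG τ z).symm

theorem integral_exp_gaussianLogLR {G : Matrix (Fin m) (Fin m) ℝ} (hG : G.PosSemidef)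
    (τ : Euc m) : ∫ x, Real.exp (gaussianLogLR G τ x) ∂(multivariateGaussian 0 G) = 1 := by
  rw [multivariateGaussian_eq_map_sqrt, integral_map (by fun_prop)
    (continuous_gaussianLogLR G τ).rexp.measurable.aestronglyMeasurable]
  simp_rw [exp_gaussianLogLR_sqrt hG]
  exact integral_gaussianLR _

/-- The Cameron–Martin formula for centered multivariate Gaussian measures. -/
theorem multivariateGaussian_withDensity {G : Matrix (Fin m) (Fin m) ℝ} (hG : G.PosSemidef)
    (τ : Euc m) :
    (multivariateGaussian 0 G).withDensity
        (fun x => ENNReal.ofReal (Real.exp (gaussianLogLR G τ x)))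
      = (multivariateGaussian 0 G).map (fun x => x + mulEuc G τ) := by
  have hm : Measurable fun x => ENNReal.ofReal (Real.exp (gaussianLogLR G τ x)) :=
    (continuous_gaussianLogLR G τ).rexp.measurable.ennreal_ofReal
  refine Measure.ext fun s hs => ?_
  rw [withDensity_apply _ hs, ← lintegral_indicator hs, multivariateGaussian_eq_map_sqrt,
    lintegral_map (hm.indicator hs) (by fun_prop), Measure.map_map (by fun_prop) (by fun_prop),
    Measure.map_apply (by fun_prop) hs]
  have h1 : ∀ z, s.indicator (fun x => ENNReal.ofReal (Real.exp (gaussianLogLR G τ x)))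
      (mulEuc (CFC.sqrt G) z) = ENNReal.ofReal (gaussianLR (mulEuc (CFC.sqrt G) τ) z) *
        (mulEuc (CFC.sqrt G) ⁻¹' s).indicator 1 z := by
    intro z
    by_cases hz : mulEuc (CFC.sqrt G) z ∈ s
    · rw [Set.indicator_of_mem hz, Set.indicator_of_mem (by exact hz), exp_gaussianLogLR_sqrt hG]
      simp
    · rw [Set.indicator_of_notMem hz, Set.indicator_of_notMem (by exact hz), mul_zero]
  have hms : MeasurableSet (mulEuc (CFC.sqrt G) ⁻¹' s) := measurable_mulEuc _ hs
  simp_rw [h1]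
  rw [lintegral_gaussianLR_mul _ (measurable_one.indicator hms)]
  have h2 : (fun z => (mulEuc (CFC.sqrt G) ⁻¹' s).indicator (1 : Euc m → ℝ≥0∞)
      (z + mulEuc (CFC.sqrt G) τ))
      = (((fun x => x + mulEuc G τ) ∘ mulEuc (CFC.sqrt G)) ⁻¹' s).indicator 1 := by
    funext z
    have : mulEuc (CFC.sqrt G) (z + mulEuc (CFC.sqrt G) τ)
        = mulEuc (CFC.sqrt G) z + mulEuc G τ := by
      rw [mulEuc_add, mulEuc_mulEuc, sqrt_mul_sqrt_of_posSemidef hG]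
    have hiff : z + mulEuc (CFC.sqrt G) τ ∈ mulEuc (CFC.sqrt G) ⁻¹' s
        ↔ z ∈ ((fun x => x + mulEuc G τ) ∘ mulEuc (CFC.sqrt G)) ⁻¹' s := by
      rw [Set.mem_preimage, this]; rfl
    by_cases hz : z ∈ ((fun x => x + mulEuc G τ) ∘ mulEuc (CFC.sqrt G)) ⁻¹' s
    · rw [Set.indicator_of_mem hz, Set.indicator_of_mem (hiff.2 hz)]; rfl
    · rw [Set.indicator_of_notMem hz, Set.indicator_of_notMem (hiff.not.2 hz)]
  rw [h2, lintegral_indicator_one]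
  exact (show Measurable ((fun x => x + mulEuc G τ) ∘ mulEuc (CFC.sqrt G)) by fun_prop) hs

theorem multivariateGaussian_whitening {k : ℕ} {G : Matrix (Fin m) (Fin m) ℝ}
    (hG : G.PosSemidef) {A : Matrix (Fin k) (Fin m) ℝ} (hA : A * G * Aᵀ = 1) :
    (multivariateGaussian 0 G).map (mulEuc A) = stdGaussian (Euc k) := by
  rw [multivariateGaussian_map_mulEuc hG, hA, multivariateGaussian_zero_one]

end MultivariateGaussian

/-! ### Local sequences -/

section LocalSeq

variable {d : ℕ} {S : Set (Euc d)} {θ : Euc d}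

theorem IsLocalSeq.tendsto {t : ℕ → Euc d} (ht : IsLocalSeq S θ t) :
    Tendsto t atTop (𝓝 θ) := by
  obtain ⟨-, M, hM⟩ := ht
  rw [tendsto_iff_norm_sub_tendsto_zero]
  have h1 : Tendsto (fun n : ℕ => M * (√(n : ℝ))⁻¹) atTop (𝓝 0) := by
    have : Tendsto (fun n : ℕ => (√(n : ℝ))⁻¹) atTop (𝓝 0) :=
      tendsto_inv_atTop_zero.comp (Real.tendsto_sqrt_atTop.comp tendsto_natCast_atTop_atTop)
    simpa using this.const_mul M
  refine squeeze_zero' (Eventually.of_forall fun n => norm_nonneg _) ?_ h1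
  filter_upwards [eventually_gt_atTop 0] with n hn
  have hs : 0 < √(n : ℝ) := Real.sqrt_pos.2 (by exact_mod_cast hn)
  rw [← div_eq_mul_inv, le_div_iff₀ hs, mul_comm]
  exact hM n

theorem isLocalSeq_of_eventually {t : ℕ → Euc d} (hS : ∀ n, t n ∈ S) {M : ℝ}
    (hM : ∀ᶠ n : ℕ in atTop, √(n : ℝ) * ‖t n - θ‖ ≤ M) : IsLocalSeq S θ t := by
  refine ⟨hS, ?_⟩
  have h : IsBoundedUnder (· ≤ ·) atTop fun n : ℕ => √(n : ℝ) * ‖t n - θ‖ := ⟨M, hM⟩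
  obtain ⟨M', hM'⟩ := h.bddAbove_range
  exact ⟨M', fun n => hM' ⟨n, rfl⟩⟩

theorem isLocalSeq_const (hθ : θ ∈ S) : IsLocalSeq S θ fun _ => θ :=
  ⟨fun _ => hθ, 0, fun n => by simp⟩

theorem IsLocalSeq.mono {S' : Set (Euc d)} {t : ℕ → Euc d} (ht : IsLocalSeq S θ t)
    (h : S ⊆ S') : IsLocalSeq S' θ t :=
  ⟨fun n => h (ht.1 n), ht.2⟩

end LocalSeq

/-! ### Consequences of local asymptotic normality -/

section ULAN

open scoped RealInnerProductSpace

variable {𝓧 : ℕ → Type*} [∀ n, MeasurableSpace (𝓧 n)] {d : ℕ}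
  {P : ∀ n, Euc d → ProbabilityMeasure (𝓧 n)} {S : Set (Euc d)}
  {Δ : ∀ n, Euc d → 𝓧 n → Euc d} {Γ : Euc d → Matrix (Fin d) (Fin d) ℝ}

theorem IsULAN.tendstoInDistribution_central (h : IsULAN P S Δ Γ) {θ : Euc d} (hθ : θ ∈ S)
    {s : ℕ → Euc d} (hs : IsLocalSeq S θ s) {F : Filter ℕ} (hF : F ≤ atTop) :
    TendstoInDistribution (fun n => Δ n (s n)) F id (fun n => (P n (s n) : Measure (𝓧 n)))
      (multivariateGaussian 0 (Γ θ)) :=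
  (h.asymptotic_normality θ hθ s hs).mono_filter hF

theorem IsULAN.logLRApprox_seq (h : IsULAN P S Δ Γ) {θ : Euc d} (hθ : θ ∈ S)
    {s t : ℕ → Euc d} (hs : IsLocalSeq S θ s) (ht : IsLocalSeq S θ t) :
    LogLRApprox atTop (fun n => (P n (s n) : Measure (𝓧 n)))
      (fun n => (P n (t n) : Measure (𝓧 n)))
      (fun n x => gaussianLogLR (Γ θ) (√(n : ℝ) • (t n - s n)) (Δ n (s n) x)) := by
  intro ε hε
  obtain ⟨M, hM⟩ := hs.2
  obtain ⟨M', hM'⟩ := ht.2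
  have hb : ∃ C : ℝ, ∀ n : ℕ, ‖√(n : ℝ) • (t n - s n)‖ ≤ C := by
    refine ⟨M' + M, fun n => ?_⟩
    rw [norm_smul, Real.norm_of_nonneg (Real.sqrt_nonneg _)]
    have h1 : ‖t n - s n‖ ≤ ‖t n - θ‖ + ‖s n - θ‖ := by
      have := norm_sub_le (t n - θ) (s n - θ)
      rwa [sub_sub_sub_cancel_right] at this
    have h2 := mul_le_mul_of_nonneg_left h1 (Real.sqrt_nonneg (n : ℝ))
    linarith [hM n, hM' n]
  have hcancel : ∀ n : ℕ, 0 < n → s n + (√(n : ℝ))⁻¹ • (√(n : ℝ) • (t n - s n)) = t n := by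
    intro n hn
    have hpos : √(n : ℝ) ≠ 0 := (Real.sqrt_pos.2 (by exact_mod_cast hn)).ne'
    rw [inv_smul_smul₀ hpos, add_sub_cancel]
  have hmem : ∀ n : ℕ, s n + (√(n : ℝ))⁻¹ • (√(n : ℝ) • (t n - s n)) ∈ S := by
    intro n
    -- At `n = 0` the factor `(√0)⁻¹` is `0` by convention, so the perturbed point is `s 0`.
    rcases Nat.eq_zero_or_pos n with rfl | hn
    · simpa using hs.1 0
    · rw [hcancel n hn]; exact ht.1 n
  have hq := h.quadratic_expansion θ hθ s hs (fun n => √(n : ℝ) • (t n - s n)) hb hmem ε hε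
  refine hq.congr' ?_
  filter_upwards [eventually_gt_atTop 0] with n hn
  simp only [hcancel n hn, gaussianLogLR, inner_eq_dotProduct, ofLp_mulEuc, one_div,
    inv_mul_eq_div]

/-- The varying direction is replaced by its limit: the central sequence is tight, so a vanishing
change of direction changes the expansion by `o_P(1)`. -/
theorem IsULAN.logLRApprox (h : IsULAN P S Δ Γ) {θ : Euc d} (hθ : θ ∈ S)
    {s t : ℕ → Euc d} (hs : IsLocalSeq S θ s) (ht : IsLocalSeq S θ t) {F : Filter ℕ}
    (hF : F ≤ atTop) {τ : Euc d} (hτ : Tendsto (fun n : ℕ => √(n : ℝ) • (t n - s n)) F (𝓝 τ)) :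
    LogLRApprox F (fun n => (P n (s n) : Measure (𝓧 n)))
      (fun n => (P n (t n) : Measure (𝓧 n)))
      (fun n x => gaussianLogLR (Γ θ) τ (Δ n (s n) x)) := by
  refine ((h.logLRApprox_seq hθ hs ht).mono_filter hF).congr_approx fun ε hε => ?_
  refine (h.tendstoInDistribution_central hθ hs hF).tendsto_measure_abs_ge
    (g := fun q : Euc d × Euc d => gaussianLogLR (Γ θ) q.2 q.1 - gaussianLogLR (Γ θ) τ q.1)
    ?_ hτ (fun x => sub_self _) hε
  unfold gaussianLogLR
  have := continuous_mulEuc (Γ θ)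
  fun_prop

/-- The limit law of the central sequence under local alternatives. -/
theorem IsULAN.tendstoInDistribution_shift (h : IsULAN P S Δ Γ) {θ : Euc d} (hθ : θ ∈ S)
    {t : ℕ → Euc d} (ht : IsLocalSeq S θ t) {F : Filter ℕ}
    (hF : F ≤ atTop) {τ : Euc d} (hτ : Tendsto (fun n : ℕ => √(n : ℝ) • (t n - θ)) F (𝓝 τ))
    {k : ℕ} {A : Matrix (Fin k) (Fin d) ℝ} (hA : A * Γ θ * Aᵀ = 1)
    {ν : Measure (Euc k)} [IsProbabilityMeasure ν]
    (hν : ν = (stdGaussian (Euc k)).map (fun x => x + mulEuc (A * Γ θ) τ)) :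
    TendstoInDistribution (fun n x => mulEuc A (Δ n θ x)) F id
      (fun n => (P n (t n) : Measure (𝓧 n))) ν := by
  have hG := h.posSemidef_info θ hθ
  have hs := isLocalSeq_const hθ
  have hp : IsProbabilityMeasure
      ((multivariateGaussian 0 (Γ θ)).map (fun x => x + mulEuc (Γ θ) τ)) :=
    Measure.isProbabilityMeasure_map (by fun_prop)
  have h1 := (h.logLRApprox hθ hs ht hF hτ).tendstoInDistribution
    (continuous_gaussianLogLR (Γ θ) τ) (h.tendstoInDistribution_central hθ hs hF)
    (fun n => h.measurable_central n θ hθ) (integrable_exp_gaussianLogLR hG τ)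
    (integral_exp_gaussianLogLR hG τ) (multivariateGaussian_withDensity hG τ)
  refine h1.map_continuous (continuous_mulEuc A) ?_
  rw [hν, ← multivariateGaussian_whitening hG hA, Measure.map_map (by fun_prop) (by fun_prop),
    Measure.map_map (by fun_prop) (by fun_prop)]
  congr 1
  funext x
  simp [mulEuc_add, mulEuc_mulEuc]

end ULAN

/-! ### Immersions and charts -/

section Geometry

variable {a b l d m p : ℕ}

theorem fderiv_eq_mulEuc (f : Euc a → Euc b) (x v : Euc a) :
    fderiv ℝ f x v = mulEuc (jacobian f x) v := by
  have hv : v = ∑ j, v j • EuclideanSpace.single j (1 : ℝ) := by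
    have := (EuclideanSpace.basisFun (Fin a) ℝ).sum_repr v
    simpa using this.symm
  conv_lhs => rw [hv]
  ext i
  simp only [map_sum, map_smul, ofLp_mulEuc, Matrix.mulVec, dotProduct, jacobian, Matrix.of_apply]
  simp [mul_comm]

theorem mulEuc_leftInvJacobian {f : Euc a → Euc b} {x : Euc a} (hr : (jacobian f x).rank = a)
    (v : Euc a) : mulEuc (leftInvJacobian f x) (mulEuc (jacobian f x) v) = v := by
  rw [mulEuc_mulEuc, leftInvJacobian, Matrix.mul_assoc,
    Matrix.nonsing_inv_mul _ (isUnit_det_gram hr), mulEuc_one]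

theorem exists_norm_mulEuc_le (M : Matrix (Fin b) (Fin a) ℝ) :
    ∃ C : ℝ, 0 < C ∧ ∀ v, ‖mulEuc M v‖ ≤ C * ‖v‖ := by
  set T : Euc a →L[ℝ] Euc b := LinearMap.toContinuousLinearMap (Matrix.toLpLin 2 2 M)
  refine ⟨‖T‖ + 1, by positivity, fun v => ?_⟩
  have h : ‖mulEuc M v‖ ≤ ‖T‖ * ‖v‖ := T.le_opNorm v
  nlinarith [norm_nonneg v]

variable {ι : Type*} {F : Filter ι}

/-! ### Rescaled increments of an immersion between two moving points -/

section TwoPoint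

variable {f : Euc a → Euc b} {x : Euc a} {y z : ι → Euc a} {r : ι → ℝ} {M : ℝ}

theorem exists_eventually_norm_smul_sub_le
    (hf : HasStrictFDerivAt f (fderiv ℝ f x) x) (hr : (jacobian f x).rank = a)
    (hy : Tendsto y F (𝓝 x)) (hz : Tendsto z F (𝓝 x))
    (hM : ∀ᶠ i in F, ‖r i • (f (y i) - f (z i))‖ ≤ M) :
    ∃ C : ℝ, ∀ᶠ i in F, ‖r i • (y i - z i)‖ ≤ C := by
  obtain ⟨c, hc, hcb⟩ := exists_norm_mulEuc_le (leftInvJacobian f x)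
  -- With `c` bounding the left inverse, the tolerance `1 / (2 * c)` makes the linearization error
  -- at most half of `‖y i - z i‖`, which is absorbed in the left-hand side.
  have hl := (hf.isLittleO.comp_tendsto (hy.prodMk_nhds hz)).def
    (show 0 < 1 / (2 * c) by positivity)
  refine ⟨2 * c * M, ?_⟩
  filter_upwards [hl, hM] with i hi hMi
  simp only [Function.comp_apply] at hi
  have h1 : ‖y i - z i‖ ≤ c * ‖mulEuc (jacobian f x) (y i - z i)‖ := by
    conv_lhs => rw [← mulEuc_leftInvJacobian hr (y i - z i)]
    exact hcb _
  rw [← fderiv_eq_mulEuc] at h1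
  have h2 : ‖fderiv ℝ f x (y i - z i)‖ ≤ ‖f (y i) - f (z i)‖ + 1 / (2 * c) * ‖y i - z i‖ := by
    have h3 := norm_sub_le (f (y i) - f (z i)) (f (y i) - f (z i) - fderiv ℝ f x (y i - z i))
    rw [sub_sub_cancel] at h3
    linarith
  have h4 : ‖y i - z i‖ ≤ 2 * c * ‖f (y i) - f (z i)‖ := by
    have h5 := h1.trans (mul_le_mul_of_nonneg_left h2 hc.le)
    have h6 : c * (1 / (2 * c) * ‖y i - z i‖) = ‖y i - z i‖ / 2 := by field_simp
    rw [mul_add, h6] at h5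
    linarith
  rw [norm_smul] at hMi ⊢
  calc ‖r i‖ * ‖y i - z i‖ ≤ ‖r i‖ * (2 * c * ‖f (y i) - f (z i)‖) :=
        mul_le_mul_of_nonneg_left h4 (norm_nonneg _)
    _ = 2 * c * (‖r i‖ * ‖f (y i) - f (z i)‖) := by ring
    _ ≤ 2 * c * M := mul_le_mul_of_nonneg_left hMi (by positivity)

theorem tendsto_smul_sub_sub_mulEuc
    (hf : HasStrictFDerivAt f (fderiv ℝ f x) x) (hr : (jacobian f x).rank = a)
    (hy : Tendsto y F (𝓝 x)) (hz : Tendsto z F (𝓝 x))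
    (hM : ∀ᶠ i in F, ‖r i • (f (y i) - f (z i))‖ ≤ M) :
    Tendsto (fun i => r i • (f (y i) - f (z i)) - mulEuc (jacobian f x) (r i • (y i - z i))) F
      (𝓝 0) := by
  obtain ⟨C, hC⟩ := exists_eventually_norm_smul_sub_le hf hr hy hz hM
  rw [Metric.tendsto_nhds]
  intro ε hε
  have hC1 : 0 < |C| + 1 := by positivity
  have hl := (hf.isLittleO.comp_tendsto (hy.prodMk_nhds hz)).def
    (show 0 < ε / 2 / (|C| + 1) by positivity)
  filter_upwards [hl, hC] with i hi hCi
  simp only [Function.comp_apply] at hi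
  rw [dist_zero_right, mulEuc_smul, ← smul_sub, ← fderiv_eq_mulEuc, norm_smul]
  rw [norm_smul] at hCi
  calc ‖r i‖ * ‖f (y i) - f (z i) - fderiv ℝ f x (y i - z i)‖
      ≤ ‖r i‖ * (ε / 2 / (|C| + 1) * ‖y i - z i‖) := mul_le_mul_of_nonneg_left hi (norm_nonneg _)
    _ = ε / 2 / (|C| + 1) * (‖r i‖ * ‖y i - z i‖) := by ring
    _ ≤ ε / 2 / (|C| + 1) * (|C| + 1) :=
        mul_le_mul_of_nonneg_left (hCi.trans (by linarith [le_abs_self C])) (by positivity)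
    _ = ε / 2 := by field_simp
    _ < ε := by linarith

theorem tendsto_mulEuc_leftInv_sub
    (hf : HasStrictFDerivAt f (fderiv ℝ f x) x) (hr : (jacobian f x).rank = a)
    (hy : Tendsto y F (𝓝 x)) (hz : Tendsto z F (𝓝 x))
    (hM : ∀ᶠ i in F, ‖r i • (f (y i) - f (z i))‖ ≤ M) :
    Tendsto (fun i => mulEuc (leftInvJacobian f x) (r i • (f (y i) - f (z i)))
      - r i • (y i - z i)) F (𝓝 0) := by
  have h := ((continuous_mulEuc (leftInvJacobian f x)).tendsto 0).comp
    (tendsto_smul_sub_sub_mulEuc hf hr hy hz hM)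
  have h0 : mulEuc (leftInvJacobian f x) 0 = 0 := by simp [mulEuc]
  rw [h0] at h
  refine h.congr fun i => ?_
  simp only [Function.comp_apply]
  rw [mulEuc_sub, mulEuc_leftInvJacobian hr]

end TwoPoint

/-- Since the derivative has a left inverse, convergence of rescaled secants in the image forces
convergence upstairs; passing to the limit shows that `v` is in the range of the Jacobian. -/
theorem tendsto_smul_sub_of_image {f : Euc a → Euc b} {x : Euc a}
    (hf : HasStrictFDerivAt f (fderiv ℝ f x) x) (hr : (jacobian f x).rank = a) {y : ι → Euc a}
    (hy : Tendsto y F (𝓝 x)) {r : ι → ℝ} {v : Euc b}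
    (hv : Tendsto (fun i => r i • (f (y i) - f x)) F (𝓝 v)) [F.NeBot] :
    Tendsto (fun i => r i • (y i - x)) F (𝓝 (mulEuc (leftInvJacobian f x) v)) ∧
      v = mulEuc (jacobian f x) (mulEuc (leftInvJacobian f x) v) := by
  have hM : ∀ᶠ i in F, ‖r i • (f (y i) - f x)‖ ≤ ‖v‖ + 1 :=
    hv.norm.eventually_le_const (by linarith)
  have h1 := tendsto_mulEuc_leftInv_sub hf hr hy tendsto_const_nhds hM
  have h2 := tendsto_smul_sub_sub_mulEuc hf hr hy tendsto_const_nhds hM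
  have h3 := ((continuous_mulEuc (leftInvJacobian f x)).tendsto v).comp hv
  have h4 : Tendsto (fun i => r i • (y i - x)) F (𝓝 (mulEuc (leftInvJacobian f x) v)) := by
    have := h3.sub h1
    rw [sub_zero] at this
    refine this.congr fun i => ?_
    simp
  refine ⟨h4, ?_⟩
  have h5 := hv.sub (((continuous_mulEuc (jacobian f x)).tendsto _).comp h4)
  exact sub_eq_zero.1 (tendsto_nhds_unique h5 h2)

theorem tendsto_of_isEmbedding {f : Euc a → Euc b} {A : Set (Euc a)}
    (hemb : IsEmbedding (A.domRestrict f)) {x : Euc a} (hx : x ∈ A) {y : ι → Euc a}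
    (hy : ∀ᶠ i in F, y i ∈ A) (hlim : Tendsto (fun i => f (y i)) F (𝓝 (f x))) :
    Tendsto y F (𝓝 x) := by
  classical
  set y' : ι → A := fun i => if h : y i ∈ A then ⟨y i, h⟩ else ⟨x, hx⟩ with hy'
  have he : ∀ᶠ i in F, (y' i : Euc a) = y i := by
    filter_upwards [hy] with i hi
    simp [hy', hi]
  have h1 : Tendsto (A.domRestrict f ∘ y') F (𝓝 (A.domRestrict f ⟨x, hx⟩)) := by
    refine hlim.congr' ?_
    filter_upwards [he] with i hi
    show f (y i) = f (y' i)
    rw [hi]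
  have h2 := hemb.tendsto_nhds_iff.2 h1
  exact ((continuous_subtype_val.tendsto _).comp h2).congr' he

theorem hasStrictFDerivAt_of_contDiffOn {f : Euc a → Euc b} {A : Set (Euc a)}
    (hf : ContDiffOn ℝ 1 f A) (hA : IsOpen A) {x : Euc a} (hx : x ∈ A) :
    HasStrictFDerivAt f (fderiv ℝ f x) x :=
  (hf.contDiffAt (hA.mem_nhds hx)).hasStrictFDerivAt one_ne_zero

/-- Limits of rescaled secants of a manifold at a point are tangent. -/
theorem IsLocalChart.exists_eq_mulEuc_of_tendsto {f : Euc l → Euc d} {A : Set (Euc l)}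
    {S : Set (Euc d)} (hf : IsLocalChart f A S) {x : Euc l} (hx : x ∈ A) [F.NeBot] {y : ι → Euc d}
    (hy : ∀ᶠ i in F, y i ∈ S) (hlim : Tendsto y F (𝓝 (f x))) {r : ι → ℝ} {v : Euc d}
    (hv : Tendsto (fun i => r i • (y i - f x)) F (𝓝 v)) :
    ∃ w, v = mulEuc (jacobian f x) w := by
  obtain ⟨U, hU, hfU⟩ := hf.isOpen_image
  have hxU : f x ∈ U := by
    have : f x ∈ f '' A := ⟨x, hx, rfl⟩
    rw [hfU] at this
    exact this.2
  have hex : ∀ᶠ i in F, ∃ z ∈ A, f z = y i := by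
    filter_upwards [hy, hlim.eventually (hU.mem_nhds hxU)] with i h1 h2
    have : y i ∈ f '' A := by rw [hfU]; exact ⟨h1, h2⟩
    exact this
  -- A preimage under the chart; where there is none, `x` is a default that is eventually not used.
  have hz0 : ∀ i, ∃ z, (∃ z ∈ A, f z = y i) → z ∈ A ∧ f z = y i := by
    intro i
    by_cases h : ∃ z ∈ A, f z = y i
    · exact ⟨h.choose, fun _ => h.choose_spec⟩
    · exact ⟨x, fun h' => absurd h' h⟩
  choose z hz using hz0
  have hzA : ∀ᶠ i in F, z i ∈ A := hex.mono fun i hi => (hz i hi).1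
  have hzf : ∀ᶠ i in F, f (z i) = y i := hex.mono fun i hi => (hz i hi).2
  have hzlim : Tendsto z F (𝓝 x) := tendsto_of_isEmbedding hf.isEmbedding hx hzA
    (hlim.congr' (hzf.mono fun i hi => hi.symm))
  have hv' : Tendsto (fun i => r i • (f (z i) - f x)) F (𝓝 v) :=
    hv.congr' (hzf.mono fun i hi => by simp only [hi])
  have h := (tendsto_smul_sub_of_image
    (hasStrictFDerivAt_of_contDiffOn hf.contDiffOn hf.isOpen_source hx)
    (hf.rank_jacobian x hx) hzlim hv').2
  exact ⟨_, h⟩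

/-- Tangent vectors are limits of rescaled secants along root-`n` sequences. -/
theorem IsLocalChart.exists_isLocalSeq {f : Euc l → Euc d} {A : Set (Euc l)}
    {S : Set (Euc d)} (hf : IsLocalChart f A S) {x : Euc l} (hx : x ∈ A) (w : Euc l) :
    ∃ s : ℕ → Euc d, IsLocalSeq S (f x) s ∧
      Tendsto (fun n : ℕ => √(n : ℝ) • (s n - f x)) atTop (𝓝 (mulEuc (jacobian f x) w)) := by
  classical
  have hsq : Tendsto (fun n : ℕ => √(n : ℝ)) atTop atTop :=
    Real.tendsto_sqrt_atTop.comp tendsto_natCast_atTop_atTop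
  have hsub : ∀ z ∈ A, f z ∈ S := by
    intro z hz
    obtain ⟨U, -, hfU⟩ := hf.isOpen_image
    have : f z ∈ f '' A := ⟨z, hz, rfl⟩
    rw [hfU] at this
    exact this.1
  set y : ℕ → Euc l := fun n => x + (√(n : ℝ))⁻¹ • w with hy
  have hylim : Tendsto y atTop (𝓝 x) := by
    have h1 : Tendsto (fun n : ℕ => (√(n : ℝ))⁻¹ • w) atTop (𝓝 ((0 : ℝ) • w)) :=
      (tendsto_inv_atTop_zero.comp hsq).smul_const w
    simpa [hy] using h1.const_add x
  have hyA : ∀ᶠ n in atTop, y n ∈ A := hylim.eventually (hf.isOpen_source.mem_nhds hx)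
  -- The image under the chart of a straight root-`n` sequence; the default serves the indices at
  -- which that sequence is outside `A`.
  set s : ℕ → Euc d := fun n => if y n ∈ A then f (y n) else f x with hs
  have hsS : ∀ n, s n ∈ S := by
    intro n
    by_cases h : y n ∈ A
    · simp only [hs, h, if_true]; exact hsub _ h
    · simp only [hs, h, if_false]; exact hsub _ hx
  have hlim : Tendsto (fun n : ℕ => √(n : ℝ) • (s n - f x)) atTop
      (𝓝 (mulEuc (jacobian f x) w)) := by
    have hd := (hasStrictFDerivAt_of_contDiffOn hf.contDiffOn hf.isOpen_source hx).hasFDerivAt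
    have h1 := (hd.lim_real w).comp hsq
    rw [fderiv_eq_mulEuc] at h1
    refine h1.congr' ?_
    filter_upwards [hyA] with n hn
    have hsn : s n = f (y n) := by simp only [hs, hn, if_true]
    rw [hsn]
    rfl
  refine ⟨s, isLocalSeq_of_eventually hsS (M := ‖mulEuc (jacobian f x) w‖ + 1) ?_, hlim⟩
  filter_upwards [hlim.norm.eventually_le_const (lt_add_one _)] with n hn
  rwa [norm_smul, Real.norm_of_nonneg (Real.sqrt_nonneg _)] at hn

/-- Difference quotients of the chart lie in the range of `N`, a finite-dimensional and hence closed
subspace, so derivatives do too. -/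
theorem mem_range_of_isLocalChart_affine {f : Euc l → Euc d} {A : Set (Euc l)} {S : Set (Euc d)}
    (hf : IsLocalChart f A S) {x : Euc l} (hx : x ∈ A) {N : Matrix (Fin d) (Fin m) ℝ}
    (hS : ∀ y ∈ S, ∃ w, y - f x = mulEuc N w) (v : Euc l) :
    ∃ w, mulEuc (jacobian f x) v = mulEuc N w := by
  have hd := (hasStrictFDerivAt_of_contDiffOn hf.contDiffOn hf.isOpen_source hx).hasFDerivAt
  have h1 := hd.lim_real v
  rw [fderiv_eq_mulEuc] at h1
  set T : Euc m →ₗ[ℝ] Euc d := Matrix.toLpLin 2 2 N with hT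
  have hclosed : IsClosed (LinearMap.range T : Set (Euc d)) :=
    (LinearMap.range T).closed_of_finiteDimensional
  have hmem : mulEuc (jacobian f x) v ∈ (LinearMap.range T : Set (Euc d)) := by
    refine hclosed.mem_of_tendsto h1 ?_
    have hlim : Tendsto (fun c : ℝ => x + c⁻¹ • v) atTop (𝓝 x) := by
      have : Tendsto (fun c : ℝ => c⁻¹ • v) atTop (𝓝 ((0 : ℝ) • v)) :=
        tendsto_inv_atTop_zero.smul_const v
      simpa using this.const_add x
    filter_upwards [hlim.eventually (hf.isOpen_source.mem_nhds hx)] with c hc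
    obtain ⟨U, -, hfU⟩ := hf.isOpen_image
    have h2 : f (x + c⁻¹ • v) ∈ f '' A := ⟨_, hc, rfl⟩
    rw [hfU] at h2
    obtain ⟨w, hw⟩ := hS _ h2.1
    exact (LinearMap.range T).smul_mem c ⟨w, hw.symm⟩
  obtain ⟨w, hw⟩ := hmem
  exact ⟨w, hw.symm⟩

theorem exists_eq_mul_of_range_le {N : Matrix (Fin d) (Fin m) ℝ} {B : Matrix (Fin d) (Fin l) ℝ}
    (h : ∀ v, ∃ w, mulEuc B v = mulEuc N w) : ∃ M : Matrix (Fin m) (Fin l) ℝ, B = N * M := by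
  choose w hw using fun j : Fin l => h (EuclideanSpace.single j 1)
  refine ⟨Matrix.of fun i j => w j i, ?_⟩
  ext i j
  have h1 := congrFun (congrArg WithLp.ofLp (hw j)) i
  simp only [ofLp_mulEuc] at h1
  rw [Matrix.mul_apply]
  simpa [Matrix.mulVec, dotProduct] using h1

end Geometry

/-! ### The curved experiment -/

section Curved

open scoped RealInnerProductSpace

variable {a b m p : ℕ}

theorem continuousAt_jacobian {f : Euc a → Euc b} {A : Set (Euc a)} (hf : ContDiffOn ℝ 1 f A)
    (hA : IsOpen A) {x : Euc a} (hx : x ∈ A) : ContinuousAt (jacobian f) x := by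
  have h1 : ContinuousAt (fderiv ℝ f) x :=
    (hf.continuousOn_fderiv_of_isOpen hA le_rfl).continuousAt (hA.mem_nhds hx)
  refine continuousAt_pi.2 fun i => continuousAt_pi.2 fun j => ?_
  have h2 : ContinuousAt (fun y => fderiv ℝ f y (EuclideanSpace.single j (1 : ℝ))) x :=
    h1.clm_apply continuousAt_const
  exact (EuclideanSpace.proj (𝕜 := ℝ) i).continuous.continuousAt.comp h2

theorem continuousAt_leftInvJacobian {f : Euc a → Euc b} {A : Set (Euc a)}
    (hf : ContDiffOn ℝ 1 f A) (hA : IsOpen A) {x : Euc a} (hx : x ∈ A)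
    (hr : (jacobian f x).rank = a) : ContinuousAt (leftInvJacobian f) x := by
  have hinv : ContinuousAt (fun M : Matrix (Fin a) (Fin a) ℝ => M⁻¹)
      ((jacobian f x)ᵀ * jacobian f x) := by
    simp only [Matrix.inv_def, Ring.inverse_eq_inv']
    exact (continuous_id.matrix_det.continuousAt.inv₀ (isUnit_det_gram hr).ne_zero).smul
      continuous_id.matrix_adjugate.continuousAt
  have hJ := continuousAt_jacobian hf hA hx
  have hJt : ContinuousAt (fun y => (jacobian f y)ᵀ) x :=
    (continuous_id.matrix_transpose).continuousAt.comp hJ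
  have hmul : ∀ {c d e : ℕ} {M : Euc a → Matrix (Fin c) (Fin d) ℝ}
      {N : Euc a → Matrix (Fin d) (Fin e) ℝ}, ContinuousAt M x → ContinuousAt N x →
      ContinuousAt (fun y => M y * N y) x := fun {c d e M N} hM hN =>
    (Continuous.matrix_mul (continuous_fst (X := Matrix (Fin c) (Fin d) ℝ)
      (Y := Matrix (Fin d) (Fin e) ℝ)) continuous_snd).continuousAt.comp
      (f := fun y => (M y, N y)) (hM.prodMk hN)
  have hG : ContinuousAt (fun y => ((jacobian f y)ᵀ * jacobian f y)⁻¹) x :=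
    ContinuousAt.comp (f := fun y => (jacobian f y)ᵀ * jacobian f y) hinv (hmul hJt hJ)
  exact hmul hG hJt

theorem tendsto_mulEuc {ι : Type*} {F : Filter ι} {M : ι → Matrix (Fin b) (Fin a) ℝ}
    {M₀ : Matrix (Fin b) (Fin a) ℝ} {v : ι → Euc a} {v₀ : Euc a} (hM : Tendsto M F (𝓝 M₀))
    (hv : Tendsto v F (𝓝 v₀)) : Tendsto (fun i => mulEuc (M i) (v i)) F (𝓝 (mulEuc M₀ v₀)) :=
  Tendsto.comp (f := fun i => (M i, v i)) (continuous_mulEuc_uncurry.tendsto (M₀, v₀))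
    (hM.prodMk_nhds hv)

theorem exists_tendsto_ultrafilter {d : ℕ} {u : ℕ → Euc d} {M : ℝ} (h : ∀ n, ‖u n‖ ≤ M)
    (𝒰 : Ultrafilter ℕ) : ∃ x, Tendsto u 𝒰 (𝓝 x) := by
  obtain ⟨x, -, hx⟩ := (isCompact_closedBall (0 : Euc d) M).ultrafilter_le_nhds (𝒰.map u) (by
    rw [Ultrafilter.coe_map, le_principal_iff, mem_map]
    exact univ_mem' fun n => by simpa using h n)
  exact ⟨x, hx⟩

theorem injOn_of_isEmbedding {f : Euc a → Euc b} {A : Set (Euc a)}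
    (hemb : IsEmbedding (A.domRestrict f)) : Set.InjOn f A :=
  Set.injOn_iff_injective.2 hemb.injective

variable {h : Euc m → Euc p} {Ξ : Set (Euc m)}

theorem IsLocalSeq.image (hΞ : IsOpen Ξ) (hh : ContDiffOn ℝ 1 h Ξ) {N : Set (Euc m)} {ξ : Euc m}
    (hξ : ξ ∈ Ξ) {s : ℕ → Euc m} (hs : IsLocalSeq N ξ s) :
    IsLocalSeq (h '' N) (h ξ) fun n => h (s n) := by
  obtain ⟨M, hM⟩ := hs.2
  obtain ⟨c, hc⟩ := ((hasStrictFDerivAt_of_contDiffOn hh hΞ hξ).hasFDerivAt.isBigO_sub.comp_tendsto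
    hs.tendsto).bound
  refine isLocalSeq_of_eventually (fun n => ⟨_, hs.1 n, rfl⟩) (M := |c| * M) ?_
  filter_upwards [hc] with n hn
  simp only [Function.comp_apply] at hn
  calc √(n : ℝ) * ‖h (s n) - h ξ‖ ≤ √(n : ℝ) * (|c| * ‖s n - ξ‖) :=
        mul_le_mul_of_nonneg_left (hn.trans (mul_le_mul_of_nonneg_right (le_abs_self c)
          (norm_nonneg _))) (Real.sqrt_nonneg _)
    _ = |c| * (√(n : ℝ) * ‖s n - ξ‖) := by ring
    _ ≤ |c| * M := mul_le_mul_of_nonneg_left (hM n) (abs_nonneg _)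

/-- The homeomorphism property makes the preimages converge to `ξ`; the immersion property then
transfers the rate. -/
theorem IsLocalSeq.invFunOn (hΞ : IsOpen Ξ) (hh : ContDiffOn ℝ 1 h Ξ)
    (hrank : ∀ ξ ∈ Ξ, (jacobian h ξ).rank = m) (hemb : IsEmbedding (Ξ.domRestrict h))
    {N : Set (Euc m)} (hN : N ⊆ Ξ) {ξ : Euc m} (hξ : ξ ∈ Ξ) {t : ℕ → Euc p}
    (ht : IsLocalSeq (h '' N) (h ξ) t) :
    IsLocalSeq N ξ (fun n => Function.invFunOn h Ξ (t n)) ∧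
      ∀ n, h (Function.invFunOn h Ξ (t n)) = t n := by
  have hmem : ∀ n, Function.invFunOn h Ξ (t n) ∈ N ∧ h (Function.invFunOn h Ξ (t n)) = t n := by
    intro n
    obtain ⟨s, hs, hst⟩ := ht.1 n
    rw [← hst, (injOn_of_isEmbedding hemb).leftInvOn_invFunOn (hN hs)]
    exact ⟨hs, rfl⟩
  refine ⟨?_, fun n => (hmem n).2⟩
  have hlim : Tendsto (fun n => Function.invFunOn h Ξ (t n)) atTop (𝓝 ξ) :=
    tendsto_of_isEmbedding hemb hξ (Eventually.of_forall fun n => hN (hmem n).1)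
      (ht.tendsto.congr fun n => (hmem n).2.symm)
  obtain ⟨M, hM⟩ := ht.2
  obtain ⟨c, hc⟩ := exists_eventually_norm_smul_sub_le
    (hasStrictFDerivAt_of_contDiffOn hh hΞ hξ) (hrank ξ hξ) hlim tendsto_const_nhds
    (r := fun n : ℕ => √(n : ℝ)) (M := M) (Eventually.of_forall fun n => by
      rw [norm_smul, Real.norm_of_nonneg (Real.sqrt_nonneg _), (hmem n).2]
      exact hM n)
  refine isLocalSeq_of_eventually (fun n => (hmem n).1) (M := c) ?_
  filter_upwards [hc] with n hn
  rwa [norm_smul, Real.norm_of_nonneg (Real.sqrt_nonneg _)] at hn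

theorem curvedCentral_eq_mulEuc {𝓧 : ℕ → Type*} {Δ : ∀ n, Euc m → 𝓧 n → Euc m} (n : ℕ)
    (θ : Euc p) (x : 𝓧 n) :
    curvedCentral h Ξ Δ n θ x = mulEuc (leftInvJacobian h (Function.invFunOn h Ξ θ))ᵀ
      (Δ n (Function.invFunOn h Ξ θ) x) := rfl

variable {𝓧 : ℕ → Type*} [∀ n, MeasurableSpace (𝓧 n)]
  {P : ∀ n, Euc m → ProbabilityMeasure (𝓧 n)}
  {Δ : ∀ n, Euc m → 𝓧 n → Euc m} {Γ : Euc m → Matrix (Fin m) (Fin m) ℝ}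

theorem IsLocalSeq.add_smul {d : ℕ} {S : Set (Euc d)} {θ : Euc d} {t τ : ℕ → Euc d}
    (ht : IsLocalSeq S θ t) (hτ : ∃ M : ℝ, ∀ n, ‖τ n‖ ≤ M)
    (hmem : ∀ n : ℕ, t n + (√(n : ℝ))⁻¹ • τ n ∈ S) :
    IsLocalSeq S θ fun n => t n + (√(n : ℝ))⁻¹ • τ n := by
  obtain ⟨M, hM⟩ := ht.2
  obtain ⟨M', hM'⟩ := hτ
  refine ⟨hmem, M + M', fun n => ?_⟩
  have h1 : ‖t n + (√(n : ℝ))⁻¹ • τ n - θ‖ ≤ ‖t n - θ‖ + (√(n : ℝ))⁻¹ * ‖τ n‖ := by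
    have h2 := norm_add_le (t n - θ) ((√(n : ℝ))⁻¹ • τ n)
    rw [norm_smul, norm_inv, Real.norm_of_nonneg (Real.sqrt_nonneg _), sub_add_eq_add_sub] at h2
    exact h2
  have h3 : √(n : ℝ) * ((√(n : ℝ))⁻¹ * ‖τ n‖) ≤ ‖τ n‖ := by
    rw [← mul_assoc]
    exact mul_le_of_le_one_left (norm_nonneg _) mul_inv_le_one
  have h4 := mul_le_mul_of_nonneg_left h1 (Real.sqrt_nonneg (n : ℝ))
  rw [mul_add] at h4
  linarith [hM n, hM' n]

theorem tendsto_smul_add_smul_sub {d : ℕ} {t τ : ℕ → Euc d} {F : Filter ℕ} (hF : F ≤ atTop)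
    {τ₀ : Euc d} (hτ : Tendsto τ F (𝓝 τ₀)) :
    Tendsto (fun n : ℕ => √(n : ℝ) • (t n + (√(n : ℝ))⁻¹ • τ n - t n)) F (𝓝 τ₀) := by
  refine hτ.congr' ?_
  filter_upwards [hF (eventually_gt_atTop 0)] with n hn
  rw [add_sub_cancel_left, smul_inv_smul₀ (Real.sqrt_pos.2 (by exact_mod_cast hn)).ne']

/-- A regular reparametrization of a ULAN experiment is ULAN. -/
theorem IsULAN.curvedModel (hΞ : IsOpen Ξ) (hULAN : IsULAN P Ξ Δ Γ) (hh : ContDiffOn ℝ 1 h Ξ)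
    (hrank : ∀ ξ ∈ Ξ, (jacobian h ξ).rank = m) (hemb : IsEmbedding (Ξ.domRestrict h)) :
    IsULAN (curvedModel h Ξ P) (h '' Ξ) (curvedCentral h Ξ Δ) (curvedInfo h Ξ Γ) := by
  have hinv := (injOn_of_isEmbedding hemb).leftInvOn_invFunOn
  have hD : ∀ {ξ : Euc m} {t : ℕ → Euc p}, ξ ∈ Ξ → IsLocalSeq (h '' Ξ) (h ξ) t →
      Tendsto (fun n => leftInvJacobian h (Function.invFunOn h Ξ (t n))) atTop
        (𝓝 (leftInvJacobian h ξ)) := fun {ξ t} hξ ht =>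
    (continuousAt_leftInvJacobian hh hΞ hξ (hrank ξ hξ)).tendsto.comp
      (ht.invFunOn hΞ hh hrank hemb subset_rfl hξ).1.tendsto
  refine ⟨?_, ?_, ?_, ?_⟩
  · rintro n _ ⟨ξ, hξ, rfl⟩
    have h1 := hULAN.measurable_central n ξ hξ
    rw [← hinv hξ] at h1
    exact (measurable_mulEuc _).comp h1
  · rintro _ ⟨ξ, hξ, rfl⟩
    have h1 := hULAN.posSemidef_info ξ hξ
    rw [← hinv hξ] at h1
    have h2 := h1.conjTranspose_mul_mul_same
      (leftInvJacobian h (Function.invFunOn h Ξ (h ξ)))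
    rwa [Matrix.conjTranspose_eq_transpose_of_trivial] at h2
  · rintro _ ⟨ξ, hξ, rfl⟩ t ht τ hτ hmem
    suffices hS : LogLRApprox atTop
        (fun n => (CurvedULAN.curvedModel h Ξ P n (t n) : Measure (𝓧 n)))
        (fun n => (CurvedULAN.curvedModel h Ξ P n (t n + (√(n : ℝ))⁻¹ • τ n) : Measure (𝓧 n)))
        (fun n x => (τ n).ofLp ⬝ᵥ (curvedCentral h Ξ Δ n (t n) x).ofLp
          - 1 / 2 * ((τ n).ofLp ⬝ᵥ (curvedInfo h Ξ Γ (h ξ) *ᵥ (τ n).ofLp))) from hS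
    intro ε hε
    -- Along an ultrafilter the bounded sequence `τ` converges, so the expansion for a convergent
    -- direction applies.
    rw [tendsto_iff_ultrafilter]
    intro 𝒰 h𝒰
    revert ε
    change LogLRApprox (𝒰 : Filter ℕ) _ _ _
    have ht' := ht.add_smul hτ hmem
    obtain ⟨M, hM⟩ := hτ
    obtain ⟨τ₀, hτ₀⟩ := exists_tendsto_ultrafilter hM 𝒰
    obtain ⟨hs, hst⟩ := ht.invFunOn hΞ hh hrank hemb subset_rfl hξ
    obtain ⟨hs', hst'⟩ := ht'.invFunOn hΞ hh hrank hemb subset_rfl hξ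
    have hr := tendsto_smul_add_smul_sub (t := t) h𝒰 hτ₀
    have hσ : Tendsto (fun n : ℕ => √(n : ℝ) •
        (Function.invFunOn h Ξ (t n + (√(n : ℝ))⁻¹ • τ n) - Function.invFunOn h Ξ (t n))) 𝒰
        (𝓝 (mulEuc (leftInvJacobian h ξ) τ₀)) := by
      have hr' : Tendsto (fun n : ℕ => √(n : ℝ) •
          (h (Function.invFunOn h Ξ (t n + (√(n : ℝ))⁻¹ • τ n))
            - h (Function.invFunOn h Ξ (t n)))) 𝒰 (𝓝 τ₀) :=
        hr.congr fun n => by rw [hst, hst']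
      have h1 := tendsto_mulEuc_leftInv_sub (hasStrictFDerivAt_of_contDiffOn hh hΞ hξ)
        (hrank ξ hξ) (hs'.tendsto.mono_left h𝒰) (hs.tendsto.mono_left h𝒰)
        (hr'.norm.eventually_le_const (lt_add_one _))
      have h2 := (((continuous_mulEuc (leftInvJacobian h ξ)).tendsto _).comp hr').sub h1
      rw [sub_zero] at h2
      exact h2.congr fun n => by simp
    -- The flat expansion has the fixed direction `D⁻h(ξ) τ₀`, the curved one involves `D⁻h` at the
    -- moving point applied to `τ n`. Continuity of `D⁻h` makes the difference `o_P(1)`.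
    refine (hULAN.logLRApprox hξ hs hs' h𝒰 hσ).congr_approx fun ε hε => ?_
    have hDτ : Tendsto (fun n => mulEuc (leftInvJacobian h (Function.invFunOn h Ξ (t n))) (τ n)) 𝒰
        (𝓝 (mulEuc (leftInvJacobian h ξ) τ₀)) :=
      tendsto_mulEuc ((hD hξ ht).mono_left h𝒰) hτ₀
    have hq : Tendsto (fun n => ⟪τ n, mulEuc (curvedInfo h Ξ Γ (h ξ)) (τ n)⟫) 𝒰
        (𝓝 ⟪τ₀, mulEuc (curvedInfo h Ξ Γ (h ξ)) τ₀⟫) :=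
      ((show Continuous fun v : Euc p => ⟪v, mulEuc (curvedInfo h Ξ Γ (h ξ)) v⟫ by
        fun_prop).tendsto τ₀).comp hτ₀
    have hlim := (hULAN.tendstoInDistribution_central hξ hs h𝒰).tendsto_measure_abs_ge
      (g := fun q : Euc m × (Euc m × ℝ) =>
        gaussianLogLR (Γ ξ) (mulEuc (leftInvJacobian h ξ) τ₀) q.1 - (⟪q.2.1, q.1⟫ - q.2.2 / 2))
      (by
        have := continuous_gaussianLogLR (Γ ξ) (mulEuc (leftInvJacobian h ξ) τ₀)
        fun_prop) (hDτ.prodMk_nhds hq) (fun x => by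
        simp only [gaussianLogLR, curvedInfo, hinv hξ]
        rw [← mulEuc_mulEuc, ← mulEuc_mulEuc,
          ← inner_mulEuc (leftInvJacobian h ξ) τ₀, sub_self]) hε
    refine hlim.congr fun n => ?_
    congr 1
    ext x
    simp only [Set.mem_ofPred_eq]
    rw [← ofLp_mulEuc, ← inner_eq_dotProduct, ← inner_eq_dotProduct, curvedCentral_eq_mulEuc,
      inner_mulEuc, one_div, inv_mul_eq_div]
  · rintro _ ⟨ξ, hξ, rfl⟩ t ht
    have hs := (ht.invFunOn hΞ hh hrank hemb subset_rfl hξ).1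
    have : SecondCountableTopology (Matrix (Fin m) (Fin p) ℝ) :=
      inferInstanceAs (SecondCountableTopology (Fin m → Fin p → ℝ))
    have : TopologicalSpace.PseudoMetrizableSpace (Matrix (Fin m) (Fin p) ℝ) :=
      inferInstanceAs (TopologicalSpace.PseudoMetrizableSpace (Fin m → Fin p → ℝ))
    have hg : Continuous fun q : Euc m × Matrix (Fin m) (Fin p) ℝ => mulEuc q.2ᵀ q.1 :=
      continuous_mulEuc_uncurry.comp (continuous_snd.matrix_transpose.prodMk continuous_fst)
    refine (hULAN.asymptotic_normality ξ hξ _ hs).map_continuous_prod hg (hD hξ ht) ?_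
    rw [curvedInfo, hinv hξ]
    exact (multivariateGaussian_map_mulEuc (hULAN.posSemidef_info ξ hξ)
      (leftInvJacobian h ξ)ᵀ).trans
      (by rw [Matrix.transpose_transpose])

end Curved

/-! ### The tangent space and the two statistics -/

section Statistics

variable {m p l : ℕ} {h : Euc m → Euc p} {Ξ Ξ₀ : Set (Euc m)}

/-- A curve in the image pulls back to a curve in `Ξ₀`. Its secants converge because `h` is an
immersion, and their limit is tangent to `Ξ₀`. -/
theorem exists_eq_mulEuc_of_mem_tangentVectors (hΞ : IsOpen Ξ) (hh : ContDiffOn ℝ 1 h Ξ)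
    (hrank : ∀ ξ ∈ Ξ, (jacobian h ξ).rank = m) (hemb : IsEmbedding (Ξ.domRestrict h))
    (hsub : Ξ₀ ⊆ Ξ) {f : Euc l → Euc m} {B : Set (Euc l)} (hf : IsLocalChart f B Ξ₀) {x : Euc l}
    (hx : x ∈ B) (hfx : f x ∈ Ξ) {v : Euc p} (hv : v ∈ tangentVectors (h '' Ξ₀) (h (f x))) :
    ∃ w, v = mulEuc (jacobian h (f x) * jacobian f x) w := by
  obtain ⟨γ, hγ0, hγ, hd⟩ := hv
  have hmem : ∀ᶠ t in 𝓝[≠] (0 : ℝ), Function.invFunOn h Ξ (γ t) ∈ Ξ₀ ∧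
      h (Function.invFunOn h Ξ (γ t)) = γ t := by
    filter_upwards [nhdsWithin_le_nhds hγ] with t ht
    obtain ⟨s, hs, hst⟩ := ht
    rw [← hst, (injOn_of_isEmbedding hemb).leftInvOn_invFunOn (hsub hs)]
    exact ⟨hs, rfl⟩
  have hlim : Tendsto (fun t => Function.invFunOn h Ξ (γ t)) (𝓝[≠] (0 : ℝ)) (𝓝 (f x)) := by
    refine tendsto_of_isEmbedding hemb hfx (hmem.mono fun t ht => hsub ht.1) ?_
    have h1 : Tendsto γ (𝓝[≠] (0 : ℝ)) (𝓝 (h (f x))) := by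
      rw [← hγ0]; exact hd.continuousAt.tendsto.mono_left nhdsWithin_le_nhds
    exact h1.congr' (hmem.mono fun t ht => ht.2.symm)
  have hslope : Tendsto (fun t : ℝ => t⁻¹ • (h (Function.invFunOn h Ξ (γ t)) - h (f x)))
      (𝓝[≠] (0 : ℝ)) (𝓝 v) := by
    have h1 := hasDerivAt_iff_tendsto_slope_zero.1 hd
    rw [hγ0] at h1
    exact h1.congr' (hmem.mono fun t ht => by simp only [zero_add, ht.2])
  obtain ⟨h1, h2⟩ := tendsto_smul_sub_of_image (hasStrictFDerivAt_of_contDiffOn hh hΞ hfx)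
    (hrank _ hfx) hlim hslope
  obtain ⟨w, hw⟩ := hf.exists_eq_mulEuc_of_tendsto hx (hmem.mono fun t ht => ht.1) hlim h1
  exact ⟨w, by rw [h2, hw, mulEuc_mulEuc]⟩

/-- The Jacobian of a chart of the tangent at a point of the image of a submanifold. -/
theorem exists_jacobian_eq_mul_mul (hΞ : IsOpen Ξ) (hh : ContDiffOn ℝ 1 h Ξ)
    (hrank : ∀ ξ ∈ Ξ, (jacobian h ξ).rank = m) (hemb : IsEmbedding (Ξ.domRestrict h))
    (hsub : Ξ₀ ⊆ Ξ) {f : Euc l → Euc m} {B : Set (Euc l)} (hf : IsLocalChart f B Ξ₀) {x : Euc l}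
    (hx : x ∈ B) (hfx : f x ∈ Ξ) {g : Euc l → Euc p} {A : Set (Euc l)}
    (hg : IsLocalChart g A (affineTangent (h '' Ξ₀) (h (f x)))) {y : Euc l} (hy : y ∈ A)
    (hgy : g y = h (f x)) :
    ∃ M : Matrix (Fin l) (Fin l) ℝ, IsUnit M.det ∧
      jacobian g y = jacobian h (f x) * jacobian f x * M := by
  obtain ⟨M, hM⟩ := exists_eq_mul_of_range_le (mem_range_of_isLocalChart_affine hg hy
    (N := jacobian h (f x) * jacobian f x) (by
      rintro _ ⟨v, hv, rfl⟩
      rw [hgy]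
      simp only [add_sub_cancel_left]
      exact exists_eq_mulEuc_of_mem_tangentVectors hΞ hh hrank hemb hsub hf hx hfx hv))
  -- The product has rank `l`, so its square factor `M` has rank at least `l`.
  refine ⟨M, isUnit_det_of_rank_eq (le_antisymm ?_ ?_), hM⟩
  · simpa using M.rank_le_width
  · have h1 := hg.rank_jacobian y hy
    rw [hM] at h1
    exact h1.symm.le.trans (Matrix.rank_mul_le_right _ _)

variable {𝓧 : ℕ → Type*} [∀ n, MeasurableSpace (𝓧 n)]
  {P : ∀ n, Euc m → ProbabilityMeasure (𝓧 n)}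
  {Δ : ∀ n, Euc m → 𝓧 n → Euc m} {Γ : Euc m → Matrix (Fin m) (Fin m) ℝ}

theorem IsULAN.tendstoInDistribution_flatStatistic (hULAN : IsULAN P Ξ Δ Γ) {ξ : Euc m}
    (hξ : ξ ∈ Ξ) (hΓ : (Γ ξ).rank = m) {L : Matrix (Fin m) (Fin l) ℝ} (hL : L.rank = l) :
    TendstoInDistribution (fun n x => flatStatistic (Δ n ξ x) (Γ ξ) L) atTop id
      (fun n => (P n ξ : Measure (𝓧 n))) (chiSquare (m - l)) := by
  have hG := hULAN.posSemidef_info ξ hξ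
  obtain ⟨A, hA1, -, hA3⟩ := exists_whitening hG hΓ hL
  simp_rw [flatStatistic_eq_norm_sq hA3]
  refine (hULAN.asymptotic_normality ξ hξ _ (isLocalSeq_const hξ)).map_continuous
    (g := fun x => ‖mulEuc A x‖ ^ 2) (by fun_prop) ?_
  rw [chiSquare, ← multivariateGaussian_whitening hG hA1,
    Measure.map_map (by fun_prop) (by fun_prop)]
  rfl

end Statistics

/-! ### Upper limits of bounded real sequences -/

section Limsup

theorem limsup_coe_le_iff {u : ℕ → ℝ} {a : ℝ} :
    limsup (fun n => (u n : EReal)) atTop ≤ (a : EReal) ↔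
      ∀ ε : ℝ, 0 < ε → ∀ᶠ n in atTop, u n ≤ a + ε := by
  constructor
  · intro h ε hε
    have h1 : limsup (fun n => (u n : EReal)) atTop < ((a + ε : ℝ) : EReal) :=
      h.trans_lt (EReal.coe_lt_coe_iff.2 (by linarith))
    filter_upwards [eventually_lt_of_limsup_lt h1] with n hn
    exact (EReal.coe_lt_coe_iff.1 hn).le
  · intro h
    refine EReal.le_of_forall_lt_iff_le.1 fun b hb => ?_
    have hb' := EReal.coe_lt_coe_iff.1 hb
    refine limsup_le_of_le (h := ?_)
    filter_upwards [h (b - a) (by linarith)] with n hn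
    exact EReal.coe_le_coe_iff.2 (by linarith)

theorem eventually_atTop_of_ultrafilter {p : ℕ → Prop}
    (h : ∀ 𝒰 : Ultrafilter ℕ, (𝒰 : Filter ℕ) ≤ atTop → ∀ᶠ n in 𝒰, p n) : ∀ᶠ n in atTop, p n :=
  Filter.mem_iff_ultrafilter.2 h

theorem le_limsup_coe {u : ℕ → ℝ} {a : ℝ} (h : ∀ᶠ n in atTop, a ≤ u n) :
    (a : EReal) ≤ limsup (fun n => (u n : EReal)) atTop :=
  le_limsup_of_frequently_le (h.mono fun _ hn => EReal.coe_le_coe_iff.2 hn).frequently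

/-- The bound `a` may depend on the ultrafilter, that is, on the limiting direction of the local
sequence. -/
theorem limsup_coe_le_of_ultrafilter {u : ℕ → ℝ} {B : EReal}
    (h : ∀ 𝒰 : Ultrafilter ℕ, (𝒰 : Filter ℕ) ≤ atTop → ∃ a : ℝ, (a : EReal) ≤ B ∧
      ∀ ε : ℝ, 0 < ε → ∀ᶠ n in 𝒰, u n ≤ a + ε) :
    limsup (fun n => (u n : EReal)) atTop ≤ B := by
  refine EReal.le_of_forall_lt_iff_le.1 fun b hb => ?_
  refine limsup_le_of_le (h := eventually_atTop_of_ultrafilter fun 𝒰 h𝒰 => ?_)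
  obtain ⟨a, ha, hu⟩ := h 𝒰 h𝒰
  have hab : a < b := EReal.coe_lt_coe_iff.1 (ha.trans_lt hb)
  filter_upwards [hu (b - a) (by linarith)] with n hn
  exact EReal.coe_le_coe_iff.2 (by linarith)

end Limsup

/-! ### Critical values -/

section CriticalValues

theorem normSqPower_chiSquareUpperQuantile {k : ℕ} [Nontrivial (Euc k)] {α : ℝ} (h0 : 0 < α)
    (h1 : α < 1) : normSqPower (chiSquareUpperQuantile k α) (0 : Euc k) = α := by
  have hnull : ∀ x, chiSquare k {x} = 0 := by
    intro x
    rw [chiSquare, Measure.map_apply (by fun_prop) (measurableSet_singleton x)]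
    have := stdGaussian_norm_sq_eq (0 : Euc k) x
    simp only [add_zero] at this
    exact this
  have h2 := measureReal_Ioi_sInf_eq (chiSquare k) hnull h0 h1
  rw [← chiSquareUpperQuantile, measureReal_def, chiSquare,
    Measure.map_apply (by fun_prop) measurableSet_Ioi] at h2
  simp only [normSqPower, measureReal_def, add_zero]
  exact h2

theorem exists_gaussianReal_Ioi_eq {α : ℝ} (h0 : 0 < α) (h1 : α < 1) :
    ∃ z, (gaussianReal 0 1).real (Set.Ioi z) = α := by
  have := nullSingletonClass_gaussianReal (μ := 0) (v := 1) one_ne_zero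
  exact ⟨_, measureReal_Ioi_sInf_eq (gaussianReal 0 1) (fun x => measure_singleton x) h0 h1⟩

theorem chiSquareUpperQuantile_nonneg (k : ℕ) {α : ℝ} (h1 : α < 1) :
    0 ≤ chiSquareUpperQuantile k α := by
  refine Real.sInf_nonneg fun c hc => ?_
  by_contra hlt
  have h2 : chiSquare k (Set.Ioi c) = 1 := by
    rw [chiSquare, Measure.map_apply (by fun_prop) measurableSet_Ioi]
    have : (fun z : Euc k => ‖z‖ ^ 2) ⁻¹' Set.Ioi c = Set.univ :=
      Set.eq_univ_of_forall fun z => (not_le.1 hlt).trans_le (sq_nonneg _)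
    rw [this, measure_univ]
  have h3 : chiSquare k (Set.Ioi c) ≤ ENNReal.ofReal α := hc
  rw [h2, ENNReal.one_le_ofReal] at h3
  linarith

end CriticalValues

/-! ### Powers under local alternatives -/

section Power

open scoped RealInnerProductSpace

variable {m k : ℕ} {𝓧 : ℕ → Type*} [∀ n, MeasurableSpace (𝓧 n)]
  {P : ∀ n, Euc m → ProbabilityMeasure (𝓧 n)} {Ξ : Set (Euc m)}
  {Δ : ∀ n, Euc m → 𝓧 n → Euc m} {Γ : Euc m → Matrix (Fin m) (Fin m) ℝ}

theorem isTest_indicator {s : ∀ n, Set (𝓧 n)} (hs : ∀ n, MeasurableSet (s n)) :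
    IsTest fun n => (s n).indicator (1 : 𝓧 n → ℝ) := by
  refine fun n => ⟨measurable_one.indicator (hs n), fun x => ?_⟩
  by_cases hx : x ∈ s n <;> simp [hx]

theorem power_indicator {s : ∀ n, Set (𝓧 n)} (hs : ∀ n, MeasurableSet (s n)) (n : ℕ) (θ : Euc m) :
    power P (fun n => (s n).indicator (1 : 𝓧 n → ℝ)) n θ = (P n θ : Measure (𝓧 n)).real (s n) :=
  integral_indicator_one (hs n)

theorem IsULAN.tendsto_measureReal (hULAN : IsULAN P Ξ Δ Γ) {ξ : Euc m} (hξ : ξ ∈ Ξ)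
    {t : ℕ → Euc m} (ht : IsLocalSeq Ξ ξ t) {F : Filter ℕ} (hF : F ≤ atTop) {τ : Euc m}
    (hτ : Tendsto (fun n : ℕ => √(n : ℝ) • (t n - ξ)) F (𝓝 τ))
    {A : Matrix (Fin k) (Fin m) ℝ} (hA : A * Γ ξ * Aᵀ = 1) {s : Set (Euc k)}
    (hs : MeasurableSet s)
    (h0 : stdGaussian (Euc k) {x | x + mulEuc (A * Γ ξ) τ ∈ frontier s} = 0) :
    Tendsto (fun n => (P n (t n) : Measure (𝓧 n)).real {x | mulEuc A (Δ n ξ x) ∈ s}) F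
      (𝓝 ((stdGaussian (Euc k)).real {x | x + mulEuc (A * Γ ξ) τ ∈ s})) := by
  have hp : IsProbabilityMeasure
      ((stdGaussian (Euc k)).map (fun x => x + mulEuc (A * Γ ξ) τ)) :=
    Measure.isProbabilityMeasure_map (by fun_prop)
  have h1 := (hULAN.tendstoInDistribution_shift hξ ht hF hτ hA rfl).tendsto_measureReal hs (by
    rw [Measure.map_apply (by fun_prop) isClosed_frontier.measurableSet]
    exact h0)
  rwa [measureReal_def, Measure.map_apply (by fun_prop) hs] at h1

theorem IsULAN.tendsto_measureReal_norm_sq [Nontrivial (Euc k)] (hULAN : IsULAN P Ξ Δ Γ)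
    {ξ : Euc m} (hξ : ξ ∈ Ξ) {t : ℕ → Euc m} (ht : IsLocalSeq Ξ ξ t) {F : Filter ℕ}
    (hF : F ≤ atTop) {τ : Euc m} (hτ : Tendsto (fun n : ℕ => √(n : ℝ) • (t n - ξ)) F (𝓝 τ))
    {A : Matrix (Fin k) (Fin m) ℝ} (hA : A * Γ ξ * Aᵀ = 1) (c : ℝ) :
    Tendsto (fun n => (P n (t n) : Measure (𝓧 n)).real {x | c < ‖mulEuc A (Δ n ξ x)‖ ^ 2}) F
      (𝓝 (normSqPower c (mulEuc (A * Γ ξ) τ))) := by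
  refine hULAN.tendsto_measureReal hξ ht hF hτ hA (s := {y | c < ‖y‖ ^ 2})
    (measurableSet_lt measurable_const (by fun_prop)) (measure_mono_null ?_
      (stdGaussian_norm_sq_eq (mulEuc (A * Γ ξ) τ) c))
  intro x hx
  exact (frontier_lt_subset_eq continuous_const (by fun_prop) hx).symm

theorem IsULAN.tendsto_measureReal_inner (hULAN : IsULAN P Ξ Δ Γ)
    {ξ : Euc m} (hξ : ξ ∈ Ξ) {t : ℕ → Euc m} (ht : IsLocalSeq Ξ ξ t) {F : Filter ℕ}
    (hF : F ≤ atTop) {τ : Euc m} (hτ : Tendsto (fun n : ℕ => √(n : ℝ) • (t n - ξ)) F (𝓝 τ))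
    {A : Matrix (Fin k) (Fin m) ℝ} (hA : A * Γ ξ * Aᵀ = 1) {u : Euc k} (hu : ‖u‖ = 1) (z : ℝ) :
    Tendsto (fun n => (P n (t n) : Measure (𝓧 n)).real {x | z < ⟪u, mulEuc A (Δ n ξ x)⟫}) F
      (𝓝 ((gaussianReal 0 1).real (Set.Ioi (z - ⟪u, mulEuc (A * Γ ξ) τ⟫)))) := by
  have hu0 : u ≠ 0 := by rintro rfl; simp at hu
  have h1 := hULAN.tendsto_measureReal hξ ht hF hτ hA (s := {y | z < ⟪u, y⟫})
    (measurableSet_lt measurable_const (by fun_prop)) (measure_mono_null (fun x hx =>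
      (frontier_lt_subset_eq continuous_const (by fun_prop) hx).symm)
      (stdGaussian_inner_eq hu0 (mulEuc (A * Γ ξ) τ) z))
  rwa [measureReal_def, show {x | x + mulEuc (A * Γ ξ) τ ∈ {y | z < ⟪u, y⟫}}
    = {x | z < ⟪u, x + mulEuc (A * Γ ξ) τ⟫} from rfl, stdGaussian_lt_inner hu,
    ← measureReal_def] at h1

/-- For directions in the range of `A'` the limiting likelihood ratio depends on the data only
through the whitened vector. The problem thus reduces to a standard Gaussian shift in dimension `k`.
-/
theorem exp_gaussianLogLR_transpose {G : Matrix (Fin m) (Fin m) ℝ} {A : Matrix (Fin k) (Fin m) ℝ}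
    (hA : A * G * Aᵀ = 1) (v : Euc k) (x : Euc m) :
    Real.exp (gaussianLogLR G (mulEuc Aᵀ v) x) = gaussianLR v (mulEuc A x) := by
  rw [gaussianLogLR, gaussianLR, inner_mulEuc, inner_mulEuc, Matrix.transpose_transpose,
    mulEuc_mulEuc, mulEuc_mulEuc, hA, mulEuc_one, real_inner_self_eq_norm_sq]

/-- The Neyman–Pearson bound on the mixed power of a test of given asymptotic level. -/
theorem IsULAN.eventually_sum_power_le (hULAN : IsULAN P Ξ Δ Γ) {ξ : Euc m} (hξ : ξ ∈ Ξ)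
    {A : Matrix (Fin k) (Fin m) ℝ} (hA : A * Γ ξ * Aᵀ = 1) {N : Set (Euc m)} (hN : N ⊆ Ξ) {α : ℝ}
    {ψ : ∀ n, 𝓧 n → ℝ} (hψ : ψ ∈ levelClass P N ξ α) {s : ℕ → Euc m} (hs : IsLocalSeq N ξ s)
    {F : Filter ℕ} (hF : F ≤ atTop) {J : Finset (Euc k)} {t : Euc k → ℕ → Euc m}
    (ht : ∀ j ∈ J, IsLocalSeq Ξ ξ (t j))
    (hτ : ∀ j ∈ J, Tendsto (fun n : ℕ => √(n : ℝ) • (t j n - s n)) F (𝓝 (mulEuc Aᵀ j)))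
    {w : Euc k → ℝ} (hw : ∀ j, 0 ≤ w j) (hw1 : ∑ j ∈ J, w j = 1) {K : ℝ} (hK : 0 ≤ K) {ε : ℝ}
    (hε : 0 < ε) :
    ∀ᶠ n in F, ∑ j ∈ J, w j * power P ψ n (t j n) ≤
      K * α + ∫ x, max (∑ j ∈ J, w j * gaussianLR j x - K) 0 ∂(stdGaussian (Euc k)) + ε := by
  have hG := hULAN.posSemidef_info ξ hξ
  have hsΞ := hs.mono hN
  have h1 := eventually_sum_integral_le_of_neymanPearson
    (S := fun j => gaussianLogLR (Γ ξ) (mulEuc Aᵀ j))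
    (R := fun j n => (P n (t j n) : Measure (𝓧 n)))
    (fun j => continuous_gaussianLogLR _ _) (hULAN.tendstoInDistribution_central hξ hsΞ hF)
    (fun n => hULAN.measurable_central n _ (hsΞ.1 n))
    (fun j _ => integrable_exp_gaussianLogLR hG _) (fun j _ => integral_exp_gaussianLogLR hG _)
    (fun j hj => hULAN.logLRApprox hξ hsΞ (ht j hj) hF (hτ j hj)) hw hw1 hK
    (fun n => (hψ.1 n).1) (fun n => (hψ.1 n).2)
    (fun ε hε => hF (limsup_coe_le_iff.1 (hψ.2 s hs) ε hε)) hε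
  have h2 : ∫ x, max (∑ j ∈ J, w j * Real.exp (gaussianLogLR (Γ ξ) (mulEuc Aᵀ j) x) - K) 0
      ∂(multivariateGaussian 0 (Γ ξ))
      = ∫ x, max (∑ j ∈ J, w j * gaussianLR j x - K) 0 ∂(stdGaussian (Euc k)) := by
    have hc : Continuous fun x : Euc k => max (∑ j ∈ J, w j * gaussianLR j x - K) 0 := by
      have := fun j : Euc k => continuous_gaussianLR j
      fun_prop
    rw [← multivariateGaussian_whitening hG hA,
      integral_map (by fun_prop) hc.measurable.aestronglyMeasurable]
    simp_rw [exp_gaussianLogLR_transpose hA]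
  rw [h2] at h1
  exact h1

end Power

/-! ### Stringency of the flat statistic -/

section Stringency

open scoped RealInnerProductSpace

variable {m l k : ℕ} {𝓧 : ℕ → Type*} [∀ n, MeasurableSpace (𝓧 n)]
  {P : ∀ n, Euc m → ProbabilityMeasure (𝓧 n)} {Ξ Ξ₀ : Set (Euc m)}
  {Δ : ∀ n, Euc m → 𝓧 n → Euc m} {Γ : Euc m → Matrix (Fin m) (Fin m) ℝ}

theorem IsLocalSeq.exists_tendsto_ultrafilter {d : ℕ} {S : Set (Euc d)} {θ : Euc d}
    {t : ℕ → Euc d} (ht : IsLocalSeq S θ t) (𝒰 : Ultrafilter ℕ) :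
    ∃ τ, Tendsto (fun n : ℕ => √(n : ℝ) • (t n - θ)) 𝒰 (𝓝 τ) := by
  obtain ⟨M, hM⟩ := ht.2
  exact CurvedULAN.exists_tendsto_ultrafilter (M := M) (fun n => by
    rw [norm_smul, Real.norm_of_nonneg (Real.sqrt_nonneg _)]; exact hM n) 𝒰

/-- Local null sequences do not shift the whitened central sequence. -/
theorem IsLocalChart.mulEuc_eq_zero {f : Euc l → Euc m} {B : Set (Euc l)}
    (hf : IsLocalChart f B Ξ₀) {x : Euc l} (hx : x ∈ B) {G : Matrix (Fin m) (Fin m) ℝ}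
    {A : Matrix (Fin k) (Fin m) ℝ} (hA : A * G * jacobian f x = 0) {F : Filter ℕ} [F.NeBot]
    {t : ℕ → Euc m} (ht : ∀ᶠ n in F, t n ∈ Ξ₀) (hlim : Tendsto t F (𝓝 (f x))) {τ : Euc m}
    (hτ : Tendsto (fun n : ℕ => √(n : ℝ) • (t n - f x)) F (𝓝 τ)) :
    mulEuc (A * G) τ = 0 := by
  obtain ⟨w, rfl⟩ := hf.exists_eq_mulEuc_of_tendsto hx ht hlim hτ
  rw [mulEuc_mulEuc, hA, mulEuc_zero_left]

theorem limsup_le_maxRegret {θ₀ : Euc m} {α : ℝ} {φ ψ : ∀ n, 𝓧 n → ℝ} {t : ℕ → Euc m}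
    (ht : IsLocalSeq (Ξ \ Ξ₀) θ₀ t) (hψ : ψ ∈ levelClass P Ξ₀ θ₀ α) :
    limsup (fun n => ((power P ψ n (t n) - power P φ n (t n) : ℝ) : EReal)) atTop
      ≤ maxRegret P Ξ Ξ₀ θ₀ α φ := by
  rw [maxRegret]
  refine le_trans ?_ (le_iSup₂ t ht)
  rw [regret]
  exact le_iSup₂ (f := fun ψ (_ : ψ ∈ levelClass P Ξ₀ θ₀ α) =>
    limsup (fun n => ((power P ψ n (t n) - power P φ n (t n) : ℝ) : EReal)) atTop) ψ hψ

variable {f : Euc l → Euc m} {B : Set (Euc l)} {x : Euc l} {A : Matrix (Fin k) (Fin m) ℝ}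

/-- The asymptotic power envelope under local alternatives. -/
theorem IsULAN.eventually_power_le (hULAN : IsULAN P Ξ Δ Γ) (hsub : Ξ₀ ⊆ Ξ)
    (hf : IsLocalChart f B Ξ₀) (hx : x ∈ B) (hfx : f x ∈ Ξ) (hΓ : (Γ (f x)).rank = m)
    (hA1 : A * Γ (f x) * Aᵀ = 1)
    (hA3 : Aᵀ * A = (Γ (f x))⁻¹ - jacobian f x * ((jacobian f x)ᵀ * Γ (f x) * jacobian f x)⁻¹ *
      (jacobian f x)ᵀ) {z α : ℝ} (hz : (gaussianReal 0 1).real (Set.Ioi z) = α)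
    {ψ : ∀ n, 𝓧 n → ℝ} (hψ : ψ ∈ levelClass P Ξ₀ (f x) α) {t : ℕ → Euc m}
    (ht : IsLocalSeq Ξ (f x) t) {F : Filter ℕ} (hF : F ≤ atTop) {τ : Euc m}
    (hτ : Tendsto (fun n : ℕ => √(n : ℝ) • (t n - f x)) F (𝓝 τ)) {ε : ℝ} (hε : 0 < ε) :
    ∀ᶠ n in F, power P ψ n (t n) ≤
      (gaussianReal 0 1).real (Set.Ioi (z - ‖mulEuc (A * Γ (f x)) τ‖)) + ε := by
  set v := mulEuc (A * Γ (f x)) τ with hv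
  -- The least favorable null sequence: its direction is the `Γ`-orthogonal projection of `τ` on the
  -- tangent space. What remains of `τ` is `A' A Γ τ = A' v`.
  obtain ⟨s, hs, hsl⟩ := hf.exists_isLocalSeq hx
    (mulEuc (((jacobian f x)ᵀ * Γ (f x) * jacobian f x)⁻¹ * (jacobian f x)ᵀ * Γ (f x)) τ)
  have hdiff : Tendsto (fun n : ℕ => √(n : ℝ) • (t n - s n)) F (𝓝 (mulEuc Aᵀ v)) := by
    have h1 := hτ.sub (hsl.mono_left hF)
    have h2 : mulEuc Aᵀ v = τ - mulEuc (jacobian f x) (mulEuc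
        (((jacobian f x)ᵀ * Γ (f x) * jacobian f x)⁻¹ * (jacobian f x)ᵀ * Γ (f x)) τ) := by
      rw [hv, mulEuc_mulEuc, ← Matrix.mul_assoc, hA3, Matrix.sub_mul,
        Matrix.nonsing_inv_mul _ (isUnit_det_of_rank_eq hΓ), sub_mulEuc, mulEuc_one,
        mulEuc_mulEuc]
      simp only [Matrix.mul_assoc]
    rw [h2]
    refine h1.congr fun n => ?_
    rw [← smul_sub, sub_sub_sub_cancel_right]
  -- A mixture with one component, with the multiplier for which the Gaussian duality is an
  -- equality.
  have h1 := hULAN.eventually_sum_power_le hfx hA1 hsub hψ hs hF (J := {v}) (t := fun _ => t)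
    (w := fun _ => 1) (fun _ _ => ht) (fun j hj => by rw [Finset.mem_singleton.1 hj]; exact hdiff)
    (fun _ => zero_le_one) (by simp) (Real.exp_pos (‖v‖ * z - ‖v‖ ^ 2 / 2)).le hε
  simp only [Finset.sum_singleton, one_mul] at h1
  rw [← hz, neymanPearson_gaussian] at h1
  exact h1

/-- Lower bound for the maximal regret of a test of given asymptotic level. -/
theorem IsULAN.le_maxRegret [Nontrivial (Euc k)] (hΞ : IsOpen Ξ) (hULAN : IsULAN P Ξ Δ Γ)
    (hsub : Ξ₀ ⊆ Ξ) (hf : IsLocalChart f B Ξ₀) (hx : x ∈ B) (hfx : f x ∈ Ξ₀)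
    (hA1 : A * Γ (f x) * Aᵀ = 1) (hA2 : A * Γ (f x) * jacobian f x = 0) {z c α : ℝ} (hα : α < 1)
    (hz : (gaussianReal 0 1).real (Set.Ioi z) = α) (hc : normSqPower c (0 : Euc k) = α)
    {ψ : ∀ n, 𝓧 n → ℝ} (hψ : ψ ∈ levelClass P Ξ₀ (f x) α) {v : Euc k} (hv : v ≠ 0) :
    (((gaussianReal 0 1).real (Set.Ioi (z - ‖v‖)) - normSqPower c v : ℝ) : EReal)
      ≤ maxRegret P Ξ Ξ₀ (f x) α ψ := by
  classical
  have hfΞ := hsub hfx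
  have hv0 : ‖v‖ ≠ 0 := norm_ne_zero_iff.2 hv
  refine EReal.ge_of_forall_gt_iff_ge.1 fun b hb => ?_
  have hb' := EReal.coe_lt_coe_iff.1 hb
  -- Three errors are allowed for: the finite mixture, the asymptotic power bound and the power of
  -- the competitor.
  obtain ⟨ε, hε, hbε⟩ : ∃ ε : ℝ, 0 < ε ∧
      b ≤ (gaussianReal 0 1).real (Set.Ioi (z - ‖v‖)) - normSqPower c v - 3 * ε :=
    ⟨((gaussianReal 0 1).real (Set.Ioi (z - ‖v‖)) - normSqPower c v - b) / 3, by linarith,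
      by linarith⟩
  obtain ⟨J, w, K, hJ, hw, hw1, hK, hmix⟩ := exists_finite_mixture hα hc v hε
  obtain ⟨C, hC, hCb⟩ := exists_norm_mulEuc_le Aᵀ
  have hJne : J.Nonempty := by
    rw [Finset.nonempty_iff_ne_empty]; rintro rfl; simp at hw1
  -- the local alternatives
  set y : Euc k → ℕ → Euc m := fun j n => f x + (√(n : ℝ))⁻¹ • mulEuc Aᵀ j with hy
  have hylim : ∀ j, Tendsto (fun n : ℕ => √(n : ℝ) • (y j n - f x)) atTop (𝓝 (mulEuc Aᵀ j)) :=
    fun j => tendsto_smul_add_smul_sub (t := fun _ => f x) (τ := fun _ => mulEuc Aᵀ j) le_rfl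
      tendsto_const_nhds
  have hy0 : ∀ j, Tendsto (y j) atTop (𝓝 (f x)) := by
    intro j
    have h1 : Tendsto (fun n : ℕ => (√(n : ℝ))⁻¹ • mulEuc Aᵀ j) atTop
        (𝓝 ((0 : ℝ) • mulEuc Aᵀ j)) :=
      (tendsto_inv_atTop_zero.comp (Real.tendsto_sqrt_atTop.comp
        tendsto_natCast_atTop_atTop)).smul_const _
    simpa [hy] using h1.const_add (f x)
  have hymem : ∀ j ∈ J, ∀ᶠ n in atTop, y j n ∈ Ξ \ Ξ₀ := by
    intro j hj
    have hj0 : j ≠ 0 := by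
      rintro rfl; exact hv0 (by rw [← hJ 0 hj, norm_zero])
    refine ((hy0 j).eventually (hΞ.mem_nhds hfΞ)).and ?_
    by_contra hcon
    -- If the alternatives met the null set infinitely often, then along these indices the limiting
    -- direction `A' j` would be tangent, and `j = A Γ A' j` would vanish.
    have hfr : ∃ᶠ n in atTop, y j n ∈ Ξ₀ := by
      simpa [Filter.Frequently, Set.mem_compl_iff] using hcon
    have : (atTop ⊓ 𝓟 {n | y j n ∈ Ξ₀} : Filter ℕ).NeBot :=
      frequently_mem_iff_neBot.1 hfr
    have h1 := hf.mulEuc_eq_zero hx hA2 (F := atTop ⊓ 𝓟 {n | y j n ∈ Ξ₀})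
      (mem_inf_of_right (mem_principal_self _)) ((hy0 j).mono_left inf_le_left)
      ((hylim j).mono_left inf_le_left)
    rw [mulEuc_mulEuc, hA1, mulEuc_one] at h1
    exact hj0 h1
  -- A filler for the indices at which `y j n` is not an alternative, as local sequences must lie in
  -- the set at every index.
  obtain ⟨y₀, hy₀⟩ : ∃ y₀, y₀ ∈ Ξ \ Ξ₀ := by
    obtain ⟨j, hj⟩ := hJne
    exact (hymem j hj).exists.imp' _ fun n hn => hn
  set t : Euc k → ℕ → Euc m := fun j n => if y j n ∈ Ξ \ Ξ₀ then y j n else y₀ with ht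
  have htmem : ∀ j n, t j n ∈ Ξ \ Ξ₀ := by
    intro j n
    by_cases h : y j n ∈ Ξ \ Ξ₀
    · simp only [ht, h, if_true]
    · simp only [ht, h, if_false]; exact hy₀
  have hty : ∀ j ∈ J, ∀ᶠ n in atTop, t j n = y j n := by
    intro j hj
    filter_upwards [hymem j hj] with n hn
    simp only [ht, hn, if_true]
  have htlim : ∀ j ∈ J, Tendsto (fun n : ℕ => √(n : ℝ) • (t j n - f x)) atTop
      (𝓝 (mulEuc Aᵀ j)) := fun j hj =>
    (hylim j).congr' ((hty j hj).mono fun n hn => by simp only [hn])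
  have htb : ∀ j ∈ J, ∀ᶠ n : ℕ in atTop, √(n : ℝ) * ‖t j n - f x‖ ≤ C * ‖v‖ + 1 := by
    intro j hj
    have h1 : ‖mulEuc Aᵀ j‖ < C * ‖v‖ + 1 := by
      have := hCb j; rw [hJ j hj] at this; linarith
    filter_upwards [(htlim j hj).norm.eventually_le_const h1] with n hn
    rwa [norm_smul, Real.norm_of_nonneg (Real.sqrt_nonneg _)] at hn
  have htloc : ∀ j ∈ J, IsLocalSeq (Ξ \ Ξ₀) (f x) (t j) := fun j hj =>
    isLocalSeq_of_eventually (htmem j) (htb j hj)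
  -- the least favorable one among them
  choose j hjJ hjmin using fun n => J.exists_min_image (fun j => power P ψ n (t j n)) hJne
  have htj : IsLocalSeq (Ξ \ Ξ₀) (f x) fun n => t (j n) n := by
    refine isLocalSeq_of_eventually (fun n => htmem _ n) (M := C * ‖v‖ + 1) ?_
    filter_upwards [(eventually_all_finset J).2 htb] with n hn
    exact hn _ (hjJ n)
  -- The smallest power is at most the mixed one. The constant null sequence suffices here, because
  -- the directions `A' j` have no tangential part to subtract.
  have hpow : ∀ᶠ n in atTop, power P ψ n (t (j n) n) ≤ normSqPower c v + 2 * ε := by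
    filter_upwards [hULAN.eventually_sum_power_le hfΞ hA1 hsub hψ (isLocalSeq_const hfx) le_rfl
      (fun j hj => (htloc j hj).mono Set.sdiff_subset) htlim hw hw1 hK hε] with n hn
    have h1 : power P ψ n (t (j n) n) ≤ ∑ i ∈ J, w i * power P ψ n (t i n) := by
      calc power P ψ n (t (j n) n) = ∑ i ∈ J, w i * power P ψ n (t (j n) n) := by
            rw [← Finset.sum_mul, hw1, one_mul]
        _ ≤ _ := Finset.sum_le_sum fun i hi => mul_le_mul_of_nonneg_left (hjmin n i hi) (hw i)
    linarith
  -- a competitor that is good against it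
  set u : Euc k → Euc k := fun j => ‖v‖⁻¹ • j with hu
  have hu1 : ∀ j ∈ J, ‖u j‖ = 1 := by
    intro j hj
    simp only [hu]
    rw [norm_smul, hJ j hj, norm_inv, norm_norm, inv_mul_cancel₀ hv0]
  set s : ∀ n, Set (𝓧 n) := fun n => {q | z < ⟪u (j n), mulEuc A (Δ n (f x) q)⟫} with hs
  have hsm : ∀ n, MeasurableSet (s n) := by
    intro n
    have h1 := (measurable_mulEuc A).comp (hULAN.measurable_central n _ hfΞ)
    exact measurableSet_lt measurable_const (h1.const_inner)
  -- The direction `j n` varies with `n` but only in the finite set `J`, and under null sequences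
  -- each linear test has limiting size `α`.
  have hlevel : (fun n => (s n).indicator (1 : 𝓧 n → ℝ)) ∈ levelClass P Ξ₀ (f x) α := by
    refine ⟨isTest_indicator hsm, fun t' ht' => limsup_coe_le_iff.2 fun δ hδ =>
      eventually_atTop_of_ultrafilter fun 𝒰 h𝒰 => ?_⟩
    obtain ⟨τ, hτ⟩ := ht'.exists_tendsto_ultrafilter 𝒰
    have h0 := hf.mulEuc_eq_zero hx hA2 (Eventually.of_forall ht'.1)
      (ht'.tendsto.mono_left h𝒰) hτ
    have h1 : ∀ i ∈ J, ∀ᶠ n in 𝒰, (P n (t' n) : Measure (𝓧 n)).real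
        {q | z < ⟪u i, mulEuc A (Δ n (f x) q)⟫} ≤ α + δ := by
      intro i hi
      have h2 := hULAN.tendsto_measureReal_inner hfΞ (ht'.mono hsub) h𝒰 hτ hA1 (hu1 i hi) z
      rw [h0, inner_zero_right, sub_zero, hz] at h2
      exact h2.eventually_le_const (by linarith)
    filter_upwards [(eventually_all_finset J).2 h1] with n hn
    rw [power_indicator hsm]
    exact hn _ (hjJ n)
  have hgood : ∀ᶠ n in atTop, (gaussianReal 0 1).real (Set.Ioi (z - ‖v‖)) - ε ≤
      power P (fun n => (s n).indicator (1 : 𝓧 n → ℝ)) n (t (j n) n) := by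
    have h1 : ∀ i ∈ J, ∀ᶠ n in atTop, (gaussianReal 0 1).real (Set.Ioi (z - ‖v‖)) - ε ≤
        (P n (t i n) : Measure (𝓧 n)).real {q | z < ⟪u i, mulEuc A (Δ n (f x) q)⟫} := by
      intro i hi
      have h2 := hULAN.tendsto_measureReal_inner hfΞ ((htloc i hi).mono Set.sdiff_subset) le_rfl
        (htlim i hi) hA1 (hu1 i hi) z
      have h3 : ⟪u i, mulEuc (A * Γ (f x)) (mulEuc Aᵀ i)⟫ = ‖v‖ := by
        rw [mulEuc_mulEuc, hA1, mulEuc_one]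
        simp only [hu]
        rw [real_inner_smul_left, real_inner_self_eq_norm_sq, hJ i hi]
        field_simp
      rw [h3] at h2
      exact h2.eventually_const_le (by linarith)
    filter_upwards [(eventually_all_finset J).2 h1] with n hn
    rw [power_indicator hsm]
    exact hn _ (hjJ n)
  refine le_trans (le_limsup_coe ?_) (limsup_le_maxRegret htj hlevel)
  filter_upwards [hpow, hgood] with n h1 h2
  linarith

/-- The chi-square test attains the lower bound for the maximal regret. -/
theorem IsULAN.isLocallyAsymptoticallyMostStringent [Nontrivial (Euc k)] (hΞ : IsOpen Ξ)
    (hULAN : IsULAN P Ξ Δ Γ) (hsub : Ξ₀ ⊆ Ξ) (hf : IsLocalChart f B Ξ₀) (hx : x ∈ B)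
    (hfx : f x ∈ Ξ₀) (hΓ : (Γ (f x)).rank = m)
    (hA1 : A * Γ (f x) * Aᵀ = 1) (hA2 : A * Γ (f x) * jacobian f x = 0)
    (hA3 : Aᵀ * A = (Γ (f x))⁻¹ - jacobian f x * ((jacobian f x)ᵀ * Γ (f x) * jacobian f x)⁻¹ *
      (jacobian f x)ᵀ) {α : ℝ} (hα0 : 0 < α) (hα : α < 1) :
    IsLocallyAsymptoticallyMostStringent P Ξ Ξ₀ (f x) α
      (chiSquareTest k α fun n q => ‖mulEuc A (Δ n (f x) q)‖ ^ 2) := by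
  have hfΞ := hsub hfx
  obtain ⟨z, hz⟩ := exists_gaussianReal_Ioi_eq hα0 hα
  have hc := normSqPower_chiSquareUpperQuantile (k := k) hα0 hα
  set c := chiSquareUpperQuantile k α
  have hsm : ∀ n, MeasurableSet {q | c < ‖mulEuc A (Δ n (f x) q)‖ ^ 2} := by
    intro n
    have h1 := (measurable_mulEuc A).comp (hULAN.measurable_central n _ hfΞ)
    exact measurableSet_lt measurable_const (h1.norm.pow_const 2)
  have hpow : ∀ n θ, power P (chiSquareTest k α fun n q => ‖mulEuc A (Δ n (f x) q)‖ ^ 2) n θ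
      = (P n θ : Measure (𝓧 n)).real {q | c < ‖mulEuc A (Δ n (f x) q)‖ ^ 2} := fun n θ =>
    power_indicator hsm n θ
  refine ⟨⟨isTest_indicator hsm, fun t ht => limsup_coe_le_iff.2 fun δ hδ =>
    eventually_atTop_of_ultrafilter fun 𝒰 h𝒰 => ?_⟩, fun ψ hψ => ?_⟩
  · obtain ⟨τ, hτ⟩ := ht.exists_tendsto_ultrafilter 𝒰
    have h0 := hf.mulEuc_eq_zero hx hA2 (Eventually.of_forall ht.1)
      (ht.tendsto.mono_left h𝒰) hτ
    have h1 := hULAN.tendsto_measureReal_norm_sq hfΞ (ht.mono hsub) h𝒰 hτ hA1 c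
    rw [h0, hc] at h1
    filter_upwards [h1.eventually_le_const (show α < α + δ by linarith)] with n hn
    rw [hpow]
    exact hn
  -- Along an ultrafilter the regret is at most the gap between envelope and chi-square power at the
  -- limiting shift `v`; the lower bound for `ψ` dominates this gap.
  · refine iSup₂_le fun t ht => iSup₂_le fun χ hχ => limsup_coe_le_of_ultrafilter fun 𝒰 h𝒰 => ?_
    have ht' := IsLocalSeq.mono ht Set.sdiff_subset
    obtain ⟨τ, hτ⟩ := ht'.exists_tendsto_ultrafilter 𝒰
    set v := mulEuc (A * Γ (f x)) τ with hv
    refine ⟨(gaussianReal 0 1).real (Set.Ioi (z - ‖v‖)) - normSqPower c v, ?_, fun ε hε => ?_⟩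
    · have hlow := fun v (hv : v ≠ 0) =>
        hULAN.le_maxRegret hΞ hsub hf hx hfx hA1 hA2 hα hz hc hψ (v := v) hv
      -- At `v = 0` the gap is `α - α = 0`. The lower bound needs a nonzero shift, and any one will
      -- do since its gap is nonnegative.
      by_cases hv0 : v = 0
      · obtain ⟨v', hv'⟩ := exists_ne (0 : Euc k)
        refine le_trans (EReal.coe_le_coe_iff.2 ?_) (hlow v' hv')
        have h1 := normSqPower_le_of_level_eq (hc.trans hz.symm) v'
        rw [hv0, norm_zero, sub_zero, hz, hc]
        linarith
      · exact hlow v hv0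
    · have h1 := (hULAN.tendsto_measureReal_norm_sq hfΞ ht' h𝒰 hτ hA1 c).eventually_const_le
        (show normSqPower c v - ε / 2 < normSqPower c v by linarith)
      filter_upwards [h1, hULAN.eventually_power_le hsub hf hx hfΞ hΓ hA1 hA3 hz hχ ht' h𝒰 hτ
        (half_pos hε)] with n hn1 hn2
      rw [hpow]
      linarith

/-- A submanifold of full dimension is a neighborhood of each of its points. -/
theorem IsLocalChart.mem_nhds_of_le (hf : IsLocalChart f B Ξ₀) (hx : x ∈ B) (hml : m ≤ l) :
    Ξ₀ ∈ 𝓝 (f x) := by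
  have hrk := hf.rank_jacobian x hx
  have hlm : m = l := le_antisymm hml (by
    rw [← hrk]; simpa using (jacobian f x).rank_le_height)
  subst hlm
  -- In equal dimensions the derivative of the chart is invertible, so the chart is open at `x`.
  have hsurj : (fderiv ℝ f x).range = ⊤ := by
    refine LinearMap.range_eq_top.2 fun y => ⟨mulEuc (jacobian f x)⁻¹ y, ?_⟩
    show fderiv ℝ f x _ = y
    rw [fderiv_eq_mulEuc, mulEuc_mulEuc,
      Matrix.mul_nonsing_inv _ (isUnit_det_of_rank_eq hrk), mulEuc_one]
  have h1 := (hasStrictFDerivAt_of_contDiffOn hf.contDiffOn hf.isOpen_source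
    hx).map_nhds_eq_of_surj hsurj
  rw [← h1]
  obtain ⟨U, -, hU⟩ := hf.isOpen_image
  refine mem_of_superset (image_mem_map (hf.isOpen_source.mem_nhds hx)) ?_
  rw [hU]
  exact Set.inter_subset_left

theorem IsULAN.isMostStringentStatistic_flatStatistic (hΞ : IsOpen Ξ)
    (hULAN : IsULAN P Ξ Δ Γ) (hsub : Ξ₀ ⊆ Ξ) (hf : IsLocalChart f B Ξ₀) (hx : x ∈ B)
    (hfx : f x ∈ Ξ₀) (hΓ : (Γ (f x)).rank = m) :
    IsMostStringentStatistic P Ξ Ξ₀ (f x) (m - l)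
      (fun n q => flatStatistic (Δ n (f x) q) (Γ (f x)) (jacobian f x)) := by
  intro α hα0 hα
  obtain ⟨A, hA1, hA2, hA3⟩ := exists_whitening (hULAN.posSemidef_info _ (hsub hfx)) hΓ
    (hf.rank_jacobian x hx)
  simp_rw [flatStatistic_eq_norm_sq hA3]
  -- For `m - l = 0` the statistic is identically `0` and its critical value nonnegative, so the
  -- test never rejects. The null set is then a neighborhood of the point, there are no local
  -- alternatives, and the maximal regret is a supremum over the empty set.
  rcases Nat.eq_zero_or_pos (m - l) with hk | hk
  · have hQ : ∀ n q, ‖mulEuc A (Δ n (f x) q)‖ ^ 2 = 0 := by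
      intro n q
      have : Subsingleton (Euc (m - l)) := by
        rw [hk]; infer_instance
      rw [Subsingleton.elim (mulEuc A (Δ n (f x) q)) 0, norm_zero]
      norm_num
    have htest : (chiSquareTest (m - l) α fun n q => ‖mulEuc A (Δ n (f x) q)‖ ^ 2)
        = fun n => (∅ : Set (𝓧 n)).indicator 1 := by
      funext n
      rw [chiSquareTest]
      congr 1
      ext q
      simp [hQ, chiSquareUpperQuantile_nonneg (m - l) hα]
    rw [htest]
    refine ⟨⟨isTest_indicator fun n => MeasurableSet.empty, fun t _ =>
      limsup_coe_le_iff.2 fun δ hδ => Eventually.of_forall fun n => ?_⟩, fun ψ _ => ?_⟩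
    · rw [power_indicator fun n => MeasurableSet.empty, measureReal_empty]
      linarith
    · refine iSup₂_le fun t ht => ?_
      have h1 := (IsLocalSeq.tendsto ht).eventually
        (hf.mem_nhds_of_le hx (Nat.sub_eq_zero_iff_le.1 hk))
      obtain ⟨n, hn⟩ := h1.exists
      exact absurd hn (ht.1 n).2
  · have : Nontrivial (Euc (m - l)) := by
      have : Nonempty (Fin (m - l)) := ⟨⟨0, hk⟩⟩
      infer_instance
    exact hULAN.isLocallyAsymptoticallyMostStringent hΞ hsub hf hx hfx hΓ hA1 hA2 hA3 hα0 hα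

end Stringency

/-! ### Invariance of stringency under reparametrization -/

section Transfer

variable {m p : ℕ} {𝓧 : ℕ → Type*} [∀ n, MeasurableSpace (𝓧 n)]
  {P : ∀ n, Euc m → ProbabilityMeasure (𝓧 n)} {Ξ N : Set (Euc m)} {h : Euc m → Euc p} {ξ : Euc m}

theorem power_curvedModel (φ : ∀ n, 𝓧 n → ℝ) (n : ℕ) (θ : Euc p) :
    power (curvedModel h Ξ P) φ n θ = power P φ n (Function.invFunOn h Ξ θ) := rfl

/-- Local null sequences correspond bijectively under `h`, with equal powers along them. -/
theorem levelClass_curvedModel (hΞ : IsOpen Ξ) (hh : ContDiffOn ℝ 1 h Ξ)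
    (hrank : ∀ ξ ∈ Ξ, (jacobian h ξ).rank = m) (hemb : IsEmbedding (Ξ.domRestrict h))
    (hN : N ⊆ Ξ) (hξ : ξ ∈ Ξ) (α : ℝ) :
    levelClass (curvedModel h Ξ P) (h '' N) (h ξ) α = levelClass P N ξ α := by
  ext φ
  refine and_congr_right fun _ => ⟨fun hφ s hs => ?_, fun hφ t ht => ?_⟩
  · have h1 := hφ _ (hs.image hΞ hh hξ)
    simp only [power_curvedModel,
      (injOn_of_isEmbedding hemb).leftInvOn_invFunOn (hN (hs.1 _))] at h1
    exact h1
  · exact hφ _ (ht.invFunOn hΞ hh hrank hemb hN hξ).1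

theorem maxRegret_curvedModel (hΞ : IsOpen Ξ) (hh : ContDiffOn ℝ 1 h Ξ)
    (hrank : ∀ ξ ∈ Ξ, (jacobian h ξ).rank = m) (hemb : IsEmbedding (Ξ.domRestrict h))
    (hN : N ⊆ Ξ) (hξ : ξ ∈ Ξ) (α : ℝ) (φ : ∀ n, 𝓧 n → ℝ) :
    maxRegret (curvedModel h Ξ P) (h '' Ξ) (h '' N) (h ξ) α φ = maxRegret P Ξ N ξ α φ := by
  have hdiff : h '' Ξ \ h '' N = h '' (Ξ \ N) :=
    ((injOn_of_isEmbedding hemb).image_sdiff_subset hN).symm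
  have hregret : ∀ t, regret (curvedModel h Ξ P) (h '' N) (h ξ) α φ t
      = regret P N ξ α φ fun n => Function.invFunOn h Ξ (t n) := by
    intro t
    rw [regret, regret, levelClass_curvedModel hΞ hh hrank hemb hN hξ]
    rfl
  rw [maxRegret, maxRegret, hdiff]
  refine le_antisymm (iSup₂_le fun t ht => ?_) (iSup₂_le fun s hs => ?_)
  · rw [hregret]
    exact le_iSup₂ (f := fun s (_ : s ∈ {s | IsLocalSeq (Ξ \ N) ξ s}) => regret P N ξ α φ s) _
      (IsLocalSeq.invFunOn hΞ hh hrank hemb Set.sdiff_subset hξ ht).1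
  · have h1 : regret P N ξ α φ s
        = regret (curvedModel h Ξ P) (h '' N) (h ξ) α φ fun n => h (s n) := by
      rw [hregret]
      congr 1
      funext n
      exact ((injOn_of_isEmbedding hemb).leftInvOn_invFunOn (hs.1 n).1).symm
    rw [h1]
    exact le_iSup₂ (f := fun t (_ : t ∈ {t | IsLocalSeq (h '' (Ξ \ N)) (h ξ) t}) =>
      regret (curvedModel h Ξ P) (h '' N) (h ξ) α φ t) _ (IsLocalSeq.image hΞ hh hξ hs)

theorem IsMostStringentStatistic.curvedModel (hΞ : IsOpen Ξ) (hh : ContDiffOn ℝ 1 h Ξ)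
    (hrank : ∀ ξ ∈ Ξ, (jacobian h ξ).rank = m) (hemb : IsEmbedding (Ξ.domRestrict h))
    (hN : N ⊆ Ξ) (hξ : ξ ∈ Ξ) {k : ℕ} {Q : ∀ n, 𝓧 n → ℝ}
    (hQ : IsMostStringentStatistic P Ξ N ξ k Q) :
    IsMostStringentStatistic (curvedModel h Ξ P) (h '' Ξ) (h '' N) (h ξ) k Q := by
  intro α hα0 hα
  have h1 := hQ α hα0 hα
  rw [IsLocallyAsymptoticallyMostStringent] at h1 ⊢
  simp only [levelClass_curvedModel hΞ hh hrank hemb hN hξ,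
    maxRegret_curvedModel hΞ hh hrank hemb hN hξ]
  exact h1

end Transfer

end CurvedULAN

/-! ### The proposition -/

theorem proposition3p2 {𝓧 : ℕ → Type*} [∀ n, MeasurableSpace (𝓧 n)] {m p r l : ℕ}
    -- the flat experiment, indexed by an open subset of `ℝ^m`, is ULAN with full-rank information
    (P : ∀ n, CurvedULAN.Euc m → ProbabilityMeasure (𝓧 n))
    (Ξ : Set (CurvedULAN.Euc m)) (hΞ : IsOpen Ξ)
    (Δ : ∀ n, CurvedULAN.Euc m → 𝓧 n → CurvedULAN.Euc m)
    (Γ : CurvedULAN.Euc m → Matrix (Fin m) (Fin m) ℝ)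
    (hULAN : CurvedULAN.IsULAN P Ξ Δ Γ)
    (hΓ : ∀ ξ ∈ Ξ, (Γ ξ).rank = m)
    -- the reparametrization `θ = h(ξ)` and the curved parameter space `Θ = h(Ξ)`
    (h : CurvedULAN.Euc m → CurvedULAN.Euc p)
    (hh : ContDiffOn ℝ 1 h Ξ)
    (hrank : ∀ ξ ∈ Ξ, (CurvedULAN.jacobian h ξ).rank = m)
    (hemb : IsEmbedding (Ξ.domRestrict h))
    (Θ : Set (CurvedULAN.Euc p)) (hΘ : Θ = h '' Ξ)
    -- the null hypothesis `θ ∈ C ∩ Θ`, that is, `ξ ∈ Ξ₀`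
    (C : Set (CurvedULAN.Euc p)) (hC : CurvedULAN.IsSubmanifold r C) (hrp : r < p)
    (Ξ₀ : Set (CurvedULAN.Euc m)) (hΞ₀ : Ξ₀ = {ξ ∈ Ξ | h ξ ∈ C ∩ Θ})
    (hΞ₀l : CurvedULAN.IsSubmanifold l Ξ₀)
    (ξ₀ : CurvedULAN.Euc m) (hξ₀ : ξ₀ ∈ Ξ₀)
    (θ₀ : CurvedULAN.Euc p) (hθ₀ : θ₀ = h ξ₀)
    -- a local chart of `Ξ₀` at `ξ₀`
    (lbar : CurvedULAN.Euc l → CurvedULAN.Euc m) (B : Set (CurvedULAN.Euc l))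
    (hlbar : CurvedULAN.IsLocalChart lbar B Ξ₀)
    (α₀ : CurvedULAN.Euc l) (hα₀ : α₀ ∈ B) (hlα₀ : lbar α₀ = ξ₀)
    -- a local chart, at `θ₀`, of the tangent at `θ₀` to `C ∩ Θ`
    (btilde : CurvedULAN.Euc l → CurvedULAN.Euc p) (A : Set (CurvedULAN.Euc l))
    (hbtilde : CurvedULAN.IsLocalChart btilde A (CurvedULAN.affineTangent (C ∩ Θ) θ₀))
    (η₀ : CurvedULAN.Euc l) (hη₀ : η₀ ∈ A) (hbη₀ : btilde η₀ = θ₀)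
    -- the central sequence, the information and the two statistics
    (Δθ : ∀ n, CurvedULAN.Euc p → 𝓧 n → CurvedULAN.Euc p)
    (hΔθ : Δθ = CurvedULAN.curvedCentral h Ξ Δ)
    (Γθ : CurvedULAN.Euc p → Matrix (Fin p) (Fin p) ℝ)
    (hΓθ : Γθ = CurvedULAN.curvedInfo h Ξ Γ)
    (Qξ₀ Qθ₀ : ∀ n, 𝓧 n → ℝ)
    (hQξ₀ : Qξ₀ = fun n x =>
      CurvedULAN.flatStatistic (Δ n ξ₀ x) (Γ ξ₀) (CurvedULAN.jacobian lbar α₀))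
    (hQθ₀ : Qθ₀ = fun n x =>
      CurvedULAN.curvedStatistic (Δθ n θ₀ x) (Γθ θ₀) (CurvedULAN.jacobian btilde η₀)) :
    -- the curved experiment is ULAN
    CurvedULAN.IsULAN (CurvedULAN.curvedModel h Ξ P) Θ Δθ Γθ ∧
    -- the two statistics coincide
    (∀ n x, Qξ₀ n x = Qθ₀ n x) ∧
    -- they are locally asymptotically most stringent, at `ξ₀` and at `θ₀`
    CurvedULAN.IsMostStringentStatistic P Ξ Ξ₀ ξ₀ (m - l) Qξ₀ ∧
    CurvedULAN.IsMostStringentStatistic (CurvedULAN.curvedModel h Ξ P) Θ (C ∩ Θ) θ₀ (m - l) Qθ₀ ∧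
    -- they are asymptotically chi-square with `m - l` degrees of freedom (and `l ≤ m`)
    l ≤ m ∧
    TendstoInDistribution Qξ₀ atTop id (fun n => (P n ξ₀ : Measure (𝓧 n)))
      (CurvedULAN.chiSquare (m - l)) ∧
    TendstoInDistribution Qθ₀ atTop id
      (fun n => (CurvedULAN.curvedModel h Ξ P n θ₀ : Measure (𝓧 n)))
      (CurvedULAN.chiSquare (m - l)) := by
  subst hΘ hθ₀ hΔθ hΓθ hQξ₀ hQθ₀ hlα₀
  have hsub : Ξ₀ ⊆ Ξ := by rw [hΞ₀]; exact fun ξ hξ => hξ.1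
  have hnull : C ∩ h '' Ξ = h '' Ξ₀ := by
    rw [hΞ₀]
    ext θ
    constructor
    · rintro ⟨hC, ξ, hξ, rfl⟩
      exact ⟨ξ, ⟨hξ, hC, ξ, hξ, rfl⟩, rfl⟩
    · rintro ⟨ξ, ⟨-, hξ⟩, rfl⟩
      exact hξ
  have hξΞ := hsub hξ₀
  have hinv := (CurvedULAN.injOn_of_isEmbedding hemb).leftInvOn_invFunOn hξΞ
  have hLrank := hlbar.rank_jacobian α₀ hα₀
  -- The curved null set is the image of the flat one, so its tangent can be computed from the chart
  -- `lbar`.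
  rw [hnull] at hbtilde ⊢
  obtain ⟨M, hM, hbM⟩ := CurvedULAN.exists_jacobian_eq_mul_mul hΞ hh hrank hemb hsub hlbar hα₀
    hξΞ hbtilde hη₀ hbη₀
  have hQ : ∀ n x, CurvedULAN.flatStatistic (Δ n (lbar α₀) x) (Γ (lbar α₀))
      (CurvedULAN.jacobian lbar α₀)
      = CurvedULAN.curvedStatistic (CurvedULAN.curvedCentral h Ξ Δ n (h (lbar α₀)) x)
        (CurvedULAN.curvedInfo h Ξ Γ (h (lbar α₀))) (CurvedULAN.jacobian btilde η₀) := by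
    intro n x
    rw [hbM, CurvedULAN.curvedCentral_eq_mulEuc, CurvedULAN.curvedInfo, hinv]
    exact (CurvedULAN.curvedStatistic_eq_flatStatistic (hULAN.posSemidef_info _ hξΞ)
      (hΓ _ hξΞ) hLrank (hrank _ hξΞ) hM rfl _).symm
  have hstringent := hULAN.isMostStringentStatistic_flatStatistic hΞ hsub hlbar hα₀ hξ₀ (hΓ _ hξΞ)
  have hchi := hULAN.tendstoInDistribution_flatStatistic hξΞ (hΓ _ hξΞ) hLrank
  -- Every claim about the curved statistic becomes one about the flat statistic.
  simp only [← hQ]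
  refine ⟨hULAN.curvedModel hΞ hh hrank hemb, fun _ _ => trivial, hstringent,
    hstringent.curvedModel hΞ hh hrank hemb hsub hξΞ, ?_, hchi, ?_⟩
  · rw [← hLrank]
    simpa using (CurvedULAN.jacobian lbar α₀).rank_le_height
  · simp only [CurvedULAN.curvedModel, hinv]
    exact hchi
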